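/- For $L>0$ and $0<\delta<1$ let $$A_\delta=\Big\{\rho\in L^\infty(0,L):\ \int_0^L\rho\,dx=1,\ \|\rho-L^{-1}\|_{L^\infty(0,L)}<\delta\Big\}.$$ Elements of $A_\delta$ that are nonnegative (all of them, if $\delta\le 1/L$) are identified with probability measures on $\mathbb R$, extending the density by zero outside $(0,L)$. For probability measures $\rho_0,\rho$ on $\mathbb R$ let $\Gamma(\rho_0,\rho)$ be the set of probability measures on $\mathbb R\times\mathbb R$ with first marginal $\rho_0$ and second marginal $\rho$. For $h>0$ put $$p_h(x,y)=\frac{1}{\sqrt{4\pi h}}\,e^{-(y-x)^2/(4h)},\qquad q_0(dx,dy)=\rho_0(dx)\,p_h(x,y)\,dy,\qquad J_h(\rho;\rho_0)=\inf_{q\in\Gamma(\rho_0,\rho)}H(q\,|\,q_0),$$ where $H(q\,|\,p)=\int \frac{dq}{dp}\log\frac{dq}{dp}\,dp\in[0,\infty]$ if $q\ll p$ and $H(q\,|\,p)=+\infty$ otherwise is the relative entropy. Let $$d(\rho_0,\rho)^2=\inf_{\gamma\in\Gamma(\rho_0,\rho)}\int (x-y)^2\,d\gamma(x,y)$$ be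 the squared 2-Wasserstein distance and $E(\rho)=\int_{\mathbb R}\rho\log\rho\,dx$. **Theorem.** For every $L>0$ there is $\delta_0\in(0,1)$ such that for every $\delta\in(0,\delta_0]$ and every $\rho_0\in A_\delta$ that is continuous on $[0,L]$ (that is, has a density continuous on $[0,L]$), the functionals $J_h(\,\cdot\,;\rho_0)-\frac1{4h}d(\,\cdot\,,\rho_0)^2$ Gamma-converge on $A_\delta$, as $h\to0$, with respect to the narrow topology (duality with bounded continuous functions), to $\frac12E(\cdot)-\frac12E(\rho_0)$. That is: 1. (Lower bound) for every $\rho\in A_\delta$ and every family $(\rho^h)_{h>0}\subset A_\delta$ converging narrowly to $\rho$ as $h\to0$, $$\liminf_{h\to0}\Big(J_h(\rho^h;\rho_0)-\frac1{4h}d(\rho^h,\rho_0)^2\Big)\ \ge\ \frac12E(\rho)-\frac12E(\rho_0);$$ 2. (Recovery sequence) for every $\rho\in A_\delta$ there is a family $(\rho^h)_{h>0}\subset A_\delta$ converging narrowly to $\rho$ as $h\to0$ such that $$\lim_{h\to0}\Big(J_h(\rho^h;\rho_0)-\frac1{4h}d(\rho^h,\rho_0)^2\Big)\ =\ \frac12E(\rho)-\frac12E(\rho_0).$$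 -/

import Mathlib

open MeasureTheory Set Filter Topology
open scoped ENNReal

noncomputable section

/-- The heat kernel `p_h(x,y) = (4 π h)^{-1/2} exp(-(y-x)²/(4h))` of Brownian motion with
generator `Δ`. -/
def heatKernel (h x y : ℝ) : ℝ :=
  1 / Real.sqrt (4 * Real.pi * h) * Real.exp (-(y - x) ^ 2 / (4 * h))

/-- The law `q₀(dx,dy) = ρ₀(dx) p_h(x,y) dy` of the initial and final position of a Brownian
particle started from `ρ₀`. -/
def brownianPairLaw (h : ℝ) (ρ₀ : Measure ℝ) : Measure (ℝ × ℝ) :=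
  (ρ₀.prod volume).withDensity fun z => ENNReal.ofReal (heatKernel h z.1 z.2)

/-- The set `Γ(ρ₀,ρ)` of pair measures (probability measures on `ℝ × ℝ`) with first marginal `ρ₀`
and second marginal `ρ`. -/
def couplings (ρ₀ ρ : Measure ℝ) : Set (Measure (ℝ × ℝ)) :=
  {q | IsProbabilityMeasure q ∧ q.map Prod.fst = ρ₀ ∧ q.map Prod.snd = ρ}

/-- The large-deviations rate functional `J_h(ρ; ρ₀) = inf H(q | q₀)` over the couplings `q` of
`ρ₀` and `ρ`. The relative entropy `H` is Mathlib's Kullback-Leibler divergence (equal to `+∞`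
when `q` is not absolutely continuous with respect to `q₀`). -/
def rateFunctional (h : ℝ) (ρ ρ₀ : Measure ℝ) : ℝ≥0∞ :=
  ⨅ q ∈ couplings ρ₀ ρ, InformationTheory.klDiv q (brownianPairLaw h ρ₀)

/-- The 2-Wasserstein distance `d(ρ₀,ρ₁)`, that is the square root of
`inf ∫ (x-y)² dγ(x,y)` over the couplings `γ` of `ρ₀` and `ρ₁`. -/
def wassersteinDist (ρ₀ ρ₁ : Measure ℝ) : ℝ≥0∞ :=
  (⨅ γ ∈ couplings ρ₀ ρ₁, ∫⁻ z, ENNReal.ofReal ((z.1 - z.2) ^ 2) ∂γ) ^ (1 / 2 : ℝ)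

/-- The entropy `E(ρ) = ∫_ℝ ρ log ρ dx` of an absolutely continuous measure, where `ρ` is identified
with its Lebesgue density. It is used only for measures with a bounded density supported in a
bounded interval, for which the integrand is integrable. -/
def entropy (ρ : Measure ℝ) : ℝ :=
  ∫ x, (ρ.rnDeriv volume x).toReal * Real.log (ρ.rnDeriv volume x).toReal

/-- `ρ` is the measure on `(0,L)` (extended by zero to `ℝ`) with Lebesgue density `f`. -/
def HasDensityOn (L : ℝ) (ρ : Measure ℝ) (f : ℝ → ℝ) : Prop :=
  ρ = (volume.restrict (Ioo 0 L)).withDensity fun x => ENNReal.ofReal (f x)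

/-- The set `A_δ` of probability measures on `(0,L)`, regarded as measures on `ℝ`, with a density
`f ∈ L^∞(0,L)` such that `∫ f = 1` and `‖f - L⁻¹‖_∞ < δ`. (Such an `f` is automatically nonnegative
almost everywhere: both `f` and its positive part have integral one.) -/
def nearUniform (L δ : ℝ) : Set (ProbabilityMeasure ℝ) :=
  {ρ | ∃ f : ℝ → ℝ, MemLp f ∞ (volume.restrict (Ioo 0 L)) ∧ ∫ x in Ioo 0 L, f x = 1 ∧
    eLpNorm (fun x => f x - L⁻¹) ∞ (volume.restrict (Ioo 0 L)) < ENNReal.ofReal δ ∧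
    HasDensityOn L ρ f}

/-- Gamma-convergence as `h ↓ 0`, in the subset `A` of a topological space, of a family of
functionals `F h`, `h > 0`, to the functional `G`: a lower bound along every convergent family in
`A`, and a recovery family in `A` for every limit point. -/
def GammaConvergesOn {X : Type*} [TopologicalSpace X] (A : Set X) (F : ℝ → X → EReal)
    (G : X → EReal) : Prop :=
  (∀ x ∈ A, ∀ u : ℝ → X, (∀ h > 0, u h ∈ A) → Tendsto u (𝓝[>] 0) (𝓝 x) →
    G x ≤ liminf (fun h => F h (u h)) (𝓝[>] 0)) ∧
  (∀ x ∈ A, ∃ u : ℝ → X, (∀ h > 0, u h ∈ A) ∧ Tendsto u (𝓝[>] 0) (𝓝 x) ∧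
    Tendsto (fun h => F h (u h)) (𝓝[>] 0) (𝓝 (G x)))

end

/-! For small `δ` all densities involved lie between two positive constants, so there is a
bi-Lipschitz monotone rearrangement `T` of `ρ₀` to `ρ`, extended by the identity outside `(0,L)`.
Let `φ` be a primitive of `T - id` and let `g_t` be its Hopf-Lax evolution, so that `g_1` and `φ`
are the dual potentials of the quadratic transport problem and `2 (∫ g_1 dρ - ∫ φ dρ₀) = d²`.

Lower bound. The inequality `J_h - d²/(4h) ≥ ½E(ρ) - ½E(ρ₀)` holds for every `h > 0`, without an
error term (`ofReal_le_rateFunctional`). By Donsker-Varadhan with the test function `½ log f(y) - ½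
log f₀(x) + (g_1(y) - φ(x))/(2h)` it suffices that the exponential of this function, restricted to
`y ∈ (0,L)`, has `q₀`-integral at most one. That integral is the pairing of `√f exp(g_1/(2h))` with
the heat flow `v`, at time `h`, of `√f₀ exp(-φ/(2h))`. Young's inequality bounds it by half of `∫ f
+ ∫ exp(g_1/h) v²`. The last integral is at most one because `∫ exp(g_t/h) v(ht)²` is nonincreasing
along the Hamilton-Jacobi equation (its derivative is minus an integrated square,
`antitoneOn_weighted_heatFlow`) and has upper limit at most `∫ f₀ = 1` as `t → 0`. The liminf
inequality follows since `E` is lower semicontinuous (`eventually_lt_entropy`).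

Upper bound. The constant family is a recovery sequence. Trial couplings are images of symmetric
self-couplings `k` of `ρ₀` under `(x,x') ↦ (x, T x')`. Symmetry gives `∫ k (x - T x')² = d² + ∫ k (x
- x')(T x - T x')`, so `d²/(4h)` separates exactly (`rateFunctional_le_ofReal`). With `k` close to a
Gaussian of variance `2hm(x)`, the remaining cost tends to `E(ρ) + ∫ (-½ log m - log f₀ + ½ m T' -
½) dρ₀`. The choice `m = 1/T'`, with `T' = f₀ / (f ∘ T)`, turns this into `½E(ρ) - ½E(ρ₀)`. As `T'`
is only measurable, `m` is a continuous `L¹` approximation of `1/T'`. The Gaussian is made symmetric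
by taking a minimum, scaled by `1 - ε`, and the missing mass is restored on blocks of length of
order `√h`, at a cost of order `ε (K - log ε)` in the limit (`rateFunctional_le_gaussMinKernel`). -/

noncomputable section

/-! ### The heat kernel, its derivatives and Gaussian bounds. -/

/-- The derivative of the heat kernel in its last variable. -/
def heatKernelDeriv (s x y : ℝ) : ℝ := -(y - x) / (2 * s) * heatKernel s x y

/-- The second derivative of the heat kernel in its last variable. -/
def heatKernelDeriv2 (s x y : ℝ) : ℝ :=
  ((y - x) ^ 2 / (4 * s ^ 2) - 1 / (2 * s)) * heatKernel s x y

lemma heatKernel_pos {s : ℝ} (hs : 0 < s) (x y : ℝ) : 0 < heatKernel s x y := by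
  unfold heatKernel; positivity

lemma hasDerivAt_heatKernel (s x y : ℝ) :
    HasDerivAt (fun y => heatKernel s x y) (heatKernelDeriv s x y) y := by
  unfold heatKernelDeriv heatKernel
  have h : HasDerivAt (fun y => -(y - x) ^ 2 / (4 * s)) (-(2 * (y - x)) / (4 * s)) y := by
    have := (((hasDerivAt_id y).sub_const x).pow 2).neg.div_const (4 * s)
    refine this.congr_deriv ?_
    simp
  refine (h.exp.const_mul _).congr_deriv ?_
  rw [show -(2 * (y - x)) / (4 * s) = -(y - x) / (2 * s) by
    rw [show 4 * s = 2 * (2 * s) by ring, ← mul_neg, mul_div_mul_left _ _ two_ne_zero]]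
  ring

lemma hasDerivAt_heatKernelDeriv {s : ℝ} (hs : 0 < s) (x y : ℝ) :
    HasDerivAt (fun y => heatKernelDeriv s x y) (heatKernelDeriv2 s x y) y := by
  have h1 : HasDerivAt (fun y => -(y - x) / (2 * s)) (-1 / (2 * s)) y :=
    ((hasDerivAt_id y).sub_const x).neg.div_const (2 * s)
  refine (h1.mul (hasDerivAt_heatKernel s x y)).congr_deriv ?_
  unfold heatKernelDeriv2 heatKernelDeriv
  field_simp
  ring

/-- This is the heat equation: the time derivative is the second space derivative, with no constant,
because the generator is `Δ` rather than `½Δ`. -/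
lemma hasDerivAt_heatKernel_time {s : ℝ} (hs : 0 < s) (x y : ℝ) :
    HasDerivAt (fun s => heatKernel s x y) (heatKernelDeriv2 s x y) s := by
  have hp : 0 < 4 * Real.pi * s := by positivity
  have hsq : 0 < Real.sqrt (4 * Real.pi * s) := Real.sqrt_pos.2 hp
  have h0 : HasDerivAt (fun s => 4 * Real.pi * s) (4 * Real.pi) s := by
    simpa using (hasDerivAt_id s).const_mul (4 * Real.pi)
  have h1 : HasDerivAt (fun s => 1 / Real.sqrt (4 * Real.pi * s))
      (-(1 / (2 * s)) * (1 / Real.sqrt (4 * Real.pi * s))) s := by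
    have := (h0.sqrt hp.ne').inv hsq.ne'
    simp only [one_div]
    refine this.congr_deriv ?_
    have hs2 : Real.sqrt (4 * Real.pi * s) ^ 2 = 4 * Real.pi * s := Real.sq_sqrt hp.le
    rw [hs2]
    field_simp
  have h2 : HasDerivAt (fun s => -(y - x) ^ 2 / (4 * s)) ((y - x) ^ 2 / (4 * s ^ 2)) s := by
    have h4 : HasDerivAt (fun s : ℝ => 4 * s) 4 s := by
      simpa using (hasDerivAt_id s).const_mul (4 : ℝ)
    have := (hasDerivAt_const s (-(y - x) ^ 2)).div h4 (by positivity)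
    refine this.congr_deriv ?_
    field_simp
    ring
  refine (h1.mul h2.exp).congr_deriv ?_
  unfold heatKernelDeriv2 heatKernel
  ring

lemma continuous_heatKernel_left (s y : ℝ) : Continuous fun x => heatKernel s x y := by
  unfold heatKernel; fun_prop

lemma continuous_heatKernelDeriv_left (s y : ℝ) : Continuous fun x => heatKernelDeriv s x y := by
  unfold heatKernelDeriv heatKernel; fun_prop

lemma continuous_heatKernelDeriv2_left (s y : ℝ) :
    Continuous fun x => heatKernelDeriv2 s x y := by
  unfold heatKernelDeriv2 heatKernel; fun_prop

/-- Locally uniform Gaussian bounds for the heat kernel and its derivatives. -/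
lemma exists_heatKernel_bounds (L : ℝ) {a b : ℝ} (ha : 0 < a) (hab : a ≤ b) :
    ∃ B β : ℝ, 0 < B ∧ 0 < β ∧ ∀ s ∈ Icc a b, ∀ x, |x| ≤ L → ∀ y,
      |heatKernel s x y| ≤ B * Real.exp (-β * y ^ 2) ∧
      |heatKernelDeriv s x y| ≤ B * Real.exp (-β * y ^ 2) ∧
      |heatKernelDeriv2 s x y| ≤ B * Real.exp (-β * y ^ 2) := by
  have hb : 0 < b := ha.trans_le hab
  set K : ℝ := 1 / Real.sqrt (4 * Real.pi * a) * Real.exp (L ^ 2 / (8 * b)) with hK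
  have hK0 : 0 < K := by positivity
  set N : ℝ := 1 + (1 + 8 * b) / (2 * a) + 5 / (2 * a) with hN
  refine ⟨K * N, 1 / (16 * b), by positivity, by positivity, ?_⟩
  rintro s ⟨has, hsb⟩ x hx y
  have hs : 0 < s := ha.trans_le has
  set u : ℝ := (y - x) ^ 2 / (4 * s) with hu
  have hu0 : 0 ≤ u := by positivity
  have hyx : (y - x) ^ 2 = 4 * s * u := by rw [hu]; field_simp
  have hhalf : Real.exp (-(u / 2)) ≤
      Real.exp (L ^ 2 / (8 * b)) * Real.exp (-(1 / (16 * b)) * y ^ 2) := by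
    rw [← Real.exp_add, Real.exp_le_exp]
    have h1 : (y - x) ^ 2 / (8 * b) ≤ u / 2 := by
      rw [hu, div_div]
      exact div_le_div_of_nonneg_left (sq_nonneg _) (by positivity) (by linarith)
    have hx2 : x ^ 2 ≤ L ^ 2 := sq_le_sq' (by linarith [(abs_le.1 hx).1]) (abs_le.1 hx).2
    -- The difference of `(y - x)²` and `y²/2 - x²` is the square `½ (y - 2x)²`.
    have h2 : (y ^ 2 / 2 - L ^ 2) / (8 * b) ≤ (y - x) ^ 2 / (8 * b) := by
      apply div_le_div_of_nonneg_right _ (by positivity)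
      nlinarith [sq_nonneg (y - 2 * x)]
    have h3 : (y ^ 2 / 2 - L ^ 2) / (8 * b) = 1 / (16 * b) * y ^ 2 - L ^ 2 / (8 * b) := by
      field_simp; ring
    linarith
  have hsq : 1 / Real.sqrt (4 * Real.pi * s) ≤ 1 / Real.sqrt (4 * Real.pi * a) := by
    apply one_div_le_one_div_of_le (by positivity)
    exact Real.sqrt_le_sqrt (by nlinarith [Real.pi_pos])
  -- The exponential is split in two halves: one absorbs the polynomial prefactor of the
  -- derivatives, through `u * e ≤ 2`, the other gives the decay in `y`.
  have hker : heatKernel s x y =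
      1 / Real.sqrt (4 * Real.pi * s) * Real.exp (-(u / 2)) * Real.exp (-(u / 2)) := by
    unfold heatKernel
    rw [mul_assoc (1 / Real.sqrt (4 * Real.pi * s)), ← Real.exp_add]
    congr 2
    rw [hu]; ring
  set e : ℝ := Real.exp (-(u / 2)) with he
  have he0 : 0 < e := Real.exp_pos _
  have he1 : e ≤ 1 := Real.exp_le_one_iff.2 (by linarith)
  have hue : u * e ≤ 2 := by
    have h1 : u / 2 + 1 ≤ Real.exp (u / 2) := Real.add_one_le_exp _
    have h2 : Real.exp (u / 2) * e = 1 := by rw [he, ← Real.exp_add]; simp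
    nlinarith
  set G : ℝ := Real.exp (-(1 / (16 * b)) * y ^ 2) with hG
  have hG0 : 0 < G := Real.exp_pos _
  have hbase : 1 / Real.sqrt (4 * Real.pi * s) * e ≤ K * G := by
    calc 1 / Real.sqrt (4 * Real.pi * s) * e
        ≤ 1 / Real.sqrt (4 * Real.pi * a) * (Real.exp (L ^ 2 / (8 * b)) * G) :=
          mul_le_mul hsq hhalf he0.le (by positivity)
      _ = K * G := by rw [hK]; ring
  have hpos := heatKernel_pos hs x y
  have key : ∀ c r : ℝ, 0 ≤ r → |c| * e ≤ r → r ≤ N → |c * heatKernel s x y| ≤ K * N * G := by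
    intro c r hr hc hrN
    rw [abs_mul, abs_of_pos hpos, hker]
    calc |c| * (1 / Real.sqrt (4 * Real.pi * s) * e * e)
        = (|c| * e) * (1 / Real.sqrt (4 * Real.pi * s) * e) := by ring
      _ ≤ r * (K * G) := mul_le_mul hc hbase (by positivity) hr
      _ ≤ N * (K * G) := by gcongr
      _ = K * N * G := by ring
  have hn1 : 0 ≤ (1 + 8 * b) / (2 * a) := by positivity
  have hn2 : 0 ≤ 5 / (2 * a) := by positivity
  refine ⟨?_, ?_, ?_⟩
  · have := key 1 1 zero_le_one (by simpa using he1) (by linarith)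
    simpa using this
  · refine key _ ((1 + 8 * b) / (2 * a)) hn1 ?_ (by linarith)
    rw [abs_div, abs_neg, abs_of_pos (by positivity : 0 < 2 * s), div_mul_eq_mul_div]
    have h1 : |y - x| ≤ 1 + 4 * s * u := by
      rw [← hyx, ← sq_abs]; nlinarith [sq_nonneg (|y - x| - 1), abs_nonneg (y - x)]
    have h2 : |y - x| * e ≤ 1 + 8 * b := by
      calc |y - x| * e ≤ (1 + 4 * s * u) * e := by gcongr
        _ = e + 4 * s * (u * e) := by ring
        _ ≤ 1 + 4 * s * 2 := by gcongr
        _ ≤ 1 + 8 * b := by linarith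
    calc |y - x| * e / (2 * s) ≤ (1 + 8 * b) / (2 * s) := by gcongr
      _ ≤ (1 + 8 * b) / (2 * a) := by gcongr
  · refine key _ (5 / (2 * a)) hn2 ?_ (by linarith)
    have h0 : (y - x) ^ 2 / (4 * s ^ 2) - 1 / (2 * s) = (u - 1 / 2) / s := by
      rw [hu]; field_simp
    rw [h0, abs_div, abs_of_pos hs, div_mul_eq_mul_div]
    have h1 : |u - 1 / 2| * e ≤ 5 / 2 := by
      have : |u - 1 / 2| ≤ u + 1 / 2 := by
        rw [abs_le]; constructor <;> linarith
      nlinarith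
    calc |u - 1 / 2| * e / s ≤ 5 / 2 / s := by gcongr
      _ ≤ 5 / 2 / a := by gcongr
      _ = 5 / (2 * a) := by rw [div_div]

/-! ### The heat flow of a finite measure with bounded support. -/

/-- The heat flow started from the measure `ν`. -/
def heatFlow (ν : Measure ℝ) (s y : ℝ) : ℝ := ∫ x, heatKernel s x y ∂ν

/-- The space derivative of the heat flow. -/
def heatFlowDeriv (ν : Measure ℝ) (s y : ℝ) : ℝ := ∫ x, heatKernelDeriv s x y ∂ν

/-- The second space derivative of the heat flow. -/
def heatFlowDeriv2 (ν : Measure ℝ) (s y : ℝ) : ℝ := ∫ x, heatKernelDeriv2 s x y ∂ν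

lemma heatFlow_nonneg (ν : Measure ℝ) {s : ℝ} (hs : 0 < s) (y : ℝ) : 0 ≤ heatFlow ν s y :=
  integral_nonneg fun x => (heatKernel_pos hs x y).le

section HeatFlow

variable {ν : Measure ℝ} [IsFiniteMeasure ν] {L : ℝ}

lemma exists_heatFlow_bounds (hν : ∀ᵐ x ∂ν, |x| ≤ L) {a b : ℝ} (ha : 0 < a) (hab : a ≤ b) :
    ∃ B β : ℝ, 0 ≤ B ∧ 0 < β ∧ ∀ s ∈ Icc a b, ∀ y,
      |heatFlow ν s y| ≤ B * Real.exp (-β * y ^ 2) ∧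
      |heatFlowDeriv ν s y| ≤ B * Real.exp (-β * y ^ 2) ∧
      |heatFlowDeriv2 ν s y| ≤ B * Real.exp (-β * y ^ 2) := by
  obtain ⟨B, β, hB, hβ, h⟩ := exists_heatKernel_bounds L ha hab
  refine ⟨B * ν.real univ, β, by positivity, hβ, fun s hs y => ?_⟩
  have key : ∀ f : ℝ → ℝ, (∀ x, |x| ≤ L → |f x| ≤ B * Real.exp (-β * y ^ 2)) →
      |∫ x, f x ∂ν| ≤ B * ν.real univ * Real.exp (-β * y ^ 2) := by
    intro f hf
    have := norm_integral_le_of_norm_le_const (μ := ν) (f := f) (C := B * Real.exp (-β * y ^ 2))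
      (by filter_upwards [hν] with x hx using hf x hx)
    calc |∫ x, f x ∂ν| ≤ B * Real.exp (-β * y ^ 2) * ν.real univ := this
      _ = _ := by ring
  exact ⟨key _ fun x hx => (h s hs x hx y).1, key _ fun x hx => (h s hs x hx y).2.1,
    key _ fun x hx => (h s hs x hx y).2.2⟩

lemma integrable_of_bound (hν : ∀ᵐ x ∂ν, |x| ≤ L) {f : ℝ → ℝ} (hf : Continuous f) {B : ℝ}
    (h : ∀ x, |x| ≤ L → |f x| ≤ B) : Integrable f ν := by
  refine Integrable.of_bound hf.aestronglyMeasurable B ?_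
  filter_upwards [hν] with x hx using h x hx

lemma exp_neg_mul_sq_le_one {β : ℝ} (hβ : 0 < β) (y : ℝ) : Real.exp (-β * y ^ 2) ≤ 1 :=
  Real.exp_le_one_iff.2 (by nlinarith [sq_nonneg y])

lemma hasDerivAt_heatFlow (hν : ∀ᵐ x ∂ν, |x| ≤ L) {s : ℝ} (hs : 0 < s) (y : ℝ) :
    HasDerivAt (heatFlow ν s) (heatFlowDeriv ν s y) y := by
  obtain ⟨B, β, hB, hβ, h⟩ := exists_heatKernel_bounds L hs le_rfl
  have hm : s ∈ Icc s s := ⟨le_rfl, le_rfl⟩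
  have hB1 : ∀ y, B * Real.exp (-β * y ^ 2) ≤ B := fun y =>
    mul_le_of_le_one_right hB.le (exp_neg_mul_sq_le_one hβ y)
  refine (hasDerivAt_integral_of_dominated_loc_of_deriv_le (bound := fun _ => B) (s := univ)
    (F := fun y x => heatKernel s x y) (F' := fun y x => heatKernelDeriv s x y) univ_mem
    (Eventually.of_forall fun y => (continuous_heatKernel_left s y).aestronglyMeasurable)
    (integrable_of_bound hν (continuous_heatKernel_left s y)
      fun x hx => ((h s hm x hx y).1.trans (hB1 y)))
    (continuous_heatKernelDeriv_left s y).aestronglyMeasurable ?_ (integrable_const _) ?_).2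
  · filter_upwards [hν] with x hx y _ using ((h s hm x hx y).2.1.trans (hB1 y))
  · exact Eventually.of_forall fun x y _ => hasDerivAt_heatKernel s x y

lemma hasDerivAt_heatFlowDeriv (hν : ∀ᵐ x ∂ν, |x| ≤ L) {s : ℝ} (hs : 0 < s) (y : ℝ) :
    HasDerivAt (heatFlowDeriv ν s) (heatFlowDeriv2 ν s y) y := by
  obtain ⟨B, β, hB, hβ, h⟩ := exists_heatKernel_bounds L hs le_rfl
  have hm : s ∈ Icc s s := ⟨le_rfl, le_rfl⟩
  have hB1 : ∀ y, B * Real.exp (-β * y ^ 2) ≤ B := fun y =>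
    mul_le_of_le_one_right hB.le (exp_neg_mul_sq_le_one hβ y)
  refine (hasDerivAt_integral_of_dominated_loc_of_deriv_le (bound := fun _ => B) (s := univ)
    (F := fun y x => heatKernelDeriv s x y) (F' := fun y x => heatKernelDeriv2 s x y) univ_mem
    (Eventually.of_forall fun y => (continuous_heatKernelDeriv_left s y).aestronglyMeasurable)
    (integrable_of_bound hν (continuous_heatKernelDeriv_left s y)
      fun x hx => ((h s hm x hx y).2.1.trans (hB1 y)))
    (continuous_heatKernelDeriv2_left s y).aestronglyMeasurable ?_ (integrable_const _) ?_).2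
  · filter_upwards [hν] with x hx y _ using ((h s hm x hx y).2.2.trans (hB1 y))
  · exact Eventually.of_forall fun x y _ => hasDerivAt_heatKernelDeriv hs x y

lemma hasDerivAt_heatFlow_time (hν : ∀ᵐ x ∂ν, |x| ≤ L) {s : ℝ} (hs : 0 < s) (y : ℝ) :
    HasDerivAt (fun s => heatFlow ν s y) (heatFlowDeriv2 ν s y) s := by
  -- The time interval stays away from the singularity of the kernel at time zero, so one constant
  -- dominates.
  obtain ⟨B, β, hB, hβ, h⟩ := exists_heatKernel_bounds L (half_pos hs)
    (by linarith : s / 2 ≤ 2 * s)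
  have hm : s ∈ Icc (s / 2) (2 * s) := ⟨by linarith, by linarith⟩
  have hB1 : ∀ y, B * Real.exp (-β * y ^ 2) ≤ B := fun y =>
    mul_le_of_le_one_right hB.le (exp_neg_mul_sq_le_one hβ y)
  refine (hasDerivAt_integral_of_dominated_loc_of_deriv_le (bound := fun _ => B)
    (s := Icc (s / 2) (2 * s))
    (F := fun s x => heatKernel s x y) (F' := fun s x => heatKernelDeriv2 s x y)
    (Icc_mem_nhds (by linarith) (by linarith))
    (Eventually.of_forall fun s => (continuous_heatKernel_left s y).aestronglyMeasurable)
    (integrable_of_bound hν (continuous_heatKernel_left s y)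
      fun x hx => ((h s hm x hx y).1.trans (hB1 y)))
    (continuous_heatKernelDeriv2_left s y).aestronglyMeasurable ?_ (integrable_const _) ?_).2
  · filter_upwards [hν] with x hx s hs' using ((h s hs' x hx y).2.2.trans (hB1 y))
  · exact Eventually.of_forall fun x s' hs' =>
      hasDerivAt_heatKernel_time (lt_of_lt_of_le (half_pos hs) hs'.1) x y

lemma continuous_heatFlow (hν : ∀ᵐ x ∂ν, |x| ≤ L) {s : ℝ} (hs : 0 < s) :
    Continuous (heatFlow ν s) :=
  continuous_iff_continuousAt.2 fun y => (hasDerivAt_heatFlow hν hs y).continuousAt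

lemma continuous_heatFlowDeriv (hν : ∀ᵐ x ∂ν, |x| ≤ L) {s : ℝ} (hs : 0 < s) :
    Continuous (heatFlowDeriv ν s) :=
  continuous_iff_continuousAt.2 fun y => (hasDerivAt_heatFlowDeriv hν hs y).continuousAt

lemma continuous_heatFlowDeriv2 (hν : ∀ᵐ x ∂ν, |x| ≤ L) {s : ℝ} (hs : 0 < s) :
    Continuous (heatFlowDeriv2 ν s) := by
  obtain ⟨B, β, hB, hβ, h⟩ := exists_heatKernel_bounds L hs le_rfl
  refine continuous_of_dominated (bound := fun _ => B)
    (fun y => (continuous_heatKernelDeriv2_left s y).aestronglyMeasurable) (fun y => ?_)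
    (integrable_const _) (Eventually.of_forall fun x => ?_)
  · filter_upwards [hν] with x hx
    exact (h s ⟨le_rfl, le_rfl⟩ x hx y).2.2.trans
      (mul_le_of_le_one_right hB.le (exp_neg_mul_sq_le_one hβ y))
  · unfold heatKernelDeriv2 heatKernel; fun_prop

end HeatFlow


/-! ### Monotonicity of the weighted norm along the Hamilton-Jacobi equation. -/

/-- A Gaussian bound for a continuous function implies integrability. -/
lemma integrable_of_gaussian_bound {f : ℝ → ℝ} (hf : Continuous f) {B β : ℝ} (hβ : 0 < β)
    (h : ∀ y, |f y| ≤ B * Real.exp (-β * y ^ 2)) : Integrable f :=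
  ((integrable_exp_neg_mul_sq hβ).const_mul B).mono' hf.aestronglyMeasurable
    (Eventually.of_forall h)

lemma abs_mul_gaussian_le {u v B β y : ℝ} (hβ : 0 < β) (hB : 0 ≤ B)
    (hu : |u| ≤ B * Real.exp (-β * y ^ 2)) (hv : |v| ≤ B * Real.exp (-β * y ^ 2)) :
    |u * v| ≤ B ^ 2 * Real.exp (-β * y ^ 2) := by
  rw [abs_mul]
  have h1 := exp_neg_mul_sq_le_one hβ y
  have h0 := Real.exp_pos (-β * y ^ 2)
  calc |u| * |v| ≤ (B * Real.exp (-β * y ^ 2)) * (B * Real.exp (-β * y ^ 2)) := by gcongr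
    _ = B ^ 2 * (Real.exp (-β * y ^ 2) * Real.exp (-β * y ^ 2)) := by ring
    _ ≤ B ^ 2 * (Real.exp (-β * y ^ 2) * 1) := by gcongr
    _ = _ := by ring

/-- Along a solution `g` of the Hamilton-Jacobi equation `∂ₜ g + (∂ₓ g)² / 2 = 0`, the
`L²` norm of the heat flow with weight `exp (g / h)` is nonincreasing. -/
lemma antitoneOn_weighted_heatFlow {ν : Measure ℝ} [IsFiniteMeasure ν] {L : ℝ}
    (hν : ∀ᵐ x ∂ν, |x| ≤ L) {h t₁ M : ℝ} (hh : 0 < h) {g p : ℝ → ℝ → ℝ}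
    (hg : ∀ t ∈ Ioo 0 t₁, ∀ y, |g t y| ≤ M) (hp : ∀ t ∈ Ioo 0 t₁, ∀ y, |p t y| ≤ M)
    (hpc : ∀ t ∈ Ioo 0 t₁, Continuous (p t))
    (hgy : ∀ t ∈ Ioo 0 t₁, ∀ y, HasDerivAt (g t) (p t y) y)
    (hgt : ∀ t ∈ Ioo 0 t₁, ∀ y, HasDerivAt (fun t => g t y) (-(p t y) ^ 2 / 2) t) :
    AntitoneOn (fun t => ∫ y, Real.exp (g t y / h) * heatFlow ν (h * t) y ^ 2) (Ioo 0 t₁) := by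
  -- The time derivative of the integrand, with `∂ₜ g` replaced by the Hamilton-Jacobi equation and
  -- `∂ₜ v` by the heat equation. The factor `h` in front of `v''` comes from the time `h * t`.
  set D : ℝ → ℝ → ℝ := fun t y => Real.exp (g t y / h) *
    (-(p t y) ^ 2 / (2 * h) * heatFlow ν (h * t) y ^ 2
      + 2 * h * (heatFlow ν (h * t) y * heatFlowDeriv2 ν (h * t) y)) with hD
  have hgc : ∀ t ∈ Ioo 0 t₁, Continuous (g t) := fun t ht =>
    continuous_iff_continuousAt.2 fun y => (hgy t ht y).continuousAt
  have hA : ∀ t ∈ Ioo 0 t₁, ∀ y, Real.exp (g t y / h) ≤ Real.exp (M / h) := fun t ht y => by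
    gcongr; exact (abs_le.1 (hg t ht y)).2
  have hvc : ∀ t ∈ Ioo 0 t₁, Continuous (heatFlow ν (h * t)) := fun t ht =>
    continuous_heatFlow hν (mul_pos hh ht.1)
  have hv1c : ∀ t ∈ Ioo 0 t₁, Continuous (heatFlowDeriv ν (h * t)) := fun t ht =>
    continuous_heatFlowDeriv hν (mul_pos hh ht.1)
  have hv2c : ∀ t ∈ Ioo 0 t₁, Continuous (heatFlowDeriv2 ν (h * t)) := fun t ht =>
    continuous_heatFlowDeriv2 hν (mul_pos hh ht.1)
  have hp2 : ∀ t ∈ Ioo 0 t₁, ∀ y, p t y ^ 2 ≤ M ^ 2 := fun t ht y =>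
    sq_le_sq' (abs_le.1 (hp t ht y)).1 (abs_le.1 (hp t ht y)).2
  have hderiv : ∀ t ∈ Ioo 0 t₁, Integrable (D t) ∧
      HasDerivAt (fun t => ∫ y, Real.exp (g t y / h) * heatFlow ν (h * t) y ^ 2)
        (∫ y, D t y) t := by
    intro t ht
    obtain ⟨B, β, hB, hβ, hbd⟩ := exists_heatFlow_bounds (L := L) hν
      (a := h * (t / 2)) (b := h * ((t + t₁) / 2)) (mul_pos hh (half_pos ht.1))
      (by have := ht.2; have := ht.1; gcongr; linarith)
    have hsub : Icc (t / 2) ((t + t₁) / 2) ⊆ Ioo 0 t₁ := fun s hs =>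
      ⟨by linarith [hs.1, ht.1], by linarith [hs.2, ht.2]⟩
    have hmem : ∀ s ∈ Icc (t / 2) ((t + t₁) / 2), h * s ∈ Icc (h * (t / 2)) (h * ((t + t₁) / 2)) :=
      fun s hs => ⟨by gcongr; exact hs.1, by gcongr; exact hs.2⟩
    have htm : t ∈ Icc (t / 2) ((t + t₁) / 2) := ⟨by linarith [ht.1], by linarith [ht.2]⟩
    have hnhds : Icc (t / 2) ((t + t₁) / 2) ∈ 𝓝 t :=
      Icc_mem_nhds (by linarith [ht.1]) (by linarith [ht.2])
    refine hasDerivAt_integral_of_dominated_loc_of_deriv_le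
      (bound := fun y => Real.exp (M / h) * ((M ^ 2 / (2 * h) + 2 * h) * B ^ 2) *
        Real.exp (-β * y ^ 2))
      (F := fun t y => Real.exp (g t y / h) * heatFlow ν (h * t) y ^ 2) (F' := D)
      hnhds ?_ ?_ ?_ ?_ ?_ ?_
    · filter_upwards [hnhds] with s hs
      have h1 := hgc s (hsub hs)
      have h2 := hvc s (hsub hs)
      exact Continuous.aestronglyMeasurable (by fun_prop)
    · have h1 := hgc t ht
      have h2 := hvc t ht
      refine integrable_of_gaussian_bound (B := Real.exp (M / h) * B ^ 2) (by fun_prop) hβ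
        fun y => ?_
      rw [abs_mul, abs_of_pos (Real.exp_pos _), mul_assoc]
      have h3 := (hbd _ (hmem t htm) y).1
      rw [pow_two (heatFlow ν (h * t) y)]
      exact mul_le_mul (hA t ht y) (abs_mul_gaussian_le hβ hB h3 h3) (abs_nonneg _)
        (Real.exp_pos _).le
    · have h1 := hgc t ht
      have h2 := hvc t ht
      have h3 := hv2c t ht
      have h4 := hpc t ht
      exact Continuous.aestronglyMeasurable (by simp only [hD]; fun_prop)
    · refine Eventually.of_forall fun y s hs => ?_
      simp only [hD]
      have h3 := (hbd _ (hmem s hs) y).1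
      have h5 := (hbd _ (hmem s hs) y).2.2
      rw [Real.norm_eq_abs, abs_mul, abs_of_pos (Real.exp_pos _), mul_assoc (Real.exp (M / h))]
      refine mul_le_mul (hA s (hsub hs) y) ?_ (abs_nonneg _) (Real.exp_pos _).le
      have e1 := abs_mul_gaussian_le hβ hB h3 h3
      have e2 := abs_mul_gaussian_le hβ hB h3 h5
      rw [← pow_two] at e1
      refine (abs_add_le _ _).trans ?_
      rw [abs_mul, abs_mul (2 * h), abs_of_pos (by positivity : 0 < 2 * h), abs_div, abs_neg,
        abs_of_pos (by positivity : 0 < 2 * h), abs_of_nonneg (sq_nonneg (p s y))]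
      have hps := hp2 s (hsub hs) y
      calc p s y ^ 2 / (2 * h) * |heatFlow ν (h * s) y ^ 2| +
            2 * h * |heatFlow ν (h * s) y * heatFlowDeriv2 ν (h * s) y|
          ≤ M ^ 2 / (2 * h) * (B ^ 2 * Real.exp (-β * y ^ 2)) +
            2 * h * (B ^ 2 * Real.exp (-β * y ^ 2)) := by gcongr
        _ = _ := by ring
    · exact (integrable_exp_neg_mul_sq hβ).const_mul _
    · refine Eventually.of_forall fun y s hs => ?_
      have h1 := ((hgt s (hsub hs) y).div_const h).exp
      have h0 : HasDerivAt (fun s => h * s) h s := by simpa using (hasDerivAt_id s).const_mul h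
      have h2 := ((hasDerivAt_heatFlow_time hν (mul_pos hh (hsub hs).1) y).comp s h0).pow 2
      refine (h1.mul h2).congr_deriv ?_
      simp only [hD, Function.comp, Pi.pow_apply]
      field_simp
      ring
  refine antitoneOn_of_deriv_nonpos (convex_Ioo _ _)
    (fun t ht => (hderiv t ht).2.continuousAt.continuousWithinAt) ?_ ?_
  · rw [interior_Ioo]
    exact fun t ht => (hderiv t ht).2.differentiableAt.differentiableWithinAt
  rw [interior_Ioo]
  intro t ht
  rw [(hderiv t ht).2.deriv]
  have hs : 0 < h * t := mul_pos hh ht.1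
  obtain ⟨B, β, hB, hβ, hbd⟩ := exists_heatFlow_bounds (L := L) hν hs le_rfl
  have hbd' := hbd _ ⟨le_rfl, le_rfl⟩
  have h1 := hgc t ht
  have h2 := hvc t ht
  have h3 := hv1c t ht
  have h4 := hv2c t ht
  have h5 := hpc t ht
  set W' : ℝ → ℝ := fun y => Real.exp (g t y / h) *
    (p t y / h * (heatFlow ν (h * t) y * heatFlowDeriv ν (h * t) y)
      + (heatFlowDeriv ν (h * t) y * heatFlowDeriv ν (h * t) y
        + heatFlow ν (h * t) y * heatFlowDeriv2 ν (h * t) y)) with hW'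
  have hWint : Integrable fun y => Real.exp (g t y / h) *
      (heatFlow ν (h * t) y * heatFlowDeriv ν (h * t) y) := by
    refine integrable_of_gaussian_bound (B := Real.exp (M / h) * B ^ 2) (by fun_prop) hβ
      fun y => ?_
    rw [abs_mul, abs_of_pos (Real.exp_pos _), mul_assoc]
    exact mul_le_mul (hA t ht y) (abs_mul_gaussian_le hβ hB (hbd' y).1 (hbd' y).2.1)
      (abs_nonneg _) (Real.exp_pos _).le
  have hW'int : Integrable W' := by
    refine integrable_of_gaussian_bound (B := Real.exp (M / h) * ((M / h + 2) * B ^ 2))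
      (by simp only [hW']; fun_prop) hβ fun y => ?_
    simp only [hW']
    rw [abs_mul, abs_of_pos (Real.exp_pos _), mul_assoc]
    refine mul_le_mul (hA t ht y) ?_ (abs_nonneg _) (Real.exp_pos _).le
    have e1 := abs_mul_gaussian_le hβ hB (hbd' y).1 (hbd' y).2.1
    have e2 := abs_mul_gaussian_le hβ hB (hbd' y).2.1 (hbd' y).2.1
    have e3 := abs_mul_gaussian_le hβ hB (hbd' y).1 (hbd' y).2.2
    refine (abs_add_le _ _).trans ((add_le_add_right (abs_add_le _ _) _).trans ?_)
    rw [abs_mul, abs_div, abs_of_pos hh]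
    have hM := hp t ht y
    calc _ ≤ M / h * (B ^ 2 * Real.exp (-β * y ^ 2)) +
          (B ^ 2 * Real.exp (-β * y ^ 2) + B ^ 2 * Real.exp (-β * y ^ 2)) := by
            have : 0 ≤ M := (abs_nonneg _).trans hM
            gcongr
      _ = _ := by ring
  have hW0 : ∫ y, W' y = 0 := by
    refine integral_eq_zero_of_hasDerivAt_of_integrable (fun y => ?_) hW'int hWint
    have d1 := ((hgy t ht y).div_const h).exp
    have d2 := (hasDerivAt_heatFlow hν hs y).mul (hasDerivAt_heatFlowDeriv hν hs y)
    refine (d1.mul d2).congr_deriv ?_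
    simp only [hW']
    simp only [Pi.mul_apply]
    ring
  -- Integration by parts in disguise: `W'` is the space derivative of `exp (g/h) v v'` and
  -- integrates to zero. The factor `2h` removes `v v''` and leaves minus a complete square.
  have hfin : ∫ y, D t y = ∫ y, (D t y - 2 * h * W' y) := by
    rw [integral_sub (hderiv t ht).1 (hW'int.const_mul _), integral_const_mul, hW0]
    ring
  rw [hfin]
  refine integral_nonpos fun y => ?_
  have : D t y - 2 * h * W' y = -(Real.exp (g t y / h) / (2 * h) *
      (p t y * heatFlow ν (h * t) y + 2 * h * heatFlowDeriv ν (h * t) y) ^ 2) := by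
    simp only [hD, hW']
    field_simp
    ring
  rw [this]
  simp only [Pi.zero_apply, Left.neg_nonpos_iff]
  positivity


/-! ### The Hopf-Lax solution generated by a monotone map. -/

lemma hasDerivAt_of_sq_bound {f : ℝ → ℝ} {d x C : ℝ}
    (h : ∀ᶠ y in 𝓝 x, |f y - f x - d * (y - x)| ≤ C * (y - x) ^ 2) : HasDerivAt f d x := by
  rw [hasDerivAt_iff_isLittleO]
  have h1 : (fun y => f y - f x - (y - x) • d) =O[𝓝 x] fun y => (y - x) ^ 2 := by
    refine Asymptotics.IsBigO.of_bound C ?_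
    filter_upwards [h] with y hy
    rw [Real.norm_eq_abs, Real.norm_eq_abs, abs_of_nonneg (sq_nonneg (y - x)), smul_eq_mul,
      mul_comm (y - x) d]
    exact hy
  refine h1.trans_isLittleO ?_
  have h2 : (fun y : ℝ => y - x) =o[𝓝 x] fun _ => (1 : ℝ) := by
    rw [Asymptotics.isLittleO_one_iff]
    have : Tendsto (fun y : ℝ => y - x) (𝓝 x) (𝓝 (x - x)) :=
      (continuous_id.sub continuous_const).tendsto x
    simpa using this
  have := (Asymptotics.isBigO_refl (fun y : ℝ => y - x) (𝓝 x)).mul_isLittleO h2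
  simpa [pow_two] using this

/-- A strictly increasing map of the line at bounded distance from the identity. -/
structure IsMonotoneMap (T : ℝ → ℝ) (lam M : ℝ) : Prop where
  continuous : Continuous T
  lam_pos : 0 < lam
  lam_le_one : lam ≤ 1
  expand : ∀ x x', x ≤ x' → lam * (x' - x) ≤ T x' - T x
  bound : ∀ x, |T x - x| ≤ M

/-- The primitive of the displacement `T - id`. -/
def potential (T : ℝ → ℝ) (x : ℝ) : ℝ := ∫ y in (0 : ℝ)..x, (T y - y)

/-- The inverse of the displacement interpolation `(1 - t) id + t T`. -/
def interpInv (T : ℝ → ℝ) (t z : ℝ) : ℝ := Function.invFun (fun x => x + t * (T x - x)) z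

/-- The Hopf-Lax evolution of `potential T`. -/
def hopfLax (T : ℝ → ℝ) (t z : ℝ) : ℝ :=
  potential T (interpInv T t z) + t / 2 * (T (interpInv T t z) - interpInv T t z) ^ 2

namespace IsMonotoneMap

variable {T : ℝ → ℝ} {lam M : ℝ} (hT : IsMonotoneMap T lam M)

include hT

lemma bound_nonneg : 0 ≤ M := (abs_nonneg _).trans (hT.bound 0)

lemma hasDerivAt_potential (x : ℝ) : HasDerivAt (potential T) (T x - x) x :=
  intervalIntegral.integral_hasDerivAt_right
    ((hT.continuous.sub continuous_id).intervalIntegrable _ _)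
    ((hT.continuous.sub continuous_id).stronglyMeasurableAtFilter _ _)
    (hT.continuous.sub continuous_id).continuousAt

lemma continuous_potential : Continuous (potential T) :=
  continuous_iff_continuousAt.2 fun x => (hT.hasDerivAt_potential x).continuousAt

lemma potential_sub_le (x y : ℝ) : potential T y - potential T x ≤ M * |y - x| := by
  have h := Convex.norm_image_sub_le_of_norm_hasDerivWithin_le (f := potential T)
    (f' := fun x => T x - x) (C := M) (s := univ) (x := x) (y := y)
    (fun z _ => (hT.hasDerivAt_potential z).hasDerivWithinAt) (fun z _ => hT.bound z)
    convex_univ (mem_univ _) (mem_univ _)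
  exact (le_abs_self _).trans h

/-- The slope of the interpolation is at least `1 - t (1 - lam)`, which is at least `lam / 2` up to
time `1 + lam / 2`. Characteristics thus do not cross until slightly after time one, so time one is
an interior time of the smooth Hamilton-Jacobi solution. -/
lemma interp_expand {t : ℝ} (h0 : 0 ≤ t) (h1 : t ≤ 1 + lam / 2) {x x' : ℝ} (hx : x ≤ x') :
    lam / 2 * (x' - x) ≤ (x' + t * (T x' - x')) - (x + t * (T x - x)) := by
  have e := hT.expand x x' hx
  have hl := hT.lam_le_one
  have hp := hT.lam_pos
  have h2 : t * (lam * (x' - x)) ≤ t * (T x' - T x) := mul_le_mul_of_nonneg_left e h0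
  have h3 : 0 ≤ x' - x := by linarith
  have h4 : lam / 2 ≤ 1 - t * (1 - lam) := by nlinarith
  nlinarith

lemma interp_expand_abs {t : ℝ} (h0 : 0 ≤ t) (h1 : t ≤ 1 + lam / 2) (x x' : ℝ) :
    lam / 2 * |x' - x| ≤ |(x' + t * (T x' - x')) - (x + t * (T x - x))| := by
  rcases le_total x x' with h | h
  · rw [abs_of_nonneg (sub_nonneg.2 h)]
    exact (hT.interp_expand h0 h1 h).trans (le_abs_self _)
  · rw [abs_sub_comm, abs_of_nonneg (sub_nonneg.2 h), abs_sub_comm (x' + _)]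
    exact (hT.interp_expand h0 h1 h).trans (le_abs_self _)

lemma interp_surjective {t : ℝ} (h0 : 0 ≤ t) :
    Function.Surjective fun x => x + t * (T x - x) := by
  have hc : Continuous fun x => x + t * (T x - x) := by
    have := hT.continuous
    fun_prop
  have hb : ∀ x, |t * (T x - x)| ≤ t * M := fun x => by
    rw [abs_mul, abs_of_nonneg h0]; exact mul_le_mul_of_nonneg_left (hT.bound x) h0
  refine hc.surjective ?_ ?_
  · refine tendsto_atTop_mono (fun x => ?_) (tendsto_atTop_add_const_right atTop (-(t * M)) tendsto_id)
    have := (abs_le.1 (hb x)).1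
    simp only [id]; linarith
  · refine tendsto_atBot_mono (fun x => ?_) (tendsto_atBot_add_const_right atBot (t * M) tendsto_id)
    have := (abs_le.1 (hb x)).2
    simp only [id]; linarith

lemma interp_interpInv {t : ℝ} (h0 : 0 ≤ t) (z : ℝ) :
    interpInv T t z + t * (T (interpInv T t z) - interpInv T t z) = z :=
  Function.invFun_eq (f := fun x => x + t * (T x - x)) (hT.interp_surjective h0 z)

lemma interpInv_interp {t : ℝ} (h0 : 0 ≤ t) (h1 : t ≤ 1 + lam / 2) (x : ℝ) :
    interpInv T t (x + t * (T x - x)) = x := by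
  have h2 := hT.interp_interpInv h0 (x + t * (T x - x))
  have h3 := hT.interp_expand_abs h0 h1 x (interpInv T t (x + t * (T x - x)))
  rw [h2, sub_self, abs_zero] at h3
  have hp := hT.lam_pos
  have h4 : |interpInv T t (x + t * (T x - x)) - x| ≤ 0 := by
    by_contra h; push Not at h; nlinarith
  exact sub_eq_zero.1 (abs_nonpos_iff.1 h4)

lemma hopfLax_one_map (x : ℝ) : hopfLax T 1 (T x) = potential T x + (T x - x) ^ 2 / 2 := by
  have h := hT.interpInv_interp zero_le_one (by linarith [hT.lam_pos]) x
  rw [show x + 1 * (T x - x) = T x by ring] at h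
  rw [hopfLax, h]
  ring

lemma hopfLax_eq {t : ℝ} (h0 : 0 < t) (z : ℝ) :
    hopfLax T t z = potential T (interpInv T t z) + (z - interpInv T t z) ^ 2 / (2 * t) := by
  have h := hT.interp_interpInv h0.le z
  have h2 : z - interpInv T t z = t * (T (interpInv T t z) - interpInv T t z) := by linarith
  rw [h2, hopfLax]
  field_simp

/-- The function `x ↦ potential T x + (z - x)² / (2t)` has derivative `((x + t (T x - x)) - z) / t`.
This is nondecreasing and vanishes at `interpInv T t z`, which is therefore a global minimiser:
`hopfLax` is the infimum in the Hopf-Lax formula. -/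
lemma hopfLax_le {t : ℝ} (h0 : 0 < t) (h1 : t ≤ 1 + lam / 2) (x z : ℝ) :
    hopfLax T t z ≤ potential T x + (z - x) ^ 2 / (2 * t) := by
  rw [hT.hopfLax_eq h0]
  set S := interpInv T t z with hS
  have hSz := hT.interp_interpInv h0.le z
  rw [← hS] at hSz
  set E : ℝ → ℝ := fun x => potential T x + (z - x) ^ 2 / (2 * t) with hE
  have hd : ∀ x, HasDerivAt E (((x + t * (T x - x)) - z) / t) x := fun x => by
    have h2 := (((hasDerivAt_id x).const_sub z).pow 2).div_const (2 * t)
    refine ((hT.hasDerivAt_potential x).add h2).congr_deriv ?_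
    simp only [id]
    field_simp
    ring
  have hcont : Continuous E := continuous_iff_continuousAt.2 fun x => (hd x).continuousAt
  have hexp : ∀ {x x' : ℝ}, x ≤ x' → (x + t * (T x - x)) ≤ (x' + t * (T x' - x')) := by
    intro x x' hx
    have := hT.interp_expand h0.le h1 hx
    have h3 : 0 ≤ lam / 2 * (x' - x) := mul_nonneg (by linarith [hT.lam_pos]) (by linarith)
    linarith
  change E S ≤ E x
  rcases le_total S x with h | h
  · have hm : MonotoneOn E (Ici S) := by
      refine monotoneOn_of_deriv_nonneg (convex_Ici S) hcont.continuousOn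
        (fun y _ => (hd y).differentiableAt.differentiableWithinAt) fun y hy => ?_
      rw [interior_Ici] at hy
      rw [(hd y).deriv]
      exact div_nonneg (by linarith [hexp (le_of_lt hy)]) h0.le
    exact hm self_mem_Ici h h
  · have hm : AntitoneOn E (Iic S) := by
      refine antitoneOn_of_deriv_nonpos (convex_Iic S) hcont.continuousOn
        (fun y _ => (hd y).differentiableAt.differentiableWithinAt) fun y hy => ?_
      rw [interior_Iic] at hy
      rw [(hd y).deriv]
      exact div_nonpos_of_nonpos_of_nonneg (by linarith [hexp (le_of_lt hy)]) h0.le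
    exact hm h self_mem_Iic h

lemma abs_interpInv_sub_le {t : ℝ} (h0 : 0 ≤ t) (h1 : t ≤ 1 + lam / 2) (z z' : ℝ) :
    |interpInv T t z' - interpInv T t z| ≤ 2 / lam * |z' - z| := by
  have h := hT.interp_expand_abs h0 h1 (interpInv T t z) (interpInv T t z')
  rw [hT.interp_interpInv h0, hT.interp_interpInv h0] at h
  have hp := hT.lam_pos
  rw [div_mul_eq_mul_div, le_div_iff₀ hp]
  linarith

lemma continuous_interpInv {t : ℝ} (h0 : 0 ≤ t) (h1 : t ≤ 1 + lam / 2) :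
    Continuous (interpInv T t) := by
  have hp := hT.lam_pos
  refine (LipschitzWith.of_dist_le_mul (K := ⟨2 / lam, by positivity⟩) fun z z' => ?_).continuous
  rw [Real.dist_eq, Real.dist_eq]
  exact hT.abs_interpInv_sub_le h0 h1 z' z

lemma abs_interpInv_time_sub_le {t t' : ℝ} (h0 : 0 ≤ t) (h0' : 0 ≤ t') (h1' : t' ≤ 1 + lam / 2)
    (z : ℝ) : |interpInv T t' z - interpInv T t z| ≤ 2 * M / lam * |t' - t| := by
  have h := hT.interp_expand_abs h0' h1' (interpInv T t z) (interpInv T t' z)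
  have e1 := hT.interp_interpInv h0 z
  have e2 := hT.interp_interpInv h0' z
  have hp := hT.lam_pos
  have e3 : (interpInv T t' z + t' * (T (interpInv T t' z) - interpInv T t' z)) -
      (interpInv T t z + t' * (T (interpInv T t z) - interpInv T t z)) =
      -((t' - t) * (T (interpInv T t z) - interpInv T t z)) := by linarith
  rw [e3, abs_neg, abs_mul] at h
  have hb := mul_le_mul_of_nonneg_left (hT.bound (interpInv T t z)) (abs_nonneg (t' - t))
  rw [div_mul_eq_mul_div, le_div_iff₀ hp]
  linarith

/-- Envelope argument, since `T` need not be differentiable. The minimiser for `z` is a competitor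
at `z'`, and the minimiser for `z'` is a competitor at `z`. As the minimiser is Lipschitz in `z`,
the two resulting bounds differ from the linear expansion by a quadratic error. -/
lemma hasDerivAt_hopfLax {t : ℝ} (h0 : 0 < t) (h1 : t ≤ 1 + lam / 2) (z : ℝ) :
    HasDerivAt (hopfLax T t) (T (interpInv T t z) - interpInv T t z) z := by
  have hp := hT.lam_pos
  refine hasDerivAt_of_sq_bound (C := (1 + 4 / lam) / (2 * t)) (Eventually.of_forall fun z' => ?_)
  set S := interpInv T t z with hS
  set S' := interpInv T t z' with hS'
  have hSz : z - S = t * (T S - S) := by linarith [hT.interp_interpInv h0.le z]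
  have hτ : T S - S = (z - S) / t := by rw [hSz]; field_simp
  have up := hT.hopfLax_le h0 h1 S z'
  have lo := hT.hopfLax_le h0 h1 S' z
  have e := hT.hopfLax_eq h0 z
  have e' := hT.hopfLax_eq h0 z'
  rw [← hS] at e
  rw [← hS'] at e'
  have hSS : |S' - S| ≤ 2 / lam * |z' - z| := hT.abs_interpInv_sub_le h0.le h1 z z'
  have hprod : |(z' - z) * (S' - S)| ≤ 2 / lam * (z' - z) ^ 2 := by
    rw [abs_mul, ← sq_abs (z' - z)]
    nlinarith [abs_nonneg (z' - z)]
  have hpr := abs_le.1 hprod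
  have u1 : hopfLax T t z' - hopfLax T t z - (T S - S) * (z' - z) ≤ (z' - z) ^ 2 / (2 * t) := by
    have : (z' - S) ^ 2 / (2 * t) - (z - S) ^ 2 / (2 * t) - (z - S) / t * (z' - z)
        = (z' - z) ^ 2 / (2 * t) := by field_simp; ring
    rw [hτ]; linarith
  have l1 : ((z' - z) ^ 2 - 2 * ((z' - z) * (S' - S))) / (2 * t) ≤
      hopfLax T t z' - hopfLax T t z - (T S - S) * (z' - z) := by
    have : (z' - S') ^ 2 / (2 * t) - (z - S') ^ 2 / (2 * t) - (z - S) / t * (z' - z)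
        = ((z' - z) ^ 2 - 2 * ((z' - z) * (S' - S))) / (2 * t) := by field_simp; ring
    rw [hτ]; linarith
  have hz := sq_nonneg (z' - z)
  have hl4 : 0 ≤ 4 / lam * (z' - z) ^ 2 := by positivity
  have h42 : 2 * (2 / lam * (z' - z) ^ 2) = 4 / lam * (z' - z) ^ 2 := by ring
  rw [abs_le, div_mul_eq_mul_div]
  constructor
  · refine le_trans ?_ l1
    rw [← neg_div]
    apply div_le_div_of_nonneg_right _ (by positivity)
    linarith
  · refine u1.trans ?_
    apply div_le_div_of_nonneg_right _ (by positivity)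
    linarith

/-- The Hamilton-Jacobi equation, by the same envelope argument in time: competitors are exchanged
between the times `t` and `t'`. -/
lemma hasDerivAt_hopfLax_time {t : ℝ} (h0 : 0 < t) (h1 : t < 1 + lam / 2) (z : ℝ) :
    HasDerivAt (fun t => hopfLax T t z) (-(T (interpInv T t z) - interpInv T t z) ^ 2 / 2) t := by
  have hp := hT.lam_pos
  have hM := hT.bound_nonneg
  have hl := hT.lam_le_one
  refine hasDerivAt_of_sq_bound (C := M ^ 2 / t + 2 * M / lam * (2 * M) / t ^ 2 * 2) ?_
  have hnhds : Ioo (t / 2) (1 + lam / 2) ∈ 𝓝 t := Ioo_mem_nhds (by linarith) h1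
  filter_upwards [hnhds] with t' ht'
  have h0' : 0 < t' := by linarith [ht'.1]
  have h1' := ht'.2.le
  set S := interpInv T t z with hS
  set S' := interpInv T t' z with hS'
  have hSz : z - S = t * (T S - S) := by linarith [hT.interp_interpInv h0.le z]
  have hSz' : z - S' = t' * (T S' - S') := by linarith [hT.interp_interpInv h0'.le z]
  have up := hT.hopfLax_le h0' h1' S z
  have lo := hT.hopfLax_le h0 h1.le S' z
  have e := hT.hopfLax_eq h0 z
  have e' := hT.hopfLax_eq h0' z
  rw [← hS] at e
  rw [← hS'] at e'
  have hSS : |S' - S| ≤ 2 * M / lam * |t' - t| :=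
    hT.abs_interpInv_time_sub_le h0.le h0'.le h1' z
  set τ := T S - S with hτ
  have hτM : τ ^ 2 ≤ M ^ 2 := sq_le_sq' (abs_le.1 (hT.bound S)).1 (abs_le.1 (hT.bound S)).2
  -- The expansion with the minimiser frozen at `S`; `hdiff` below bounds the effect of moving it to
  -- `S'`, which is quadratic because `S' - S` is itself of order `t' - t`.
  have main : (z - S) ^ 2 / (2 * t') - (z - S) ^ 2 / (2 * t) - -τ ^ 2 / 2 * (t' - t)
      = τ ^ 2 / 2 * (t' - t) ^ 2 / t' := by
    rw [hSz]; field_simp; ring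
  have hA : 0 ≤ τ ^ 2 / 2 * (t' - t) ^ 2 / t' := by positivity
  have hA' : τ ^ 2 / 2 * (t' - t) ^ 2 / t' ≤ M ^ 2 / t * (t' - t) ^ 2 := by
    rw [div_le_iff₀ h0']
    have : M ^ 2 / t * (t' - t) ^ 2 * t' = M ^ 2 * (t' - t) ^ 2 * (t' / t) := by ring
    rw [this]
    have h3 : 1 / 2 ≤ t' / t := by rw [le_div_iff₀ h0]; linarith [ht'.1]
    have h4 := mul_le_mul_of_nonneg_right hτM (sq_nonneg (t' - t))
    nlinarith [mul_nonneg (sq_nonneg M) (sq_nonneg (t' - t))]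
  have hdiff : |((z - S') ^ 2 - (z - S) ^ 2) * (t - t') / (2 * t * t')| ≤
      2 * M / lam * (2 * M) / t ^ 2 * 2 * (t' - t) ^ 2 := by
    have f1 : (z - S') ^ 2 - (z - S) ^ 2 = -(S' - S) * ((z - S) + (z - S')) := by ring
    have f2 : |(z - S) + (z - S')| ≤ 2 * (2 * M) := by
      have g1 : |z - S| ≤ 2 * M := by
        rw [hSz, abs_mul, abs_of_pos h0]
        exact mul_le_mul (by linarith) (hT.bound S) (abs_nonneg _) (by norm_num)
      have g2 : |z - S'| ≤ 2 * M := by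
        rw [hSz', abs_mul, abs_of_pos h0']
        exact mul_le_mul (by linarith) (hT.bound S') (abs_nonneg _) (by norm_num)
      exact (abs_add_le _ _).trans (by linarith)
    rw [f1, abs_div, abs_mul, abs_mul, abs_neg, abs_of_pos (by positivity : 0 < 2 * t * t'),
      abs_sub_comm t t']
    calc |S' - S| * |z - S + (z - S')| * |t' - t| / (2 * t * t')
        ≤ (2 * M / lam * |t' - t|) * (2 * (2 * M)) * |t' - t| / (2 * t * t') := by gcongr
      _ ≤ (2 * M / lam * |t' - t|) * (2 * (2 * M)) * |t' - t| / (2 * t * (t / 2)) := by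
          gcongr
          exact ht'.1.le
      _ = 2 * M / lam * (2 * M) / t ^ 2 * 2 * |t' - t| ^ 2 := by field_simp
      _ = _ := by rw [sq_abs]
  have hd := abs_le.1 hdiff
  have l1 : (z - S') ^ 2 / (2 * t') - (z - S') ^ 2 / (2 * t) =
      ((z - S) ^ 2 / (2 * t') - (z - S) ^ 2 / (2 * t)) +
        ((z - S') ^ 2 - (z - S) ^ 2) * (t - t') / (2 * t * t') := by
    field_simp; ring
  have hC : 0 ≤ 2 * M / lam * (2 * M) / t ^ 2 * 2 * (t' - t) ^ 2 := by positivity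
  have hC' : 0 ≤ M ^ 2 / t * (t' - t) ^ 2 := by positivity
  rw [abs_le, add_mul]
  constructor
  · linarith [hd.1]
  · linarith [hd.1]

lemma hopfLax_le_potential {t : ℝ} (h0 : 0 < t) (h1 : t ≤ 1 + lam / 2) (z : ℝ) :
    hopfLax T t z ≤ potential T z := by
  have := hT.hopfLax_le h0 h1 z z
  simpa using this

/-- The potentials of the quadratic transport problem are admissible in the dual problem. -/
lemma two_mul_hopfLax_sub_le (x y : ℝ) :
    2 * (hopfLax T 1 y - potential T x) ≤ (x - y) ^ 2 := by
  have := hT.hopfLax_le zero_lt_one (by linarith [hT.lam_pos]) x y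
  nlinarith

end IsMonotoneMap


/-! ### The weighted estimate from time zero to time one. -/

lemma heatKernel_eq_gaussian (s x y : ℝ) :
    heatKernel s x y = 1 / Real.sqrt (4 * Real.pi * s) * Real.exp (-(1 / (4 * s)) * (y - x) ^ 2) := by
  unfold heatKernel
  congr 2
  ring

lemma heatKernel_symm (s x y : ℝ) : heatKernel s x y = heatKernel s y x := by
  unfold heatKernel
  rw [show (y - x) ^ 2 = (x - y) ^ 2 by ring]

lemma integrable_heatKernel {s : ℝ} (hs : 0 < s) (x : ℝ) :
    Integrable fun y => heatKernel s x y := by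
  simp_rw [heatKernel_eq_gaussian]
  exact ((integrable_exp_neg_mul_sq (b := 1 / (4 * s)) (by positivity)).comp_sub_right x).const_mul _

lemma integral_heatKernel {s : ℝ} (hs : 0 < s) (x : ℝ) : ∫ y, heatKernel s x y = 1 := by
  simp_rw [heatKernel_eq_gaussian]
  rw [integral_const_mul, integral_sub_right_eq_self
    (fun y => Real.exp (-(1 / (4 * s)) * y ^ 2)) x, integral_gaussian]
  rw [show Real.pi / (1 / (4 * s)) = 4 * Real.pi * s by field_simp]
  have : Real.sqrt (4 * Real.pi * s) ≠ 0 := (Real.sqrt_pos.2 (by positivity)).ne'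
  field_simp

/-- The initial weight of the heat flow used in the bilinear estimate. -/
def initialWeight (T f₀ : ℝ → ℝ) (h x : ℝ) : ℝ :=
  Real.sqrt (f₀ x) * Real.exp (-(potential T x) / (2 * h))

/-- The measure on `(0, L)` with density `initialWeight`. -/
def initialMeasure (L : ℝ) (T f₀ : ℝ → ℝ) (h : ℝ) : Measure ℝ :=
  (volume.restrict (Ioo 0 L)).withDensity fun x => ENNReal.ofReal (initialWeight T f₀ h x)

lemma initialWeight_nonneg (T f₀ : ℝ → ℝ) (h x : ℝ) : 0 ≤ initialWeight T f₀ h x := by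
  unfold initialWeight; positivity

lemma ae_initialMeasure (L : ℝ) (T f₀ : ℝ → ℝ) (h : ℝ) :
    ∀ᵐ x ∂(initialMeasure L T f₀ h), |x| ≤ L := by
  refine (withDensity_absolutelyContinuous _ _).ae_le ?_
  filter_upwards [ae_restrict_mem measurableSet_Ioo] with x hx
  exact abs_le.2 ⟨by linarith [hx.1, hx.2], hx.2.le⟩

section

variable {T f₀ : ℝ → ℝ} {lam M K C L h : ℝ}

lemma measurable_initialWeight (hT : IsMonotoneMap T lam M) (hf : Measurable f₀) :
    Measurable (initialWeight T f₀ h) := by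
  unfold initialWeight
  have := hT.continuous_potential.measurable
  fun_prop

lemma initialWeight_le (hh : 0 < h) (hK : ∀ x, |potential T x| ≤ K) (hC : ∀ x, f₀ x ≤ C) (x : ℝ) :
    initialWeight T f₀ h x ≤ Real.sqrt C * Real.exp (K / (2 * h)) := by
  unfold initialWeight
  have h1 := (abs_le.1 (hK x)).1
  have h2 : -(potential T x) / (2 * h) ≤ K / (2 * h) := by gcongr; linarith
  have h3 := Real.sqrt_le_sqrt (hC x)
  exact mul_le_mul h3 (Real.exp_le_exp.2 h2) (Real.exp_pos _).le (Real.sqrt_nonneg _)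

lemma integrable_initialWeight (hT : IsMonotoneMap T lam M) (hf : Measurable f₀) (hh : 0 < h)
    (hK : ∀ x, |potential T x| ≤ K) (hC : ∀ x, f₀ x ≤ C) :
    Integrable (initialWeight T f₀ h) (volume.restrict (Ioo 0 L)) := by
  refine Integrable.of_bound (measurable_initialWeight hT hf).aestronglyMeasurable
    (Real.sqrt C * Real.exp (K / (2 * h))) (Eventually.of_forall fun x => ?_)
  rw [Real.norm_eq_abs, abs_of_nonneg (initialWeight_nonneg _ _ _ _)]
  exact initialWeight_le hh hK hC x

lemma isFiniteMeasure_initialMeasure (hT : IsMonotoneMap T lam M) (hf : Measurable f₀) (hh : 0 < h)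
    (hK : ∀ x, |potential T x| ≤ K) (hC : ∀ x, f₀ x ≤ C) :
    IsFiniteMeasure (initialMeasure L T f₀ h) :=
  isFiniteMeasure_withDensity_ofReal (integrable_initialWeight hT hf hh hK hC).hasFiniteIntegral

lemma heatFlow_initialMeasure (hT : IsMonotoneMap T lam M) (hf : Measurable f₀) (s y : ℝ) :
    heatFlow (initialMeasure L T f₀ h) s y =
      ∫ x in Ioo 0 L, heatKernel s x y * initialWeight T f₀ h x := by
  unfold heatFlow initialMeasure
  rw [integral_withDensity_eq_integral_toReal_smul
    (measurable_initialWeight hT hf).ennreal_ofReal (by simp)]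
  simp_rw [ENNReal.toReal_ofReal (initialWeight_nonneg _ _ _ _), smul_eq_mul, mul_comm]

lemma integrable_heatKernel_mul (hs : 0 < h) (y : ℝ) {w : ℝ → ℝ} (hw : Measurable w) {B : ℝ}
    (hB : ∀ x, |w x| ≤ B) (L : ℝ) :
    Integrable (fun x => heatKernel h x y * w x) (volume.restrict (Ioo 0 L)) := by
  refine Integrable.mul_bdd (c := B) ?_ hw.aestronglyMeasurable (Eventually.of_forall hB)
  simp_rw [heatKernel_symm h _ y]
  exact (integrable_heatKernel hs y).restrict

/-- Jensen's inequality for a kernel of mass at most one, from the expansion of `∫ p (w - v)² ≥ 0`,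
where `v` is the integral of `w` against `p`. -/
lemma heatFlow_sq_le (hT : IsMonotoneMap T lam M) (hf : Measurable f₀)
    (hh : 0 < h)
    (hK : ∀ x, |potential T x| ≤ K) (hC : ∀ x, f₀ x ≤ C) {s : ℝ} (hs : 0 < s) (y : ℝ) :
    heatFlow (initialMeasure L T f₀ h) s y ^ 2 ≤
      ∫ x in Ioo 0 L, heatKernel s x y * initialWeight T f₀ h x ^ 2 := by
  rw [heatFlow_initialMeasure hT hf]
  set v := ∫ x in Ioo 0 L, heatKernel s x y * initialWeight T f₀ h x with hv
  have hwm := measurable_initialWeight (h := h) hT hf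
  set B := Real.sqrt C * Real.exp (K / (2 * h)) with hB
  have hwB : ∀ x, |initialWeight T f₀ h x| ≤ B := fun x => by
    rw [abs_of_nonneg (initialWeight_nonneg _ _ _ _)]; exact initialWeight_le hh hK hC x
  have i1 := integrable_heatKernel_mul hs y hwm hwB L
  have i2 := integrable_heatKernel_mul hs y (hwm.pow_const 2) (B := B ^ 2)
    (fun x => by rw [abs_pow]; exact pow_le_pow_left₀ (abs_nonneg _) (hwB x) 2) L
  have i0 : Integrable (fun x => heatKernel s x y) (volume.restrict (Ioo 0 L)) := by
    simp_rw [heatKernel_symm s _ y]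
    exact (integrable_heatKernel hs y).restrict
  have hone : ∫ x in Ioo 0 L, heatKernel s x y ≤ 1 := by
    simp_rw [heatKernel_symm s _ y]
    rw [← integral_heatKernel hs y]
    exact setIntegral_le_integral (integrable_heatKernel hs y)
      (Eventually.of_forall fun x => (heatKernel_pos hs y x).le)
  have h0 : 0 ≤ ∫ x in Ioo 0 L, heatKernel s x y * (initialWeight T f₀ h x - v) ^ 2 :=
    integral_nonneg fun x => mul_nonneg (heatKernel_pos hs x y).le (sq_nonneg _)
  have h1 : ∫ x in Ioo 0 L, heatKernel s x y * (initialWeight T f₀ h x - v) ^ 2 =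
      (∫ x in Ioo 0 L, heatKernel s x y * initialWeight T f₀ h x ^ 2)
        - 2 * v * v + v ^ 2 * ∫ x in Ioo 0 L, heatKernel s x y := by
    calc ∫ x in Ioo 0 L, heatKernel s x y * (initialWeight T f₀ h x - v) ^ 2
        = ∫ x in Ioo 0 L, ((heatKernel s x y * initialWeight T f₀ h x ^ 2 -
            2 * v * (heatKernel s x y * initialWeight T f₀ h x)) + v ^ 2 * heatKernel s x y) := by
          refine integral_congr_ae (Eventually.of_forall fun x => ?_)
          ring
      _ = (∫ x in Ioo 0 L, (heatKernel s x y * initialWeight T f₀ h x ^ 2 -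
            2 * v * (heatKernel s x y * initialWeight T f₀ h x))) +
            ∫ x in Ioo 0 L, v ^ 2 * heatKernel s x y :=
          integral_add (i2.sub (i1.const_mul (2 * v))) (i0.const_mul (v ^ 2))
      _ = _ := by
          rw [integral_sub i2 (i1.const_mul _), integral_const_mul, integral_const_mul, ← hv]
  nlinarith [sq_nonneg v]

/-- Control near time zero, with a bound that tends to one as `t → 0`; this replaces continuity at
`t = 0`, since `f₀` is only measurable. Jensen's inequality and `hopfLax ≤ potential` reduce it to
the increments of `potential T`, which are at most `M |y - x|` and are absorbed by a small part of
the Gaussian. -/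
lemma integral_sq_weighted_le (hT : IsMonotoneMap T lam M) (hf : Measurable f₀)
    (hf0 : ∀ x, 0 ≤ f₀ x) (hh : 0 < h) (hK : ∀ x, |potential T x| ≤ K) (hC : ∀ x, f₀ x ≤ C)
    (hf1 : ∫ x in Ioo 0 L, f₀ x = 1)
    {t : ℝ} (ht : 0 < t) (ht1 : t ≤ 1 + lam / 2) (hr : Real.sqrt (h * t) < 1 / 2) :
    ∫ y, Real.exp (hopfLax T t y / h) * heatFlow (initialMeasure L T f₀ h) (h * t) y ^ 2 ≤
      Real.exp ((M / h) ^ 2 * Real.sqrt (h * t) / 2) / Real.sqrt (1 - 2 * Real.sqrt (h * t)) := by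
  set s := h * t with hs_def
  have hs : 0 < s := mul_pos hh ht
  set r := Real.sqrt s with hr_def
  have hr0 : 0 < r := Real.sqrt_pos.2 hs
  have hrs : r ^ 2 = s := Real.sq_sqrt hs.le
  -- What remains of the exponent `1 / (4s)` after `1 / (2r)` is given away to absorb the Lipschitz
  -- term; here `r² = s`.
  set b := (1 - 2 * r) / (4 * s) with hb_def
  have hb : 0 < b := div_pos (by linarith) (by linarith)
  set A := Real.exp ((M / h) ^ 2 * r / 2) with hA
  set q : ℝ → ℝ := fun z => A * (1 / Real.sqrt (4 * Real.pi * s)) * Real.exp (-b * z ^ 2) with hq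
  have hqint : Integrable q := (integrable_exp_neg_mul_sq hb).const_mul _
  have hqpos : ∀ z, 0 ≤ q z := fun z => by simp only [hq]; positivity
  have hqI : ∫ z, q z = A / Real.sqrt (1 - 2 * r) := by
    simp only [hq]
    rw [integral_const_mul, integral_gaussian]
    have : Real.pi / b = (4 * Real.pi * s) / (1 - 2 * r) := by
      rw [hb_def]; have : 1 - 2 * r ≠ 0 := by linarith
      field_simp
    rw [this, Real.sqrt_div (by positivity)]
    have h2 : Real.sqrt (4 * Real.pi * s) ≠ 0 := (Real.sqrt_pos.2 (by positivity)).ne'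
    field_simp
  have hC0 : 0 ≤ C := (hf0 0).trans (hC 0)
  have hf0int : Integrable f₀ (volume.restrict (Ioo 0 L)) :=
    Integrable.of_bound hf.aestronglyMeasurable C (Eventually.of_forall fun x => by
      rw [Real.norm_eq_abs, abs_of_nonneg (hf0 x)]; exact hC x)
  have hprodint : Integrable (fun z : ℝ × ℝ => f₀ z.2 * q (z.1 - z.2))
      (volume.prod (volume.restrict (Ioo 0 L))) := by
    rw [integrable_prod_iff']
    · constructor
      · exact Eventually.of_forall fun x => (hqint.comp_sub_right x).const_mul (f₀ x)
      · have : (fun x => ∫ y, ‖f₀ x * q (y - x)‖) = fun x => f₀ x * (A / Real.sqrt (1 - 2 * r)) := by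
          funext x
          simp_rw [norm_mul, Real.norm_eq_abs, abs_of_nonneg (hf0 x), abs_of_nonneg (hqpos _)]
          rw [integral_const_mul, integral_sub_right_eq_self q x, hqI]
        simp only [this]
        exact hf0int.mul_const _
    · refine Measurable.aestronglyMeasurable ?_
      simp only [hq]
      fun_prop
  have hpt : ∀ y, Real.exp (hopfLax T t y / h) * heatFlow (initialMeasure L T f₀ h) s y ^ 2 ≤
      ∫ x in Ioo 0 L, f₀ x * q (y - x) := by
    intro y
    have e1 : Real.exp (hopfLax T t y / h) ≤ Real.exp (potential T y / h) := by
      gcongr; exact hT.hopfLax_le_potential ht ht1 y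
    have e2 := heatFlow_sq_le (L := L) hT hf hh hK hC hs y
    refine (mul_le_mul e1 e2 (sq_nonneg _) (Real.exp_pos _).le).trans ?_
    rw [← integral_const_mul]
    refine integral_mono_of_nonneg (Eventually.of_forall fun x => ?_) ?_
      (Eventually.of_forall fun x => ?_)
    · have := (heatKernel_pos hs x y).le
      simp only [Pi.zero_apply]
      positivity
    · refine Integrable.bdd_mul (c := C) ?_ hf.aestronglyMeasurable
        (Eventually.of_forall fun x => by rw [Real.norm_eq_abs, abs_of_nonneg (hf0 x)]; exact hC x)
      exact (hqint.comp_sub_left y).restrict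
    · simp only [hq]
      have hw2 : initialWeight T f₀ h x ^ 2 = f₀ x * Real.exp (-(potential T x) / h) := by
        unfold initialWeight
        rw [mul_pow, Real.sq_sqrt (hf0 x), ← Real.exp_nat_mul]
        congr 2
        push_cast
        field_simp
      rw [hw2, heatKernel_eq_gaussian]
      have e3 : potential T y / h + (-(1 / (4 * s)) * (y - x) ^ 2) + -(potential T x) / h ≤
          (M / h) ^ 2 * r / 2 + -b * (y - x) ^ 2 := by
        have e4 := hT.potential_sub_le x y
        have e5 : (potential T y - potential T x) / h ≤ M / h * |y - x| := by
          rw [div_mul_eq_mul_div]; gcongr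
        have e6 : M / h * |y - x| ≤ (M / h) ^ 2 * r / 2 + (y - x) ^ 2 / (2 * r) := by
          have : (M / h) ^ 2 * r / 2 + (y - x) ^ 2 / (2 * r) - M / h * |y - x| =
              (M / h * r - |y - x|) ^ 2 / (2 * r) := by
            rw [← sq_abs (y - x)]; field_simp; ring
          have h7 : 0 ≤ (M / h * r - |y - x|) ^ 2 / (2 * r) := by positivity
          linarith
        have e7 : -b * (y - x) ^ 2 = -(1 / (4 * s)) * (y - x) ^ 2 + (y - x) ^ 2 / (2 * r) := by
          rw [hb_def, ← hrs]; field_simp; ring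
        have e8 : (potential T y - potential T x) / h =
          potential T y / h + -(potential T x) / h := by ring
        linarith
      have hs4 : 0 ≤ 1 / Real.sqrt (4 * Real.pi * s) := by positivity
      calc Real.exp (potential T y / h) * (1 / Real.sqrt (4 * Real.pi * s) *
            Real.exp (-(1 / (4 * s)) * (y - x) ^ 2) * (f₀ x * Real.exp (-(potential T x) / h)))
          = f₀ x * (1 / Real.sqrt (4 * Real.pi * s)) * Real.exp (potential T y / h +
            (-(1 / (4 * s)) * (y - x) ^ 2) + -(potential T x) / h) := by
              rw [Real.exp_add, Real.exp_add]; ring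
        _ ≤ f₀ x * (1 / Real.sqrt (4 * Real.pi * s)) *
            Real.exp ((M / h) ^ 2 * r / 2 + -b * (y - x) ^ 2) := by
              gcongr
              exact mul_nonneg (hf0 x) hs4
        _ = _ := by rw [Real.exp_add]; ring
  calc ∫ y, Real.exp (hopfLax T t y / h) * heatFlow (initialMeasure L T f₀ h) s y ^ 2
      ≤ ∫ y, ∫ x in Ioo 0 L, f₀ x * q (y - x) :=
        integral_mono_of_nonneg (Eventually.of_forall fun y => by positivity)
          hprodint.integral_prod_left (Eventually.of_forall hpt)
    _ = ∫ x in Ioo 0 L, ∫ y, f₀ x * q (y - x) := integral_integral_swap hprodint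
    _ = ∫ x in Ioo 0 L, f₀ x * (A / Real.sqrt (1 - 2 * r)) := by
        refine integral_congr_ae (Eventually.of_forall fun x => ?_)
        simp only
        rw [integral_const_mul, integral_sub_right_eq_self q x, hqI]
    _ = A / Real.sqrt (1 - 2 * r) := by rw [integral_mul_const, hf1, one_mul]

lemma abs_hopfLax_le (hT : IsMonotoneMap T lam M) (hK : ∀ x, |potential T x| ≤ K) {t : ℝ}
    (ht : 0 < t) (ht1 : t ≤ 1 + lam / 2) (y : ℝ) : |hopfLax T t y| ≤ K + M ^ 2 := by
  unfold hopfLax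
  refine (abs_add_le _ _).trans (add_le_add (hK _) ?_)
  have h1 := abs_le.1 (hT.bound (interpInv T t y))
  have h2 : (T (interpInv T t y) - interpInv T t y) ^ 2 ≤ M ^ 2 := sq_le_sq' h1.1 h1.2
  rw [abs_of_nonneg (by positivity)]
  have := hT.lam_le_one
  nlinarith [sq_nonneg (T (interpInv T t y) - interpInv T t y)]

/-- The weighted `L²` estimate at time one. -/
lemma integral_weighted_heatFlow_le_one (hT : IsMonotoneMap T lam M) (hf : Measurable f₀)
    (hf0 : ∀ x, 0 ≤ f₀ x) (hh : 0 < h) (hK : ∀ x, |potential T x| ≤ K) (hC : ∀ x, f₀ x ≤ C)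
    (hf1 : ∫ x in Ioo 0 L, f₀ x = 1) :
    ∫ y, Real.exp (hopfLax T 1 y / h) * heatFlow (initialMeasure L T f₀ h) h y ^ 2 ≤ 1 := by
  have := isFiniteMeasure_initialMeasure (L := L) hT hf hh hK hC
  have hlam := hT.lam_pos
  have hK0 : 0 ≤ K := (abs_nonneg _).trans (hK 0)
  have hM := hT.bound_nonneg
  -- The final time `1 + lam / 2` places time one inside the open interval of monotonicity.
  have hanti := antitoneOn_weighted_heatFlow (ae_initialMeasure L T f₀ h) hh
    (t₁ := 1 + lam / 2) (M := K + M ^ 2 + M) (g := hopfLax T)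
    (p := fun t z => T (interpInv T t z) - interpInv T t z)
    (fun t ht y => (abs_hopfLax_le hT hK ht.1 ht.2.le y).trans (by linarith))
    (fun t ht y => (hT.bound _).trans (by nlinarith))
    (fun t ht => by
      have h1 := hT.continuous_interpInv ht.1.le ht.2.le
      have h2 := hT.continuous
      fun_prop)
    (fun t ht y => hT.hasDerivAt_hopfLax ht.1 ht.2.le y)
    (fun t ht y => hT.hasDerivAt_hopfLax_time ht.1 ht.2 y)
  set I : ℝ → ℝ := fun t => ∫ y, Real.exp (hopfLax T t y / h) *
    heatFlow (initialMeasure L T f₀ h) (h * t) y ^ 2 with hI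
  have hlim : Tendsto (fun t => Real.exp ((M / h) ^ 2 * Real.sqrt (h * t) / 2) /
      Real.sqrt (1 - 2 * Real.sqrt (h * t))) (𝓝[>] 0) (𝓝 1) := by
    have hc : ContinuousAt (fun t => Real.exp ((M / h) ^ 2 * Real.sqrt (h * t) / 2) /
      Real.sqrt (1 - 2 * Real.sqrt (h * t))) 0 := by
      refine ContinuousAt.div ?_ ?_ (by simp) <;> fun_prop
    have := hc.tendsto
    simp only [mul_zero, Real.sqrt_zero, zero_div, Real.exp_zero, sub_zero, Real.sqrt_one,
      div_one] at this
    exact this.mono_left nhdsWithin_le_nhds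
  have hsm : ∀ᶠ t in 𝓝[>] (0 : ℝ), Real.sqrt (h * t) < 1 / 2 := by
    have hc : ContinuousAt (fun t => Real.sqrt (h * t)) 0 := by fun_prop
    have := hc.tendsto
    simp only [mul_zero, Real.sqrt_zero] at this
    exact (this.mono_left nhdsWithin_le_nhds).eventually (gt_mem_nhds (by norm_num))
  have h1 : I 1 ≤ 1 := by
    -- The value at time one is below the value at every small `t`, and the bounds for the latter
    -- tend to one.
    refine ge_of_tendsto hlim ?_
    filter_upwards [hsm, self_mem_nhdsWithin, nhdsWithin_le_nhds (gt_mem_nhds zero_lt_one)]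
      with t ht1 ht0 ht2
    have ht0' : 0 < t := ht0
    refine (hanti ⟨ht0', by linarith⟩ ⟨zero_lt_one, by linarith⟩ ht2.le).trans ?_
    exact integral_sq_weighted_le hT hf hf0 hh hK hC hf1 ht0' (by linarith) ht1
  simpa [hI] using h1

end


/-! ### Densities bounded above and below, and their monotone rearrangement. -/

/-- A probability density on `(0, L)` with values in `[c, C]`, continued by the constant `1 / L`. -/
structure IsNormalizedDensity (L c C : ℝ) (f : ℝ → ℝ) : Prop where
  L_pos : 0 < L
  c_pos : 0 < c
  measurable : Measurable f
  le : ∀ x, c ≤ f x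
  ge : ∀ x, f x ≤ C
  integral : ∫ x in Ioo 0 L, f x = 1
  outside : ∀ x, x ∉ Ioo 0 L → f x = L⁻¹

/-- The measure on `(0, L)` with density `f`. -/
def densityMeasure (L : ℝ) (f : ℝ → ℝ) : Measure ℝ :=
  (volume.restrict (Ioo 0 L)).withDensity fun x => ENNReal.ofReal (f x)

/-- The primitive of a density. -/
def cdfOf (f : ℝ → ℝ) (x : ℝ) : ℝ := ∫ y in (0 : ℝ)..x, f y

/-- The inverse of the primitive of a density. -/
def quantileOf (f : ℝ → ℝ) (y : ℝ) : ℝ := Function.invFun (cdfOf f) y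

/-- The monotone rearrangement of the density `f₀` to the density `f`. -/
def transportMap (f₀ f : ℝ → ℝ) (x : ℝ) : ℝ := quantileOf f (cdfOf f₀ x)

lemma cdfOf_zero (f : ℝ → ℝ) : cdfOf f 0 = 0 := by simp [cdfOf]

namespace IsNormalizedDensity

variable {L c C : ℝ} {f f₀ : ℝ → ℝ}

section

variable (hf : IsNormalizedDensity L c C f)

include hf

lemma pos (x : ℝ) : 0 < f x := hf.c_pos.trans_le (hf.le x)

lemma C_pos : 0 < C := (hf.pos 0).trans_le (hf.ge 0)

lemma c_le_C : c ≤ C := (hf.le 0).trans (hf.ge 0)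

lemma integrable_restrict (s : Set ℝ) (hs : volume s ≠ ∞) : Integrable f (volume.restrict s) := by
  have : IsFiniteMeasure (volume.restrict s) := ⟨by simpa using hs.lt_top⟩
  refine Integrable.of_bound hf.measurable.aestronglyMeasurable C (Eventually.of_forall fun x => ?_)
  rw [Real.norm_eq_abs, abs_of_pos (hf.pos x)]
  exact hf.ge x

lemma intervalIntegrable (a b : ℝ) : IntervalIntegrable f volume a b :=
  ⟨hf.integrable_restrict _ (by simp), hf.integrable_restrict _ (by simp)⟩

lemma cdfOf_sub (x y : ℝ) : cdfOf f y - cdfOf f x = ∫ z in x..y, f z :=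
  intervalIntegral.integral_interval_sub_left (hf.intervalIntegrable _ _) (hf.intervalIntegrable _ _)

lemma le_cdfOf_sub {x y : ℝ} (h : x ≤ y) : c * (y - x) ≤ cdfOf f y - cdfOf f x := by
  rw [hf.cdfOf_sub]
  have := intervalIntegral.integral_mono_on h (intervalIntegrable_const (c := c))
    (hf.intervalIntegrable x y) (fun z _ => hf.le z)
  simpa [mul_comm] using this

lemma cdfOf_sub_le {x y : ℝ} (h : x ≤ y) : cdfOf f y - cdfOf f x ≤ C * (y - x) := by
  rw [hf.cdfOf_sub]
  have := intervalIntegral.integral_mono_on h (hf.intervalIntegrable x y)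
    (intervalIntegrable_const (c := C)) (fun z _ => hf.ge z)
  simpa [mul_comm] using this

lemma abs_cdfOf_sub_le (x y : ℝ) : |cdfOf f y - cdfOf f x| ≤ C * |y - x| := by
  have hc := hf.c_pos
  rcases le_total x y with h | h
  · rw [abs_of_nonneg (sub_nonneg.2 h), abs_of_nonneg]
    · exact hf.cdfOf_sub_le h
    · exact le_trans (mul_nonneg hc.le (by linarith)) (hf.le_cdfOf_sub h)
  · rw [abs_sub_comm, abs_sub_comm y, abs_of_nonneg (sub_nonneg.2 h), abs_of_nonneg]
    · exact hf.cdfOf_sub_le h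
    · exact le_trans (mul_nonneg hc.le (by linarith)) (hf.le_cdfOf_sub h)

lemma le_abs_cdfOf_sub (x y : ℝ) : c * |y - x| ≤ |cdfOf f y - cdfOf f x| := by
  rcases le_total x y with h | h
  · rw [abs_of_nonneg (sub_nonneg.2 h)]
    exact (hf.le_cdfOf_sub h).trans (le_abs_self _)
  · rw [abs_sub_comm, abs_sub_comm (cdfOf f y), abs_of_nonneg (sub_nonneg.2 h)]
    exact (hf.le_cdfOf_sub h).trans (le_abs_self _)

lemma strictMono_cdfOf : StrictMono (cdfOf f) := fun x y h => by
  have := hf.le_cdfOf_sub h.le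
  have h2 : 0 < c * (y - x) := mul_pos hf.c_pos (by linarith)
  linarith

lemma continuous_cdfOf : Continuous (cdfOf f) := by
  refine (LipschitzWith.of_dist_le_mul (K := ⟨C, hf.C_pos.le⟩) fun x y => ?_).continuous
  rw [Real.dist_eq, Real.dist_eq]
  exact hf.abs_cdfOf_sub_le y x

lemma cdfOf_L : cdfOf f L = 1 := by
  rw [cdfOf, intervalIntegral.integral_of_le hf.L_pos.le, integral_Ioc_eq_integral_Ioo, hf.integral]

/-- The continuation by `L⁻¹` makes the primitive independent of the density outside `(0, L)`. The
rearrangement of one density to another is therefore the identity there, and is a homeomorphism of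
the whole line. -/
lemma cdfOf_outside {x : ℝ} (hx : x ∉ Ioo 0 L) : cdfOf f x = x / L := by
  rw [mem_Ioo, not_and_or, not_lt, not_lt] at hx
  have hL := hf.L_pos
  rcases hx with h | h
  · rw [cdfOf, intervalIntegral.integral_congr (g := fun _ => L⁻¹)]
    · simp [div_eq_mul_inv]
    · intro z hz
      rw [uIcc_of_ge h] at hz
      exact hf.outside z fun h' => absurd h'.1 (not_lt.2 hz.2)
  · have h1 := hf.cdfOf_sub L x
    rw [intervalIntegral.integral_congr (g := fun _ => L⁻¹), hf.cdfOf_L] at h1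
    · simp only [intervalIntegral.integral_const, smul_eq_mul] at h1
      have : (x - L) * L⁻¹ = x / L - 1 := by field_simp
      linarith
    · intro z hz
      rw [uIcc_of_le h] at hz
      exact hf.outside z fun h' => absurd h'.2 (not_lt.2 hz.1)

lemma surjective_cdfOf : Function.Surjective (cdfOf f) := by
  have hc := hf.c_pos
  refine hf.continuous_cdfOf.surjective ?_ ?_
  · refine tendsto_atTop_mono' _ ?_ (tendsto_id.const_mul_atTop hc)
    filter_upwards [eventually_ge_atTop 0] with x hx
    have := hf.le_cdfOf_sub hx
    rw [cdfOf_zero] at this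
    simpa using this
  · refine tendsto_atBot_mono' _ ?_ (tendsto_id.const_mul_atBot hc)
    filter_upwards [eventually_le_atBot 0] with x hx
    have := hf.le_cdfOf_sub hx
    rw [cdfOf_zero] at this
    simp only [id]
    linarith

lemma cdfOf_quantileOf (y : ℝ) : cdfOf f (quantileOf f y) = y :=
  Function.invFun_eq (hf.surjective_cdfOf y)

lemma quantileOf_cdfOf (x : ℝ) : quantileOf f (cdfOf f x) = x :=
  Function.leftInverse_invFun hf.strictMono_cdfOf.injective x

lemma cdfOf_transportMap (f₀ : ℝ → ℝ) (x : ℝ) : cdfOf f (transportMap f₀ f x) = cdfOf f₀ x :=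
  hf.cdfOf_quantileOf _

lemma continuous_quantileOf : Continuous (quantileOf f) := by
  have hc := hf.c_pos
  refine (LipschitzWith.of_dist_le_mul (K := ⟨1 / c, by positivity⟩) fun x y => ?_).continuous
  rw [Real.dist_eq, Real.dist_eq]
  have := hf.le_abs_cdfOf_sub (quantileOf f y) (quantileOf f x)
  rw [hf.cdfOf_quantileOf, hf.cdfOf_quantileOf] at this
  change _ ≤ 1 / c * _
  rw [one_div_mul_eq_div, le_div_iff₀ hc]
  linarith

lemma locallyIntegrable : LocallyIntegrable f volume :=
  (locallyIntegrable_iff).2 fun _ hk => hf.integrable_restrict _ hk.measure_lt_top.ne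

lemma isProbabilityMeasure : IsProbabilityMeasure (densityMeasure L f) := by
  constructor
  rw [densityMeasure, withDensity_apply _ MeasurableSet.univ, Measure.restrict_univ,
    ← ofReal_integral_eq_lintegral_ofReal (hf.integrable_restrict _ (by simp))
      (Eventually.of_forall fun x => (hf.pos x).le), hf.integral, ENNReal.ofReal_one]

lemma withDensity_Ioc {a b : ℝ} (h : a ≤ b) :
    (volume.withDensity fun x => ENNReal.ofReal (f x)) (Ioc a b) =
      ENNReal.ofReal (cdfOf f b - cdfOf f a) := by
  rw [withDensity_apply _ measurableSet_Ioc, hf.cdfOf_sub, intervalIntegral.integral_of_le h,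
    ofReal_integral_eq_lintegral_ofReal (hf.integrable_restrict _ (by simp))
      (Eventually.of_forall fun x => (hf.pos x).le)]

end

variable (hf₀ : IsNormalizedDensity L c C f₀) (hf : IsNormalizedDensity L c C f)

include hf₀ hf

lemma transportMap_transportMap (x : ℝ) : transportMap f f₀ (transportMap f₀ f x) = x := by
  rw [transportMap, hf.cdfOf_transportMap, hf₀.quantileOf_cdfOf]

lemma continuous_transportMap : Continuous (transportMap f₀ f) :=
  hf.continuous_quantileOf.comp hf₀.continuous_cdfOf

lemma transportMap_outside {x : ℝ} (hx : x ∉ Ioo 0 L) : transportMap f₀ f x = x := by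
  rw [transportMap, hf₀.cdfOf_outside hx, ← hf.cdfOf_outside hx, hf.quantileOf_cdfOf]

lemma strictMono_transportMap : StrictMono (transportMap f₀ f) := fun x y h => by
  have h1 := hf₀.strictMono_cdfOf h
  rw [← hf.cdfOf_transportMap f₀ x, ← hf.cdfOf_transportMap f₀ y] at h1
  exact hf.strictMono_cdfOf.lt_iff_lt.1 h1

lemma transportMap_mem_iff (x : ℝ) : transportMap f₀ f x ∈ Ioo 0 L ↔ x ∈ Ioo 0 L := by
  have hm := strictMono_transportMap hf₀ hf
  have h0 : transportMap f₀ f 0 = 0 := transportMap_outside hf₀ hf (by simp)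
  have h1 : transportMap f₀ f L = L := transportMap_outside hf₀ hf (by simp)
  constructor
  · rintro ⟨ha, hb⟩
    exact ⟨hm.lt_iff_lt.1 (h0.trans_lt ha), hm.lt_iff_lt.1 (hb.trans_eq h1.symm)⟩
  · rintro ⟨ha, hb⟩
    have ha' := hm ha
    have hb' := hm hb
    rw [h0] at ha'
    rw [h1] at hb'
    exact ⟨ha', hb'⟩

/-- Both sides are compared through the mass between the two points: at least `c` times the length
at the source, at most `C` times the length at the target. -/
lemma transportMap_expand {x x' : ℝ} (h : x ≤ x') :
    c / C * (x' - x) ≤ transportMap f₀ f x' - transportMap f₀ f x := by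
  have h1 := hf₀.le_cdfOf_sub h
  have h2 := hf.cdfOf_sub_le ((strictMono_transportMap hf₀ hf).monotone h)
  rw [hf.cdfOf_transportMap, hf.cdfOf_transportMap] at h2
  rw [div_mul_eq_mul_div, div_le_iff₀ hf.C_pos]
  linarith

lemma abs_transportMap_sub_le (x x' : ℝ) :
    |transportMap f₀ f x' - transportMap f₀ f x| ≤ C / c * |x' - x| := by
  have h1 := hf₀.abs_cdfOf_sub_le x x'
  have h2 := hf.le_abs_cdfOf_sub (transportMap f₀ f x) (transportMap f₀ f x')
  rw [hf.cdfOf_transportMap, hf.cdfOf_transportMap] at h2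
  rw [div_mul_eq_mul_div, le_div_iff₀ hf.c_pos]
  linarith

lemma isMonotoneMap_transportMap : IsMonotoneMap (transportMap f₀ f) (c / C) L where
  continuous := continuous_transportMap hf₀ hf
  lam_pos := div_pos hf.c_pos hf.C_pos
  lam_le_one := div_le_one_of_le₀ hf.c_le_C hf.C_pos.le
  expand := fun _ _ h => transportMap_expand hf₀ hf h
  bound := fun x => by
    by_cases hx : x ∈ Ioo 0 L
    · have h2 := (transportMap_mem_iff hf₀ hf x).2 hx
      rw [abs_le]
      constructor <;> linarith [h2.1, h2.2, hx.1, hx.2]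
    · rw [transportMap_outside hf₀ hf hx, sub_self, abs_zero]
      exact hf.L_pos.le

/-- The displacement vanishes outside `(0, L)`, so the potential is constant on each side of the
interval; inside, it is `L`-Lipschitz and starts from zero. -/
lemma abs_potential_transportMap_le (x : ℝ) : |potential (transportMap f₀ f) x| ≤ L * L := by
  have hT := isMonotoneMap_transportMap hf₀ hf
  have hL := hf.L_pos
  have hsub : ∀ a b, (∀ z ∈ uIcc a b, z ∉ Ioo 0 L) →
      potential (transportMap f₀ f) b = potential (transportMap f₀ f) a := by
    intro a b h
    have hi : ∀ a b, IntervalIntegrable (fun y => transportMap f₀ f y - y) volume a b := fun a b =>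
      (hT.continuous.sub continuous_id).intervalIntegrable _ _
    have h1 : potential (transportMap f₀ f) b - potential (transportMap f₀ f) a = 0 := by
      rw [potential, potential, intervalIntegral.integral_interval_sub_left (hi _ _) (hi _ _),
        intervalIntegral.integral_congr (g := fun _ => 0)]
      · simp
      · intro z hz
        simp only
        rw [transportMap_outside hf₀ hf (h z hz), sub_self]
    linarith
  have h0 : potential (transportMap f₀ f) 0 = 0 := by simp [potential]
  have hin : ∀ x, 0 ≤ x → x ≤ L → |potential (transportMap f₀ f) x| ≤ L * L := by
    intro x hx0 hxL
    have h1 := hT.potential_sub_le 0 x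
    have h2 := hT.potential_sub_le x 0
    rw [h0, sub_zero, sub_zero, abs_of_nonneg hx0] at h1
    rw [h0, zero_sub, zero_sub, abs_neg, abs_of_nonneg hx0] at h2
    rw [abs_le]
    constructor <;> nlinarith
  rcases le_total x 0 with h | h
  · rw [hsub 0 x (fun z hz h' => by rw [uIcc_of_ge h] at hz; linarith [hz.2, h'.1]), h0, abs_zero]
    positivity
  rcases le_total x L with h' | h'
  · exact hin x h h'
  · rw [hsub L x (fun z hz h'' => by rw [uIcc_of_le h'] at hz; linarith [hz.1, h''.2])]
    exact hin L hL.le le_rfl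

/-- The map preserves the primitives, so the two measures agree on half-open intervals. Working on
the whole line avoids treating the endpoints separately. -/
lemma map_transportMap_withDensity :
    (volume.withDensity fun x => ENNReal.ofReal (f₀ x)).map (transportMap f₀ f) =
      volume.withDensity fun x => ENNReal.ofReal (f x) := by
  symm
  have : IsLocallyFiniteMeasure (volume.withDensity fun x => ENNReal.ofReal (f x)) :=
    ⟨fun x => ⟨Ioc (x - 1) (x + 1), Ioc_mem_nhds (by linarith) (by linarith), by
      rw [hf.withDensity_Ioc (by linarith)]
      exact ENNReal.ofReal_lt_top⟩⟩
  refine Measure.ext_of_Ioc _ _ fun a b hab => ?_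
  rw [Measure.map_apply (continuous_transportMap hf₀ hf).measurable measurableSet_Ioc,
    hf.withDensity_Ioc hab.le]
  have hpre : transportMap f₀ f ⁻¹' Ioc a b = Ioc (transportMap f f₀ a) (transportMap f f₀ b) := by
    have hm := strictMono_transportMap hf₀ hf
    ext x
    have h1 : transportMap f₀ f (transportMap f f₀ a) = a := transportMap_transportMap hf hf₀ a
    have h2 : transportMap f₀ f (transportMap f f₀ b) = b := transportMap_transportMap hf hf₀ b
    rw [mem_preimage, mem_Ioc, mem_Ioc, ← hm.lt_iff_lt (a := transportMap f f₀ a),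
      ← hm.le_iff_le (b := transportMap f f₀ b), h1, h2]
  rw [hpre, hf₀.withDensity_Ioc ((strictMono_transportMap hf hf₀).monotone hab.le),
    hf₀.cdfOf_transportMap, hf₀.cdfOf_transportMap]

lemma map_transportMap : (densityMeasure L f₀).map (transportMap f₀ f) = densityMeasure L f := by
  have h := congrArg (fun μ : Measure ℝ => μ.restrict (Ioo 0 L)) (map_transportMap_withDensity hf₀ hf)
  rw [Measure.restrict_map (continuous_transportMap hf₀ hf).measurable measurableSet_Ioo,
    restrict_withDensity measurableSet_Ioo] at h
  have hpre : transportMap f₀ f ⁻¹' Ioo 0 L = Ioo 0 L := by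
    ext x; exact transportMap_mem_iff hf₀ hf x
  rw [hpre, restrict_withDensity measurableSet_Ioo] at h
  exact h

/-- Lebesgue differentiation of `cdfOf f₀` at `x` and of `cdfOf f` at `T x`, then the inverse
function rule. The exceptional set of the second is null in the target; its preimage is null because
`T` pushes `f₀ dx` to `f dx` and `f₀` is positive. -/
lemma ae_hasDerivAt_transportMap :
    ∀ᵐ x, HasDerivAt (transportMap f₀ f) (f₀ x / f (transportMap f₀ f x)) x := by
  have h1 : ∀ᵐ x, HasDerivAt (cdfOf f₀) (f₀ x) x := by
    filter_upwards [LocallyIntegrable.ae_hasDerivAt_integral hf₀.locallyIntegrable] with x hx using hx 0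
  have h2 : ∀ᵐ y, HasDerivAt (cdfOf f) (f y) y := by
    filter_upwards [LocallyIntegrable.ae_hasDerivAt_integral hf.locallyIntegrable] with x hx using hx 0
  have h3 : ∀ᵐ x, HasDerivAt (cdfOf f) (f (transportMap f₀ f x)) (transportMap f₀ f x) := by
    have hac : (volume : Measure ℝ) ≪ volume.withDensity fun x => ENNReal.ofReal (f₀ x) :=
      withDensity_absolutelyContinuous' hf₀.measurable.ennreal_ofReal.aemeasurable
        (Eventually.of_forall fun x => (ENNReal.ofReal_pos.2 (hf₀.pos x)).ne')
    refine hac.ae_le ?_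
    have h4 : ∀ᵐ y ∂(volume.withDensity fun x => ENNReal.ofReal (f x)),
        HasDerivAt (cdfOf f) (f y) y := (withDensity_absolutelyContinuous _ _).ae_le h2
    rw [← map_transportMap_withDensity hf₀ hf] at h4
    exact ae_of_ae_map (continuous_transportMap hf₀ hf).measurable.aemeasurable h4
  filter_upwards [h1, h3] with x hx1 hx3
  have h5 : HasDerivAt (quantileOf f) (f (transportMap f₀ f x))⁻¹ (cdfOf f₀ x) :=
    HasDerivAt.of_local_left_inverse (f := cdfOf f) hf.continuous_quantileOf.continuousAt hx3
      (hf.pos _).ne' (Eventually.of_forall hf.cdfOf_quantileOf)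
  refine (h5.comp x hx1).congr_deriv ?_
  rw [div_eq_mul_inv, mul_comm]

end IsNormalizedDensity


/-! ### Duality and the lower bound for the rate functional. -/

/-- The Donsker-Varadhan lower bound for the relative entropy. -/
lemma ofReal_sub_log_le_klDiv {α : Type*} [MeasurableSpace α] {μ ν : Measure α}
    [IsProbabilityMeasure μ] [IsProbabilityMeasure ν] {F : α → ℝ} (hF : Integrable F μ)
    (hF' : Integrable (fun x => Real.exp (F x)) ν) :
    ENNReal.ofReal (∫ x, F x ∂μ - Real.log (∫ x, Real.exp (F x) ∂ν)) ≤
      InformationTheory.klDiv μ ν := by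
  by_cases h : μ ≪ ν ∧ Integrable (llr μ ν) μ
  · rw [InformationTheory.klDiv_of_ac_of_integrable h.1 h.2]
    apply ENNReal.ofReal_le_ofReal
    -- The divergence from the tilted measure is nonnegative; expanding its log-likelihood ratio
    -- gives the claim.
    have h1 := integral_llr_tilted_right h.1 hF hF' h.2
    have : IsProbabilityMeasure (ν.tilted F) := isProbabilityMeasure_tilted hF'
    have h2 := InformationTheory.integral_llr_add_sub_measure_univ_nonneg
      (h.1.trans (absolutelyContinuous_tilted hF')) (integrable_llr_tilted_right h.1 hF h.2 hF')
    simp only [probReal_univ] at h2 ⊢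
    linarith
  · rw [not_and_or] at h
    rcases h with h | h
    · rw [InformationTheory.klDiv_of_not_ac h]; exact le_top
    · rw [InformationTheory.klDiv_of_not_integrable h]; exact le_top

lemma ofReal_integral_le_lintegral {α : Type*} [MeasurableSpace α] {μ : Measure α} {φ : α → ℝ}
    (hφ : Integrable φ μ) : ENNReal.ofReal (∫ x, φ x ∂μ) ≤ ∫⁻ x, ENNReal.ofReal (φ x) ∂μ := by
  calc ENNReal.ofReal (∫ x, φ x ∂μ) ≤ ENNReal.ofReal (∫ x, max (φ x) 0 ∂μ) :=
        ENNReal.ofReal_le_ofReal (integral_mono hφ hφ.pos_part fun x => le_max_left _ _)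
    _ = ∫⁻ x, ENNReal.ofReal (max (φ x) 0) ∂μ :=
        ofReal_integral_eq_lintegral_ofReal hφ.pos_part
          (Eventually.of_forall fun x => le_max_right _ _)
    _ = ∫⁻ x, ENNReal.ofReal (φ x) ∂μ := by simp

lemma measurable_heatKernel_prod (h : ℝ) : Measurable fun z : ℝ × ℝ => heatKernel h z.1 z.2 := by
  unfold heatKernel; fun_prop

lemma isProbabilityMeasure_brownianPairLaw {h : ℝ} (hh : 0 < h) (ρ₀ : Measure ℝ)
    [IsProbabilityMeasure ρ₀] : IsProbabilityMeasure (brownianPairLaw h ρ₀) := by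
  constructor
  rw [brownianPairLaw, withDensity_apply _ MeasurableSet.univ, Measure.restrict_univ,
    lintegral_prod _ (measurable_heatKernel_prod h).ennreal_ofReal.aemeasurable]
  have : ∀ x, ∫⁻ y, ENNReal.ofReal (heatKernel h x y) = 1 := fun x => by
    rw [← ofReal_integral_eq_lintegral_ofReal (integrable_heatKernel hh x)
      (Eventually.of_forall fun y => (heatKernel_pos hh x y).le), integral_heatKernel hh,
      ENNReal.ofReal_one]
  simp [this]

lemma ae_densityMeasure_mem (L : ℝ) (f : ℝ → ℝ) : ∀ᵐ x ∂(densityMeasure L f), x ∈ Ioo 0 L :=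
  (withDensity_absolutelyContinuous _ _).ae_le (ae_restrict_mem measurableSet_Ioo)

lemma IsMonotoneMap.continuous_hopfLax {T : ℝ → ℝ} {lam M : ℝ} (hT : IsMonotoneMap T lam M) :
    Continuous (hopfLax T 1) :=
  continuous_iff_continuousAt.2 fun z =>
    (hT.hasDerivAt_hopfLax zero_lt_one (by linarith [hT.lam_pos]) z).continuousAt

lemma integrable_weighted_heatFlow {T f₀ : ℝ → ℝ} {lam M K C L h : ℝ}
    (hT : IsMonotoneMap T lam M) (hf : Measurable f₀)
    (hh : 0 < h) (hK : ∀ x, |potential T x| ≤ K) (hC : ∀ x, f₀ x ≤ C) :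
    Integrable fun y => Real.exp (hopfLax T 1 y / h) *
      heatFlow (initialMeasure L T f₀ h) h y ^ 2 := by
  have := isFiniteMeasure_initialMeasure (L := L) hT hf hh hK hC
  obtain ⟨B, β, hB, hβ, hbd⟩ := exists_heatFlow_bounds (ae_initialMeasure L T f₀ h) hh le_rfl
  have h1 := hT.continuous_hopfLax
  have h2 := continuous_heatFlow (ae_initialMeasure L T f₀ h) hh
  refine integrable_of_gaussian_bound (B := Real.exp ((K + M ^ 2) / h) * B ^ 2) (by fun_prop) hβ
    fun y => ?_
  rw [abs_mul, abs_of_pos (Real.exp_pos _), mul_assoc, pow_two (heatFlow _ _ _)]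
  have h3 := (hbd h ⟨le_rfl, le_rfl⟩ y).1
  refine mul_le_mul ?_ (abs_mul_gaussian_le hβ hB h3 h3) (abs_nonneg _) (Real.exp_pos _).le
  gcongr
  exact (abs_le.1 (abs_hopfLax_le hT hK zero_lt_one (by linarith [hT.lam_pos]) y)).2

namespace IsNormalizedDensity

variable {L c C : ℝ} {f f₀ : ℝ → ℝ}

lemma integral_densityMeasure (hf : IsNormalizedDensity L c C f) (φ : ℝ → ℝ) :
    ∫ x, φ x ∂(densityMeasure L f) = ∫ x in Ioo 0 L, f x * φ x := by
  rw [densityMeasure, integral_withDensity_eq_integral_toReal_smul hf.measurable.ennreal_ofReal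
    (by simp)]
  simp_rw [ENNReal.toReal_ofReal (hf.pos _).le, smul_eq_mul]

lemma entropy_densityMeasure (hf : IsNormalizedDensity L c C f) :
    entropy (densityMeasure L f) = ∫ x, Real.log (f x) ∂(densityMeasure L f) := by
  rw [hf.integral_densityMeasure]
  have h0 : densityMeasure L f =
      volume.withDensity ((Ioo 0 L).indicator fun x => ENNReal.ofReal (f x)) := by
    rw [densityMeasure, withDensity_indicator measurableSet_Ioo]
  have h1 := Measure.rnDeriv_withDensity volume
    (hf.measurable.ennreal_ofReal.indicator (measurableSet_Ioo (a := (0 : ℝ)) (b := L)))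
  rw [← h0] at h1
  rw [entropy, ← integral_indicator measurableSet_Ioo]
  refine integral_congr_ae ?_
  filter_upwards [h1] with x hx
  rw [hx]
  by_cases hx' : x ∈ Ioo 0 L
  · simp only [indicator_of_mem hx', ENNReal.toReal_ofReal (hf.pos _).le]
  · simp only [indicator_of_notMem hx', ENNReal.toReal_zero, zero_mul]

lemma abs_log_le (hf : IsNormalizedDensity L c C f) (x : ℝ) :
    |Real.log (f x)| ≤ |Real.log c| + |Real.log C| := by
  have h1 := Real.log_le_log hf.c_pos (hf.le x)
  have h2 := Real.log_le_log (hf.pos x) (hf.ge x)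
  rw [abs_le]
  constructor
  · linarith [neg_abs_le (Real.log c), abs_nonneg (Real.log C)]
  · linarith [le_abs_self (Real.log C), abs_nonneg (Real.log c)]

variable (hf₀ : IsNormalizedDensity L c C f₀) (hf : IsNormalizedDensity L c C f)

include hf₀ hf

/-- The squared cost of the monotone rearrangement in terms of the dual potentials. -/
lemma integral_hopfLax_sub_integral_potential :
    2 * (∫ y, hopfLax (transportMap f₀ f) 1 y ∂(densityMeasure L f) -
      ∫ x, potential (transportMap f₀ f) x ∂(densityMeasure L f₀)) =
      ∫ x, (x - transportMap f₀ f x) ^ 2 ∂(densityMeasure L f₀) := by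
  have hT := isMonotoneMap_transportMap hf₀ hf
  have hK := abs_potential_transportMap_le hf₀ hf
  have := hf₀.isProbabilityMeasure
  have hc := hT.continuous
  rw [← map_transportMap hf₀ hf, integral_map hc.measurable.aemeasurable
    hT.continuous_hopfLax.aestronglyMeasurable]
  simp_rw [hT.hopfLax_one_map]
  have i1 : Integrable (potential (transportMap f₀ f)) (densityMeasure L f₀) :=
    Integrable.of_bound hT.continuous_potential.aestronglyMeasurable (L * L)
      (Eventually.of_forall hK)
  have i2 : Integrable (fun x => (transportMap f₀ f x - x) ^ 2 / 2) (densityMeasure L f₀) := by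
    refine Integrable.of_bound (Continuous.aestronglyMeasurable (by fun_prop)) (L ^ 2 / 2)
      (Eventually.of_forall fun x => ?_)
    rw [Real.norm_eq_abs, abs_of_nonneg (by positivity)]
    have := abs_le.1 (hT.bound x)
    have := sq_le_sq' this.1 this.2
    linarith
  rw [integral_add i1 i2, add_sub_cancel_left, ← integral_const_mul]
  refine integral_congr_ae (Eventually.of_forall fun x => ?_)
  simp only
  ring

/-- The coupling along the graph of the rearrangement gives the upper bound. The lower bound
integrates `two_mul_hopfLax_sub_le` against an arbitrary coupling, and the dual value equals the
cost of the rearrangement by `integral_hopfLax_sub_integral_potential`. -/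
lemma wassersteinDist_sq :
    wassersteinDist (densityMeasure L f) (densityMeasure L f₀) ^ 2 =
      ENNReal.ofReal (∫ x, (x - transportMap f₀ f x) ^ 2 ∂(densityMeasure L f₀)) := by
  have hT := isMonotoneMap_transportMap hf₀ hf
  have hK := abs_potential_transportMap_le hf₀ hf
  have := hf₀.isProbabilityMeasure
  have hc := hT.continuous
  have h1 : ∀ a : ℝ≥0∞, (a ^ (1 / 2 : ℝ)) ^ 2 = a := fun a => by
    rw [← ENNReal.rpow_natCast, ← ENNReal.rpow_mul]
    norm_num
  rw [wassersteinDist, h1]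
  refine le_antisymm ?_ ?_
  · refine (iInf₂_le ((densityMeasure L f₀).map fun x => (transportMap f₀ f x, x)) ?_).trans ?_
    · refine ⟨Measure.isProbabilityMeasure_map (by fun_prop), ?_, ?_⟩
      · rw [Measure.map_map (by fun_prop) (by fun_prop)]
        exact map_transportMap hf₀ hf
      · rw [Measure.map_map (by fun_prop) (by fun_prop)]
        exact Measure.map_id
    · rw [lintegral_map (by fun_prop) (by fun_prop), ofReal_integral_eq_lintegral_ofReal]
      · refine lintegral_mono fun x => ?_
        simp only
        rw [show (transportMap f₀ f x - x) ^ 2 = (x - transportMap f₀ f x) ^ 2 by ring]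
      · refine Integrable.of_bound (Continuous.aestronglyMeasurable (by fun_prop)) (L ^ 2)
          (Eventually.of_forall fun x => ?_)
        rw [Real.norm_eq_abs, abs_of_nonneg (by positivity)]
        have := abs_le.1 (hT.bound x)
        have := sq_le_sq' this.1 this.2
        nlinarith
      · exact Eventually.of_forall fun x => sq_nonneg _
  · refine le_iInf₂ fun γ hγ => ?_
    obtain ⟨hγp, hγ1, hγ2⟩ := hγ
    have hb := abs_hopfLax_le hT hK zero_lt_one (by linarith [hT.lam_pos])
    have hc1 := hT.continuous_hopfLax
    have hc2 := hT.continuous_potential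
    have i1 : Integrable (fun z : ℝ × ℝ => hopfLax (transportMap f₀ f) 1 z.1) γ :=
      Integrable.of_bound (Continuous.aestronglyMeasurable (by fun_prop)) (L * L + L ^ 2)
        (Eventually.of_forall fun z => hb _)
    have i2 : Integrable (fun z : ℝ × ℝ => potential (transportMap f₀ f) z.2) γ :=
      Integrable.of_bound (Continuous.aestronglyMeasurable (by fun_prop)) (L * L)
        (Eventually.of_forall fun z => hK _)
    have e : ∫ x, (x - transportMap f₀ f x) ^ 2 ∂(densityMeasure L f₀) =
        ∫ z, 2 * (hopfLax (transportMap f₀ f) 1 z.1 - potential (transportMap f₀ f) z.2) ∂γ := by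
      rw [← integral_hopfLax_sub_integral_potential hf₀ hf, integral_const_mul,
        integral_sub i1 i2, ← hγ1, ← hγ2, integral_map measurable_fst.aemeasurable
          hc1.aestronglyMeasurable, integral_map measurable_snd.aemeasurable
          hc2.aestronglyMeasurable]
    rw [e]
    refine (ofReal_integral_le_lintegral ((i1.sub i2).const_mul 2)).trans ?_
    exact lintegral_mono fun z => ENNReal.ofReal_le_ofReal ((hT.two_mul_hopfLax_sub_le z.2 z.1).trans_eq (by ring))

/-- The dual weight of the lower bound has integral at most one. -/
lemma integral_dual_weight_le_one {h : ℝ} (hh : 0 < h) :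
    ∫ z, (Ioo 0 L).indicator (fun y => Real.sqrt (f y) *
        Real.exp (hopfLax (transportMap f₀ f) 1 y / (2 * h))) z.2 *
      (Real.exp (-(potential (transportMap f₀ f) z.1) / (2 * h)) / Real.sqrt (f₀ z.1))
      ∂(brownianPairLaw h (densityMeasure L f₀)) ≤ 1 := by
  set T := transportMap f₀ f with hT_def
  have hT : IsMonotoneMap T (c / C) L := isMonotoneMap_transportMap hf₀ hf
  have hK : ∀ x, |potential T x| ≤ L * L := abs_potential_transportMap_le hf₀ hf
  have := hf₀.isProbabilityMeasure
  have := isProbabilityMeasure_brownianPairLaw hh (densityMeasure L f₀)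
  have hb := abs_hopfLax_le hT hK zero_lt_one (by linarith [hT.lam_pos])
  have hmp := hT.continuous_potential.measurable
  have hmh := hT.continuous_hopfLax.measurable
  set G : ℝ → ℝ := (Ioo 0 L).indicator fun y => Real.sqrt (f y) *
    Real.exp (hopfLax T 1 y / (2 * h)) with hG
  set H : ℝ → ℝ := fun x => Real.exp (-(potential T x) / (2 * h)) / Real.sqrt (f₀ x) with hH
  have hGm : Measurable G := by
    refine Measurable.indicator ?_ measurableSet_Ioo
    have := hf.measurable
    fun_prop
  have hHm : Measurable H := by
    have := hf₀.measurable
    simp only [hH]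
    fun_prop
  have hG0 : ∀ y, 0 ≤ G y := fun y => indicator_nonneg (fun y _ => by positivity) y
  have hH0 : ∀ x, 0 ≤ H x := fun x => by simp only [hH]; positivity
  have hGb : ∀ y, G y ≤ Real.sqrt C * Real.exp ((L * L + L ^ 2) / (2 * h)) := by
    intro y
    have h1 := Real.sqrt_le_sqrt (hf.ge y)
    have h2 := (abs_le.1 (hb y)).2
    by_cases hy : y ∈ Ioo 0 L
    · simp only [hG, indicator_of_mem hy]
      gcongr
    · simp only [hG, indicator_of_notMem hy]
      positivity
  have hHb : ∀ x, H x ≤ Real.exp (L * L / (2 * h)) / Real.sqrt c := by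
    intro x
    have h1 := Real.sqrt_le_sqrt (hf₀.le x)
    have h2 := (abs_le.1 (hK x)).1
    have h3 : 0 < Real.sqrt c := Real.sqrt_pos.2 hf.c_pos
    simp only [hH]
    gcongr
    linarith
  have hint : Integrable (fun z : ℝ × ℝ => G z.2 * H z.1)
      (brownianPairLaw h (densityMeasure L f₀)) := by
    refine Integrable.of_bound (Measurable.aestronglyMeasurable (by fun_prop))
      ((Real.sqrt C * Real.exp ((L * L + L ^ 2) / (2 * h))) *
        (Real.exp (L * L / (2 * h)) / Real.sqrt c)) (Eventually.of_forall fun z => ?_)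
    rw [Real.norm_eq_abs, abs_of_nonneg (mul_nonneg (hG0 _) (hH0 _))]
    exact mul_le_mul (hGb _) (hHb _) (hH0 _) (by positivity)
  rw [brownianPairLaw] at hint ⊢
  have hPm := (measurable_heatKernel_prod h).ennreal_ofReal
  rw [integrable_withDensity_iff_integrable_smul₀' hPm.aemeasurable (by simp)] at hint
  rw [integral_withDensity_eq_integral_toReal_smul hPm (by simp)]
  simp_rw [ENNReal.toReal_ofReal (heatKernel_pos hh _ _).le, smul_eq_mul] at hint ⊢
  rw [integral_prod_symm _ hint]
  have hIle := integral_weighted_heatFlow_le_one (L := L) hT hf₀.measurable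
    (fun x => (hf₀.pos x).le) hh hK hf₀.ge hf₀.integral
  have hIint := integrable_weighted_heatFlow (L := L) hT hf₀.measurable hh hK hf₀.ge
  set I : ℝ → ℝ := fun y => Real.exp (hopfLax T 1 y / h) *
      heatFlow (initialMeasure L T f₀ h) h y ^ 2 with hI
  have hI0 : ∀ y, 0 ≤ I y := fun y => by simp only [hI]; positivity
  -- Integration in `x` against `f₀` turns the factor `1 / √f₀` into `√f₀`, which is the factor in
  -- `initialWeight`.
  have hinner : ∀ y, ∫ x, heatKernel h x y * (G y * H x) ∂(densityMeasure L f₀) =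
      G y * heatFlow (initialMeasure L T f₀ h) h y := by
    intro y
    rw [hf₀.integral_densityMeasure, heatFlow_initialMeasure hT hf₀.measurable,
      ← integral_const_mul]
    refine integral_congr_ae (Eventually.of_forall fun x => ?_)
    simp only [hH, initialWeight]
    have h1 : Real.sqrt (f₀ x) ≠ 0 := (Real.sqrt_pos.2 (hf₀.pos x)).ne'
    nth_rewrite 1 [← Real.mul_self_sqrt (hf₀.pos x).le]
    field_simp
  -- Young's inequality applied to `√f` and `exp (g / (2h)) v`, where `g = hopfLax T 1`. The squares
  -- are `f` and the integrand of the weighted estimate, each with integral at most one.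
  have hle : ∀ y, G y * heatFlow (initialMeasure L T f₀ h) h y ≤
      (Ioo 0 L).indicator (fun y => (f y + I y) / 2) y := by
    intro y
    by_cases hy : y ∈ Ioo 0 L
    · simp only [hG, indicator_of_mem hy]
      have h1 : f y = Real.sqrt (f y) ^ 2 := (Real.sq_sqrt (hf.pos y).le).symm
      have h2 : Real.exp (hopfLax T 1 y / h) = Real.exp (hopfLax T 1 y / (2 * h)) ^ 2 := by
        rw [← Real.exp_nat_mul]; congr 1; push_cast; field_simp
      simp only [hI]
      rw [h2]
      nth_rewrite 2 [h1]
      nlinarith [sq_nonneg (Real.sqrt (f y) - Real.exp (hopfLax T 1 y / (2 * h)) *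
        heatFlow (initialMeasure L T f₀ h) h y)]
    · simp only [hG, indicator_of_notMem hy, zero_mul, le_refl]
  have hfint := hf.integrable_restrict (Ioo 0 L) (by simp)
  calc ∫ y, ∫ x, heatKernel h x y * (G y * H x) ∂(densityMeasure L f₀)
      = ∫ y, G y * heatFlow (initialMeasure L T f₀ h) h y := by simp_rw [hinner]
    _ ≤ ∫ y, (Ioo 0 L).indicator (fun y => (f y + I y) / 2) y := by
        refine integral_mono_of_nonneg (Eventually.of_forall fun y =>
          mul_nonneg (hG0 y) (heatFlow_nonneg _ hh y)) ?_ (Eventually.of_forall hle)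
        rw [integrable_indicator_iff measurableSet_Ioo]
        exact (hfint.add hIint.restrict).div_const 2
    _ = ((∫ y in Ioo 0 L, f y) + ∫ y in Ioo 0 L, I y) / 2 := by
        rw [integral_indicator measurableSet_Ioo, integral_div, integral_add hfint hIint.restrict]
    _ ≤ (1 + 1) / 2 := by
        rw [hf.integral]
        have : ∫ y in Ioo 0 L, I y ≤ ∫ y, I y :=
          setIntegral_le_integral hIint (Eventually.of_forall hI0)
        linarith
    _ = 1 := by norm_num

/-- The lower bound for the rate functional, valid for every `h > 0`. -/
theorem ofReal_le_rateFunctional {h : ℝ} (hh : 0 < h) :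
    ENNReal.ofReal (1 / 2 * entropy (densityMeasure L f) - 1 / 2 * entropy (densityMeasure L f₀) +
      (∫ x, (x - transportMap f₀ f x) ^ 2 ∂(densityMeasure L f₀)) / (4 * h)) ≤
      rateFunctional h (densityMeasure L f) (densityMeasure L f₀) := by
  refine le_iInf₂ fun q hq => ?_
  obtain ⟨hqp, hq1, hq2⟩ := hq
  have hdual := integral_dual_weight_le_one hf₀ hf hh
  rw [← integral_hopfLax_sub_integral_potential hf₀ hf]
  set T := transportMap f₀ f with hT_def
  have hT : IsMonotoneMap T (c / C) L := isMonotoneMap_transportMap hf₀ hf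
  have hK : ∀ x, |potential T x| ≤ L * L := abs_potential_transportMap_le hf₀ hf
  have := hf₀.isProbabilityMeasure
  have := hf.isProbabilityMeasure
  have := isProbabilityMeasure_brownianPairLaw hh (densityMeasure L f₀)
  have hb := abs_hopfLax_le hT hK zero_lt_one (by linarith [hT.lam_pos])
  have hmp := hT.continuous_potential.measurable
  have hmh := hT.continuous_hopfLax.measurable
  have hmf := hf.measurable
  have hmf₀ := hf₀.measurable
  -- The test function depends on `q` only through marginal integrals, and these add up to half the
  -- entropy difference plus the transport cost divided by `4h`.
  set F₀ : ℝ × ℝ → ℝ := fun z => (1 / 2 * Real.log (f z.2) - 1 / 2 * Real.log (f₀ z.1)) +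
    (hopfLax T 1 z.2 - potential T z.1) / (2 * h) with hF₀
  set B := |Real.log c| + |Real.log C| + (L * L + L ^ 2 + L * L) / (2 * h) with hB
  have hF₀m : Measurable F₀ := by simp only [hF₀]; fun_prop
  have hF₀b : ∀ z, |F₀ z| ≤ B := by
    intro z
    have a1 := abs_le.1 (hf.abs_log_le z.2)
    have a2 := abs_le.1 (hf₀.abs_log_le z.1)
    have a3 := abs_le.1 (hb z.2)
    have a4 := abs_le.1 (hK z.1)
    have a5 : |(hopfLax T 1 z.2 - potential T z.1) / (2 * h)| ≤
        (L * L + L ^ 2 + L * L) / (2 * h) := by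
      rw [abs_div, abs_of_pos (by positivity : 0 < 2 * h)]
      gcongr
      rw [abs_le]; constructor <;> linarith
    have a6 := abs_le.1 a5
    simp only [hF₀, hB]
    rw [abs_le]; constructor <;> linarith
  -- The Brownian endpoint may leave `(0, L)`, where the dual weight is zero and its logarithm is
  -- not finite. The penalty `-N` there keeps the test function bounded and is invisible to `q`.
  set χ : ℝ → ℝ × ℝ → ℝ := fun N z => (Ioo 0 L)ᶜ.indicator (fun _ => -N) z.2 with hχ
  have hχm : ∀ N, Measurable (χ N) := fun N =>
    (measurable_const.indicator measurableSet_Ioo.compl).comp measurable_snd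
  have hχb : ∀ N z, |χ N z| ≤ |N| := by
    intro N z
    by_cases hz : z.2 ∈ Ioo 0 L
    · simp [hχ, hz]
    · simp only [hχ]
      rw [indicator_of_mem (by exact hz), abs_neg]
  have hFq : ∀ N, Integrable (fun z => F₀ z + χ N z) q := fun N =>
    Integrable.of_bound (hF₀m.add (hχm N)).aestronglyMeasurable (B + |N|)
      (Eventually.of_forall fun z => (abs_add_le _ _).trans (add_le_add (hF₀b z) (hχb N z)))
  have hFq' : ∀ N, Integrable (fun z => Real.exp (F₀ z + χ N z))
      (brownianPairLaw h (densityMeasure L f₀)) := fun N => by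
    refine Integrable.of_bound (hF₀m.add (hχm N)).exp.aestronglyMeasurable (Real.exp (B + |N|))
      (Eventually.of_forall fun z => ?_)
    rw [Real.norm_eq_abs, abs_of_pos (Real.exp_pos _)]
    gcongr
    exacts [(abs_le.1 (hF₀b z)).2, (abs_le.1 (hχb N z)).2]
  have hint : ∀ N, ∫ z, F₀ z + χ N z ∂q =
      1 / 2 * entropy (densityMeasure L f) - 1 / 2 * entropy (densityMeasure L f₀) +
      2 * (∫ y, hopfLax T 1 y ∂(densityMeasure L f) -
      ∫ x, potential T x ∂(densityMeasure L f₀)) / (4 * h) := by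
    intro N
    have hz : ∀ᵐ z ∂q, z.2 ∈ Ioo 0 L := by
      have := ae_densityMeasure_mem L f
      rw [← hq2] at this
      exact ae_of_ae_map measurable_snd.aemeasurable this
    have e1 : ∫ z, F₀ z + χ N z ∂q = ∫ z, F₀ z ∂q := by
      refine integral_congr_ae ?_
      filter_upwards [hz] with z hz
      simp [hχ, hz]
    have j1 : Integrable (fun z : ℝ × ℝ => Real.log (f z.2)) q :=
      Integrable.of_bound (Measurable.aestronglyMeasurable (by fun_prop)) _
        (Eventually.of_forall fun z => hf.abs_log_le z.2)
    have j2 : Integrable (fun z : ℝ × ℝ => Real.log (f₀ z.1)) q :=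
      Integrable.of_bound (Measurable.aestronglyMeasurable (by fun_prop)) _
        (Eventually.of_forall fun z => hf₀.abs_log_le z.1)
    have j3 : Integrable (fun z : ℝ × ℝ => hopfLax T 1 z.2) q :=
      Integrable.of_bound (Measurable.aestronglyMeasurable (by fun_prop)) _
        (Eventually.of_forall fun z => hb z.2)
    have j4 : Integrable (fun z : ℝ × ℝ => potential T z.1) q :=
      Integrable.of_bound (Measurable.aestronglyMeasurable (by fun_prop)) _
        (Eventually.of_forall fun z => hK z.1)
    have k1 : ∀ φ : ℝ → ℝ, Measurable φ → ∫ z, φ z.2 ∂q = ∫ y, φ y ∂(densityMeasure L f) :=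
      fun φ hφ => by
        rw [← hq2, integral_map measurable_snd.aemeasurable hφ.aestronglyMeasurable]
    have k2 : ∀ φ : ℝ → ℝ, Measurable φ → ∫ z, φ z.1 ∂q = ∫ y, φ y ∂(densityMeasure L f₀) :=
      fun φ hφ => by
        rw [← hq1, integral_map measurable_fst.aemeasurable hφ.aestronglyMeasurable]
    rw [e1, hf.entropy_densityMeasure, hf₀.entropy_densityMeasure]
    simp only [hF₀]
    have jA : Integrable (fun z : ℝ × ℝ => 1 / 2 * Real.log (f z.2) - 1 / 2 * Real.log (f₀ z.1)) q :=
      (j1.const_mul _).sub (j2.const_mul _)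
    have jB : Integrable (fun z : ℝ × ℝ => (hopfLax T 1 z.2 - potential T z.1) / (2 * h)) q :=
      (j3.sub j4).div_const _
    rw [integral_add jA jB,
      integral_sub (j1.const_mul _) (j2.const_mul _), integral_div, integral_sub j3 j4,
      integral_const_mul, integral_const_mul, k1 _ hmh, k2 _ hmp,
      k1 (fun y => Real.log (f y)) (by fun_prop), k2 (fun y => Real.log (f₀ y)) (by fun_prop)]
    field_simp
    ring
  have hexp : ∀ N, ∫ z, Real.exp (F₀ z + χ N z) ∂(brownianPairLaw h (densityMeasure L f₀)) ≤
      1 + Real.exp B * Real.exp (-N) := by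
    intro N
    set W : ℝ × ℝ → ℝ := fun z => (Ioo 0 L).indicator (fun y => Real.sqrt (f y) *
        Real.exp (hopfLax T 1 y / (2 * h))) z.2 *
      (Real.exp (-(potential T z.1) / (2 * h)) / Real.sqrt (f₀ z.1)) with hW
    have hWpos : ∀ z, 0 ≤ W z := fun z =>
      mul_nonneg (indicator_nonneg (fun y _ => by positivity) _) (by positivity)
    have hsq : ∀ x, 0 < x → Real.exp (1 / 2 * Real.log x) = Real.sqrt x := fun x hx => by
      rw [show 1 / 2 * Real.log x = Real.log x / 2 by ring, ← Real.log_sqrt hx.le,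
        Real.exp_log (Real.sqrt_pos.2 hx)]
    have hWF : ∀ z : ℝ × ℝ, z.2 ∈ Ioo 0 L → W z = Real.exp (F₀ z) := by
      intro z hz
      simp only [hW, hF₀]
      rw [indicator_of_mem hz, Real.exp_add, Real.exp_sub, hsq _ (hf.pos _), hsq _ (hf₀.pos _),
        show (hopfLax T 1 z.2 - potential T z.1) / (2 * h) =
          hopfLax T 1 z.2 / (2 * h) + -(potential T z.1) / (2 * h) by ring, Real.exp_add]
      ring
    have hWm : Measurable W := by
      simp only [hW]
      refine Measurable.mul (Measurable.comp (g := (Ioo 0 L).indicator (fun y => Real.sqrt (f y) *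
        Real.exp (hopfLax T 1 y / (2 * h))))
        (Measurable.indicator (by fun_prop) measurableSet_Ioo) measurable_snd) (by fun_prop)
    have hWint : Integrable W (brownianPairLaw h (densityMeasure L f₀)) := by
      refine Integrable.of_bound hWm.aestronglyMeasurable (Real.exp B)
        (Eventually.of_forall fun z => ?_)
      rw [Real.norm_eq_abs, abs_of_nonneg (hWpos z)]
      by_cases hz : z.2 ∈ Ioo 0 L
      · rw [hWF z hz]
        exact Real.exp_le_exp.2 (abs_le.1 (hF₀b z)).2
      · simp only [hW]
        rw [indicator_of_notMem hz, zero_mul]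
        exact (Real.exp_pos _).le
    have hle : ∀ z, Real.exp (F₀ z + χ N z) ≤ W z + Real.exp B * Real.exp (-N) := by
      intro z
      by_cases hz : z.2 ∈ Ioo 0 L
      · have : χ N z = 0 := by simp [hχ, hz]
        rw [hWF z hz, this, add_zero]
        have : 0 ≤ Real.exp B * Real.exp (-N) := by positivity
        linarith
      · have : χ N z = -N := by
          simp only [hχ]; rw [indicator_of_mem (by exact hz)]
        rw [this, Real.exp_add]
        have h1 := hWpos z
        have h2 : Real.exp (F₀ z) * Real.exp (-N) ≤ Real.exp B * Real.exp (-N) := by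
          gcongr; exact (abs_le.1 (hF₀b z)).2
        linarith
    refine (integral_mono (hFq' N) (hWint.add (integrable_const _)) hle).trans ?_
    simp only [Pi.add_apply]
    rw [integral_add hWint (integrable_const _)]
    simp only [integral_const, probReal_univ, one_smul]
    linarith
  set R := 1 / 2 * entropy (densityMeasure L f) - 1 / 2 * entropy (densityMeasure L f₀) +
      2 * (∫ y, hopfLax T 1 y ∂(densityMeasure L f) -
      ∫ x, potential T x ∂(densityMeasure L f₀)) / (4 * h) with hR
  have hmain : ∀ N : ℝ, ENNReal.ofReal (R - Real.log (1 + Real.exp B * Real.exp (-N))) ≤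
      InformationTheory.klDiv q (brownianPairLaw h (densityMeasure L f₀)) := by
    intro N
    refine le_trans (ENNReal.ofReal_le_ofReal ?_) (ofReal_sub_log_le_klDiv (hFq N) (hFq' N))
    rw [hint N]
    have hpos : 0 < ∫ z, Real.exp (F₀ z + χ N z) ∂(brownianPairLaw h (densityMeasure L f₀)) :=
      integral_exp_pos (hFq' N)
    have := Real.log_le_log hpos (hexp N)
    linarith
  -- As `N → ∞` the exterior contribution to the exponential integral disappears.
  have hlim : Tendsto (fun N : ℝ => ENNReal.ofReal
      (R - Real.log (1 + Real.exp B * Real.exp (-N)))) atTop (𝓝 (ENNReal.ofReal R)) := by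
    refine (ENNReal.continuous_ofReal.tendsto R).comp ?_
    have h1 : Tendsto (fun N : ℝ => 1 + Real.exp B * Real.exp (-N)) atTop (𝓝 (1 + Real.exp B * 0)) :=
      ((Real.tendsto_exp_neg_atTop_nhds_zero).const_mul _).const_add _
    rw [mul_zero, add_zero] at h1
    have h2 := (h1.log one_ne_zero).const_sub R
    simpa using h2
  exact le_of_tendsto hlim (Eventually.of_forall hmain)

end IsNormalizedDensity


/-! ### Self-couplings of the initial measure and the upper bound they give. -/

/-- A bounded symmetric density, relative to `μ ⊗ μ`, of a coupling of `μ` with itself. -/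
structure IsSelfCoupling (μ : Measure ℝ) (k : ℝ × ℝ → ℝ) (B : ℝ) : Prop where
  measurable : Measurable k
  nonneg : ∀ z, 0 ≤ k z
  le : ∀ z, k z ≤ B
  symm : ∀ z, k z.swap = k z
  row : ∀ᵐ x ∂μ, ∫ x', k (x, x') ∂μ = 1

namespace IsSelfCoupling

variable {μ : Measure ℝ} [IsProbabilityMeasure μ] {k : ℝ × ℝ → ℝ} {B : ℝ}
  (hk : IsSelfCoupling μ k B)

include hk

lemma integrable_mul {φ : ℝ × ℝ → ℝ} (hφ : Measurable φ) {D : ℝ}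
    (hD : ∀ᵐ z ∂(μ.prod μ), |φ z| ≤ D) : Integrable (fun z => k z * φ z) (μ.prod μ) := by
  refine Integrable.of_bound (hk.measurable.mul hφ).aestronglyMeasurable (B * D) ?_
  filter_upwards [hD] with z hz
  rw [Real.norm_eq_abs, abs_mul, abs_of_nonneg (hk.nonneg z)]
  exact mul_le_mul (hk.le z) hz (abs_nonneg _) ((hk.nonneg z).trans (hk.le z))

lemma integral_fst {ψ : ℝ → ℝ} (hψ : Measurable ψ) {D : ℝ} (hD : ∀ᵐ x ∂μ, |ψ x| ≤ D) :
    ∫ z, k z * ψ z.1 ∂(μ.prod μ) = ∫ x, ψ x ∂μ := by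
  have hi : Integrable (fun z => k z * ψ z.1) (μ.prod μ) :=
    hk.integrable_mul (hψ.comp measurable_fst) (Measure.quasiMeasurePreserving_fst.ae hD)
  rw [integral_prod _ hi]
  refine integral_congr_ae ?_
  filter_upwards [hk.row] with x hx
  rw [integral_mul_const, hx, one_mul]

lemma integral_swap (φ : ℝ × ℝ → ℝ) :
    ∫ z, k z * φ z.swap ∂(μ.prod μ) = ∫ z, k z * φ z ∂(μ.prod μ) := by
  rw [← integral_prod_swap (μ := μ) (ν := μ) (fun z => k z * φ z)]
  refine integral_congr_ae (Eventually.of_forall fun z => ?_)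
  simp only [hk.symm]

lemma integral_snd {ψ : ℝ → ℝ} (hψ : Measurable ψ) {D : ℝ} (hD : ∀ᵐ x ∂μ, |ψ x| ≤ D) :
    ∫ z, k z * ψ z.2 ∂(μ.prod μ) = ∫ x, ψ x ∂μ := by
  rw [← hk.integral_fst hψ hD, ← hk.integral_swap]
  rfl

lemma integral_antisymm {φ : ℝ × ℝ → ℝ} (hφ : ∀ z, φ z.swap = -φ z) :
    ∫ z, k z * φ z ∂(μ.prod μ) = 0 := by
  have h := hk.integral_swap φ
  simp_rw [hφ, mul_neg] at h
  rw [integral_neg] at h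
  linarith

lemma integral_withDensity (φ : ℝ × ℝ → ℝ) :
    ∫ z, φ z ∂((μ.prod μ).withDensity fun z => ENNReal.ofReal (k z)) =
      ∫ z, k z * φ z ∂(μ.prod μ) := by
  rw [integral_withDensity_eq_integral_toReal_smul hk.measurable.ennreal_ofReal (by simp)]
  simp_rw [ENNReal.toReal_ofReal (hk.nonneg _), smul_eq_mul]

lemma integrable_withDensity_iff {φ : ℝ × ℝ → ℝ} :
    Integrable φ ((μ.prod μ).withDensity fun z => ENNReal.ofReal (k z)) ↔
      Integrable (fun z => k z * φ z) (μ.prod μ) := by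
  rw [integrable_withDensity_iff_integrable_smul₀' hk.measurable.ennreal_ofReal.aemeasurable
    (by simp)]
  simp_rw [ENNReal.toReal_ofReal (hk.nonneg _), smul_eq_mul]

lemma lintegral_row : ∀ᵐ x ∂μ, ∫⁻ x', ENNReal.ofReal (k (x, x')) ∂μ = 1 := by
  filter_upwards [hk.row] with x hx
  rw [← ofReal_integral_eq_lintegral_ofReal _ (Eventually.of_forall fun x' => hk.nonneg _), hx,
    ENNReal.ofReal_one]
  refine Integrable.of_bound (hk.measurable.comp measurable_prodMk_left).aestronglyMeasurable B
    (Eventually.of_forall fun x' => ?_)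
  rw [Real.norm_eq_abs]
  rw [abs_of_nonneg (hk.nonneg _)]
  exact hk.le _

lemma map_fst_withDensity :
    ((μ.prod μ).withDensity fun z => ENNReal.ofReal (k z)).map Prod.fst = μ := by
  ext s hs
  rw [Measure.map_apply measurable_fst hs, withDensity_apply _ (measurable_fst hs),
    ← lintegral_indicator (measurable_fst hs),
    lintegral_prod _ (hk.measurable.ennreal_ofReal.indicator (measurable_fst hs)).aemeasurable]
  have : ∀ᵐ x ∂μ, ∫⁻ x', (Prod.fst ⁻¹' s).indicator (fun z => ENNReal.ofReal (k z)) (x, x') ∂μ =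
      s.indicator 1 x := by
    filter_upwards [hk.lintegral_row] with x hx
    by_cases hxs : x ∈ s
    · simp only [indicator, mem_preimage, hxs, if_true, hx, Pi.one_apply]
    · simp [indicator, hxs]
  rw [lintegral_congr_ae this, lintegral_indicator_one hs]

lemma map_snd_withDensity :
    ((μ.prod μ).withDensity fun z => ENNReal.ofReal (k z)).map Prod.snd = μ := by
  ext s hs
  rw [Measure.map_apply measurable_snd hs, withDensity_apply _ (measurable_snd hs),
    ← lintegral_indicator (measurable_snd hs),
    lintegral_prod_symm _ (hk.measurable.ennreal_ofReal.indicator (measurable_snd hs)).aemeasurable]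
  have : ∀ᵐ y ∂μ, ∫⁻ x, (Prod.snd ⁻¹' s).indicator (fun z => ENNReal.ofReal (k z)) (x, y) ∂μ =
      s.indicator 1 y := by
    filter_upwards [hk.lintegral_row] with y hy
    by_cases hys : y ∈ s
    · simp only [indicator, mem_preimage, hys, if_true, Pi.one_apply]
      rw [← hy]
      exact lintegral_congr fun x => by rw [← hk.symm (x, y)]; rfl
    · simp [indicator, hys]
  rw [lintegral_congr_ae this, lintegral_indicator_one hs]

lemma isProbabilityMeasure_withDensity :
    IsProbabilityMeasure ((μ.prod μ).withDensity fun z => ENNReal.ofReal (k z)) := by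
  constructor
  have h : ((μ.prod μ).withDensity fun z => ENNReal.ofReal (k z)).map Prod.fst univ = μ univ := by
    rw [hk.map_fst_withDensity]
  rwa [Measure.map_apply measurable_fst MeasurableSet.univ, preimage_univ,
    measure_univ (μ := μ)] at h

/-- The entropy density of a bounded density is integrable. -/
lemma integrable_mul_log : Integrable (fun z => k z * Real.log (k z)) (μ.prod μ) := by
  have hc : Continuous fun t : ℝ => t * Real.log t := Real.continuous_mul_log
  obtain ⟨D, hD⟩ := (isCompact_Icc (a := (0 : ℝ)) (b := B)).exists_bound_of_continuousOn
    hc.continuousOn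
  exact Integrable.of_bound (hc.measurable.comp hk.measurable).aestronglyMeasurable D
    (Eventually.of_forall fun z => hD _ ⟨hk.nonneg z, hk.le z⟩)

end IsSelfCoupling

namespace IsNormalizedDensity

variable {L c C : ℝ} {f f₀ : ℝ → ℝ} (hf₀ : IsNormalizedDensity L c C f₀)
  (hf : IsNormalizedDensity L c C f)

include hf₀ hf

/-- The density, relative to `brownianPairLaw`, of the coupling of `ρ₀` and `ρ` obtained from a
self-coupling of `ρ₀`. -/
lemma map_selfCoupling_eq {h : ℝ} (hh : 0 < h) {k : ℝ × ℝ → ℝ} {B : ℝ}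
    (hk : IsSelfCoupling (densityMeasure L f₀) k B) :
    (((densityMeasure L f₀).prod (densityMeasure L f₀)).withDensity
      fun z => ENNReal.ofReal (k z)).map (fun z => (z.1, transportMap f₀ f z.2)) =
    (brownianPairLaw h (densityMeasure L f₀)).withDensity fun z =>
      ENNReal.ofReal (k (z.1, transportMap f f₀ z.2) * (Ioo 0 L).indicator f z.2 /
        heatKernel h z.1 z.2) := by
  have := hf₀.isProbabilityMeasure
  have := hf.isProbabilityMeasure
  have hTm := (continuous_transportMap hf₀ hf).measurable
  have hSm := (continuous_transportMap hf hf₀).measurable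
  have hkm := hk.measurable
  have hPm := measurable_heatKernel_prod h
  set μ := densityMeasure L f₀ with hμ
  set K : ℝ × ℝ → ℝ≥0∞ := fun z => ENNReal.ofReal (k (z.1, transportMap f f₀ z.2)) with hK
  have hKm : Measurable K := by simp only [hK]; fun_prop
  have him : Measurable fun y => (Ioo 0 L).indicator f y := hf.measurable.indicator measurableSet_Ioo
  have e1 : ((μ.prod μ).withDensity fun z => ENNReal.ofReal (k z)).map
      (fun z => (z.1, transportMap f₀ f z.2)) = (μ.prod (densityMeasure L f)).withDensity K := by
    have hmap : (μ.prod μ).map (fun z => (z.1, transportMap f₀ f z.2)) =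
        μ.prod (densityMeasure L f) := by
      have := Measure.map_prod_map μ μ measurable_id hTm
      rw [Measure.map_id, map_transportMap hf₀ hf] at this
      rw [this]
      rfl
    have hφ : Measurable fun z : ℝ × ℝ => (z.1, transportMap f₀ f z.2) := by fun_prop
    ext s hs
    rw [Measure.map_apply hφ hs, withDensity_apply _ (hφ hs), withDensity_apply _ hs, ← hmap,
      setLIntegral_map hs hKm hφ]
    refine lintegral_congr fun z => ?_
    simp only [hK, transportMap_transportMap hf₀ hf]
  have e2 : densityMeasure L f = volume.withDensity fun y =>
      ENNReal.ofReal ((Ioo 0 L).indicator f y) := by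
    rw [densityMeasure, ← withDensity_indicator measurableSet_Ioo]
    congr 1
    funext y
    by_cases hy : y ∈ Ioo 0 L <;> simp [hy]
  rw [e1, e2, prod_withDensity_right him.ennreal_ofReal, brownianPairLaw,
    ← withDensity_mul _ (by fun_prop) hKm, ← withDensity_mul _ (by fun_prop)
      (Measurable.ennreal_ofReal (by fun_prop))]
  congr 1
  funext z
  simp only [Pi.mul_apply, hK]
  have h0 : 0 ≤ (Ioo 0 L).indicator f z.2 := indicator_nonneg (fun y _ => (hf.pos y).le) _
  rw [← ENNReal.ofReal_mul h0, ← ENNReal.ofReal_mul (heatKernel_pos hh _ _).le]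
  congr 1
  have := (heatKernel_pos hh z.1 z.2).ne'
  field_simp

/-- The upper bound for the rate functional obtained from a self-coupling of `ρ₀`. -/
theorem rateFunctional_le_ofReal {h : ℝ} (hh : 0 < h) {k : ℝ × ℝ → ℝ} {B : ℝ}
    (hk : IsSelfCoupling (densityMeasure L f₀) k B) :
    rateFunctional h (densityMeasure L f) (densityMeasure L f₀) ≤
      ENNReal.ofReal (∫ z, k z * Real.log (k z) ∂((densityMeasure L f₀).prod (densityMeasure L f₀))
        + entropy (densityMeasure L f) + 1 / 2 * Real.log (4 * Real.pi * h)
        + (∫ x, (x - transportMap f₀ f x) ^ 2 ∂(densityMeasure L f₀)) / (4 * h)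
        + (∫ z, k z * ((z.1 - z.2) * (transportMap f₀ f z.1 - transportMap f₀ f z.2))
          ∂((densityMeasure L f₀).prod (densityMeasure L f₀))) / (4 * h)) := by
  have := hf₀.isProbabilityMeasure
  have := hf.isProbabilityMeasure
  have hqp := isProbabilityMeasure_brownianPairLaw hh (densityMeasure L f₀)
  have hTm := (continuous_transportMap hf₀ hf).measurable
  have hSm := (continuous_transportMap hf hf₀).measurable
  have hkm := hk.measurable
  have hfm := hf.measurable
  have hPm := measurable_heatKernel_prod h
  have hent := hf.entropy_densityMeasure
  rw [← map_transportMap hf₀ hf, integral_map hTm.aemeasurable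
    (by exact (Real.measurable_log.comp hfm).aestronglyMeasurable),
    map_transportMap hf₀ hf] at hent
  have hq := map_selfCoupling_eq hf₀ hf hh hk
  have hTS := transportMap_transportMap hf₀ hf
  have hmem := ae_densityMeasure_mem L f₀
  have hTmem := transportMap_mem_iff hf₀ hf
  have hsnd : (densityMeasure L f₀).map (transportMap f₀ f) = densityMeasure L f :=
    map_transportMap hf₀ hf
  set T := transportMap f₀ f with hT
  set μ := densityMeasure L f₀ with hμ
  set π := (μ.prod μ).withDensity fun z => ENNReal.ofReal (k z) with hπ
  have hπp : IsProbabilityMeasure π := hk.isProbabilityMeasure_withDensity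
  have hφ : Measurable fun z : ℝ × ℝ => (z.1, T z.2) := by fun_prop
  set q := π.map (fun z => (z.1, T z.2)) with hq_def
  have hqprob : IsProbabilityMeasure q := Measure.isProbabilityMeasure_map hφ.aemeasurable
  set r : ℝ × ℝ → ℝ := fun z => k (z.1, transportMap f f₀ z.2) * (Ioo 0 L).indicator f z.2 /
        heatKernel h z.1 z.2 with hr
  have him : Measurable fun y => (Ioo 0 L).indicator f y := hfm.indicator measurableSet_Ioo
  have hrm : Measurable r := by simp only [hr]; fun_prop
  have hlogm : Measurable fun z => Real.log (r z) := Real.measurable_log.comp hrm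
  have hr0 : ∀ z, 0 ≤ r z := fun z => div_nonneg (mul_nonneg (hk.nonneg _)
    (indicator_nonneg (fun y _ => (hf.pos y).le) _)) (heatKernel_pos hh _ _).le
  have hcoup : q ∈ couplings μ (densityMeasure L f) := by
    refine ⟨hqprob, ?_, ?_⟩
    · rw [hq_def, Measure.map_map measurable_fst hφ]
      exact hk.map_fst_withDensity
    · rw [hq_def, Measure.map_map measurable_snd hφ]
      have : (Prod.snd ∘ fun z : ℝ × ℝ => (z.1, T z.2)) = T ∘ Prod.snd := rfl
      rw [this, ← Measure.map_map hTm measurable_snd, hk.map_snd_withDensity, hsnd]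
  have hac : q ≪ brownianPairLaw h μ := by rw [hq]; exact withDensity_absolutelyContinuous _ _
  have hllr : llr q (brownianPairLaw h μ) =ᵐ[q] fun z => Real.log (r z) := by
    refine hac.ae_le ?_
    have := Measure.rnDeriv_withDensity (brownianPairLaw h μ) hrm.ennreal_ofReal
    rw [← hq] at this
    filter_upwards [this] with z hz
    rw [llr, hz, ENNReal.toReal_ofReal (hr0 z)]
  have hmem2 : ∀ᵐ z ∂(μ.prod μ), z.1 ∈ Ioo 0 L ∧ z.2 ∈ Ioo 0 L := by
    filter_upwards [Measure.quasiMeasurePreserving_fst.ae hmem,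
      Measure.quasiMeasurePreserving_snd.ae hmem] with z h1 h2 using ⟨h1, h2⟩
  -- The log-likelihood ratio pulled back to the self-coupling. The heat kernel in the denominator
  -- contributes the squared distance over `4h` with a positive sign.
  set Φ : ℝ × ℝ → ℝ := fun z => Real.log (k z) + (Real.log (f (T z.2)) +
    (1 / 2 * Real.log (4 * Real.pi * h) + (z.1 - T z.2) ^ 2 / (4 * h))) with hΦ
  have hrΦ : (fun z : ℝ × ℝ => Real.log (r (z.1, T z.2))) =ᵐ[π] Φ := by
    have hpos : ∀ᵐ z ∂π, 0 < k z := by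
      rw [hπ, ae_withDensity_iff hkm.ennreal_ofReal]
      refine Eventually.of_forall fun z hz => ?_
      rcases (hk.nonneg z).lt_or_eq with h1 | h1
      · exact h1
      · simp [← h1] at hz
    filter_upwards [hpos, (withDensity_absolutelyContinuous _ _).ae_le hmem2] with z hz1 hz2
    have hp : 0 < Real.sqrt (4 * Real.pi * h) := Real.sqrt_pos.2 (by positivity)
    simp only [hr, hΦ, hTS, indicator_of_mem ((hTmem z.2).2 hz2.2)]
    rw [Real.log_div (mul_pos hz1 (hf.pos _)).ne' (heatKernel_pos hh _ _).ne',
      Real.log_mul hz1.ne' (hf.pos _).ne', heatKernel, Real.log_mul (by positivity)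
        (Real.exp_pos _).ne', Real.log_exp, one_div, Real.log_inv, Real.log_sqrt (by positivity)]
    ring
  have hbT : ∀ x ∈ Ioo 0 L, ∀ y ∈ Ioo 0 L, (x - T y) ^ 2 ≤ L ^ 2 := by
    intro x hx y hy
    have h1 := (hTmem y).2 hy
    exact sq_le_sq' (by linarith [hx.1, h1.2]) (by linarith [hx.2, h1.1])
  have hL := hf.L_pos
  have I1 := hk.integrable_mul_log
  have I2 : Integrable (fun z => k z * Real.log (f (T z.2))) (μ.prod μ) :=
    hk.integrable_mul (by fun_prop) (Eventually.of_forall fun z => hf.abs_log_le (T z.2))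
  have I3 : Integrable (fun z => k z * (1 / 2 * Real.log (4 * Real.pi * h))) (μ.prod μ) :=
    hk.integrable_mul measurable_const (Eventually.of_forall fun z => le_rfl)
  have I4 : Integrable (fun z => k z * ((z.1 - T z.2) ^ 2 / (4 * h))) (μ.prod μ) :=
    hk.integrable_mul (D := L ^ 2 / (4 * h)) (by fun_prop) (by
      filter_upwards [hmem2] with z hz
      rw [abs_of_nonneg (by positivity)]
      have := hbT _ hz.1 _ hz.2
      gcongr)
  have I34 : Integrable (fun z => k z * (1 / 2 * Real.log (4 * Real.pi * h)) +
      k z * ((z.1 - T z.2) ^ 2 / (4 * h))) (μ.prod μ) := I3.add I4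
  have I234 : Integrable (fun z => k z * Real.log (f (T z.2)) +
      (k z * (1 / 2 * Real.log (4 * Real.pi * h)) +
      k z * ((z.1 - T z.2) ^ 2 / (4 * h)))) (μ.prod μ) := I2.add I34
  have hkΦ : (fun z => k z * Φ z) = fun z => k z * Real.log (k z) + (k z * Real.log (f (T z.2)) +
      (k z * (1 / 2 * Real.log (4 * Real.pi * h)) +
      k z * ((z.1 - T z.2) ^ 2 / (4 * h)))) := by
    funext z; simp only [hΦ]; ring
  have hΦint : Integrable Φ π := by
    rw [hπ, hk.integrable_withDensity_iff, hkΦ]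
    exact I1.add I234
  have hrint : Integrable (fun z => Real.log (r z)) q := by
    rw [hq_def, integrable_map_measure hlogm.aestronglyMeasurable
      hφ.aemeasurable]
    exact hΦint.congr hrΦ.symm
  have hcost : ∫ z, k z * ((z.1 - T z.2) ^ 2 / (4 * h)) ∂(μ.prod μ) =
      (∫ x, (x - T x) ^ 2 ∂μ) / (4 * h) +
      (∫ z, k z * ((z.1 - z.2) * (T z.1 - T z.2)) ∂(μ.prod μ)) / (4 * h) := by
    -- The antisymmetric part of `(x - T x')²`. What remains is the average of `(x - T x)²` and `(x'
    -- - T x')²` plus `(x - x')(T x - T x')`; since `k` has both marginals `μ`, the average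
    -- integrates to exactly the transport cost.
    set A : ℝ × ℝ → ℝ := fun z => 1 / 2 * (z.1 ^ 2 - z.2 ^ 2) + 1 / 2 * (T z.2 ^ 2 - T z.1 ^ 2) +
      (z.2 * T z.1 - z.1 * T z.2) with hA
    have hA0 : ∫ z, k z * A z ∂(μ.prod μ) = 0 := hk.integral_antisymm fun z => by
      simp only [hA, Prod.fst_swap, Prod.snd_swap]; ring
    have b1 : ∀ᵐ x ∂μ, |(x - T x) ^ 2| ≤ L ^ 2 := by
      filter_upwards [hmem] with x hx
      rw [abs_of_nonneg (sq_nonneg _)]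
      exact hbT x hx x hx
    have hsq : Measurable fun x => (x - T x) ^ 2 := by fun_prop
    have J1 : Integrable (fun z => k z * (z.1 - T z.1) ^ 2) (μ.prod μ) :=
      hk.integrable_mul (hsq.comp measurable_fst) (Measure.quasiMeasurePreserving_fst.ae b1)
    have J2 : Integrable (fun z => k z * (z.2 - T z.2) ^ 2) (μ.prod μ) :=
      hk.integrable_mul (hsq.comp measurable_snd) (Measure.quasiMeasurePreserving_snd.ae b1)
    have J3 : Integrable (fun z => k z * ((z.1 - z.2) * (T z.1 - T z.2))) (μ.prod μ) :=
      hk.integrable_mul (D := L * L) (by fun_prop) (by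
        filter_upwards [hmem2] with z hz
        have h1 := (hTmem z.1).2 hz.1
        have h2 := (hTmem z.2).2 hz.2
        rw [abs_mul]
        have h3 : |z.1 - z.2| ≤ L := by
          rw [abs_le]; constructor <;> linarith [hz.1.1, hz.1.2, hz.2.1, hz.2.2]
        have h4 : |T z.1 - T z.2| ≤ L := by
          rw [abs_le]; constructor <;> linarith [h1.1, h1.2, h2.1, h2.2]
        exact mul_le_mul h3 h4 (abs_nonneg _) hL.le)
    have J4 : Integrable (fun z => k z * (z.1 - T z.2) ^ 2) (μ.prod μ) :=
      hk.integrable_mul (D := L ^ 2) (by fun_prop) (by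
        filter_upwards [hmem2] with z hz
        rw [abs_of_nonneg (by positivity)]
        exact hbT _ hz.1 _ hz.2)
    have hAe : (fun z => k z * A z) = fun z => k z * (z.1 - T z.2) ^ 2 -
        (1 / 2 * (k z * (z.1 - T z.1) ^ 2) + 1 / 2 * (k z * (z.2 - T z.2) ^ 2) +
          k z * ((z.1 - z.2) * (T z.1 - T z.2))) := by
      funext z; simp only [hA]; ring
    have J12 : Integrable (fun z => 1 / 2 * (k z * (z.1 - T z.1) ^ 2) +
        1 / 2 * (k z * (z.2 - T z.2) ^ 2)) (μ.prod μ) := (J1.const_mul _).add (J2.const_mul _)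
    have J123 : Integrable (fun z => 1 / 2 * (k z * (z.1 - T z.1) ^ 2) +
        1 / 2 * (k z * (z.2 - T z.2) ^ 2) + k z * ((z.1 - z.2) * (T z.1 - T z.2))) (μ.prod μ) :=
      J12.add J3
    have m1 := hk.integral_fst hsq b1
    have m2 := hk.integral_snd hsq b1
    rw [hAe, integral_sub J4 J123, integral_add J12 J3,
      integral_add (J1.const_mul _) (J2.const_mul _), integral_const_mul, integral_const_mul,
      m1, m2] at hA0
    have : ∫ z, k z * ((z.1 - T z.2) ^ 2 / (4 * h)) ∂(μ.prod μ) =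
        (∫ z, k z * (z.1 - T z.2) ^ 2 ∂(μ.prod μ)) / (4 * h) := by
      rw [← integral_div]
      refine integral_congr_ae (Eventually.of_forall fun z => ?_)
      simp only
      ring
    rw [this, ← add_div]
    congr 1
    linarith
  refine (iInf₂_le q hcoup).trans ?_
  rw [InformationTheory.klDiv_of_ac_of_integrable hac ((integrable_congr hllr).2 hrint)]
  apply ENNReal.ofReal_le_ofReal
  simp only [probReal_univ]
  rw [integral_congr_ae hllr, hq_def, integral_map hφ.aemeasurable
    hlogm.aestronglyMeasurable, integral_congr_ae hrΦ, hπ,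
    hk.integral_withDensity, hkΦ, integral_add I1 I234, integral_add I2 I34, integral_add I3 I4,
    hcost, hk.integral_snd (ψ := fun x => Real.log (f (T x))) (by fun_prop)
      (Eventually.of_forall fun x => hf.abs_log_le (T x)),
    hk.integral_fst (ψ := fun _ => 1 / 2 * Real.log (4 * Real.pi * h)) measurable_const
      (Eventually.of_forall fun x => le_rfl), hent]
  simp only [integral_const, probReal_univ, one_smul]
  linarith

end IsNormalizedDensity


/-! ### Completing a subprobability kernel to a self-coupling. -/

/-- The mass that a symmetric density misses in the row of `x`. -/
def rowDefect (μ : Measure ℝ) (k₀ : ℝ × ℝ → ℝ) (x : ℝ) : ℝ := 1 - ∫ x', k₀ (x, x') ∂μ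

/-- The mass of `rowDefect` in the block `j`. -/
def blockDefect (μ : Measure ℝ) (k₀ : ℝ × ℝ → ℝ) (b : ℝ → ℤ) (j : ℤ) : ℝ :=
  ∫ x in b ⁻¹' {j}, rowDefect μ k₀ x ∂μ

open Classical in
/-- A density, concentrated on the blocks of `b`, that completes `k₀` to a self-coupling. -/
def blockCompletion (μ : Measure ℝ) (k₀ : ℝ × ℝ → ℝ) (b : ℝ → ℤ) (θ : ℝ) (z : ℝ × ℝ) : ℝ :=
  if b z.1 = b z.2 ∧ θ ≤ μ.real (b ⁻¹' {b z.1}) then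
    rowDefect μ k₀ z.1 * rowDefect μ k₀ z.2 / blockDefect μ k₀ b (b z.1) else 0

/-- A symmetric subprobability density whose rows have mass at most `1 - ε`, and a partition into
blocks that almost all have mass at least `θ`. -/
structure IsCompletable (μ : Measure ℝ) (k₀ : ℝ × ℝ → ℝ) (b : ℝ → ℤ) (B₀ ε θ : ℝ) : Prop where
  measurable : Measurable k₀
  nonneg : ∀ z, 0 ≤ k₀ z
  le : ∀ z, k₀ z ≤ B₀
  symm : ∀ z, k₀ z.swap = k₀ z
  ε_pos : 0 < ε
  row_le : ∀ x, ∫ x', k₀ (x, x') ∂μ ≤ 1 - ε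
  measurable_block : Measurable b
  θ_pos : 0 < θ
  block : ∀ᵐ x ∂μ, θ ≤ μ.real (b ⁻¹' {b x})

namespace IsCompletable

variable {μ : Measure ℝ} [IsProbabilityMeasure μ] {k₀ : ℝ × ℝ → ℝ} {b : ℝ → ℤ} {B₀ ε θ : ℝ}
  (hk : IsCompletable μ k₀ b B₀ ε θ)

include hk

lemma le_rowDefect (x : ℝ) : ε ≤ rowDefect μ k₀ x := by
  have := hk.row_le x
  unfold rowDefect
  linarith

lemma rowDefect_le (x : ℝ) : rowDefect μ k₀ x ≤ 1 := by
  have : 0 ≤ ∫ x', k₀ (x, x') ∂μ := integral_nonneg fun x' => hk.nonneg _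
  unfold rowDefect
  linarith

lemma rowDefect_nonneg (x : ℝ) : 0 ≤ rowDefect μ k₀ x := hk.ε_pos.le.trans (hk.le_rowDefect x)

lemma measurable_rowDefect : Measurable (rowDefect μ k₀) := by
  have : StronglyMeasurable fun x => ∫ x', k₀ (x, x') ∂μ :=
    hk.measurable.stronglyMeasurable.integral_prod_right'
  exact measurable_const.sub this.measurable

lemma integrable_rowDefect : Integrable (rowDefect μ k₀) μ :=
  Integrable.of_bound hk.measurable_rowDefect.aestronglyMeasurable 1
    (Eventually.of_forall fun x => by
      rw [Real.norm_eq_abs, abs_of_nonneg (hk.rowDefect_nonneg x)]; exact hk.rowDefect_le x)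

lemma le_blockDefect {j : ℤ} (hj : θ ≤ μ.real (b ⁻¹' {j})) : ε * θ ≤ blockDefect μ k₀ b j := by
  have h1 : ∫ x in b ⁻¹' {j}, ε ∂μ ≤ blockDefect μ k₀ b j :=
    integral_mono (integrable_const _) hk.integrable_rowDefect.integrableOn
      fun x => hk.le_rowDefect x
  rw [setIntegral_const, smul_eq_mul, mul_comm] at h1
  exact (mul_le_mul_of_nonneg_left hj hk.ε_pos.le).trans h1

lemma blockCompletion_nonneg (z : ℝ × ℝ) : 0 ≤ blockCompletion μ k₀ b θ z := by
  unfold blockCompletion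
  split_ifs with h
  · have h1 := hk.le_blockDefect h.2
    have h2 := mul_pos hk.ε_pos hk.θ_pos
    exact div_nonneg (mul_nonneg (hk.rowDefect_nonneg _) (hk.rowDefect_nonneg _)) (by linarith)
  · exact le_rfl

/-- The row defects in the numerator are at most one, while a block of mass at least `θ` has total
defect at least `ε * θ`. This is why every row must miss at least `ε`. -/
lemma blockCompletion_le (z : ℝ × ℝ) : blockCompletion μ k₀ b θ z ≤ 1 / (ε * θ) := by
  have h2 := mul_pos hk.ε_pos hk.θ_pos
  unfold blockCompletion
  split_ifs with h
  · have h1 := hk.le_blockDefect h.2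
    have h3 : rowDefect μ k₀ z.1 * rowDefect μ k₀ z.2 ≤ 1 :=
      mul_le_one₀ (hk.rowDefect_le _) (hk.rowDefect_nonneg _) (hk.rowDefect_le _)
    exact div_le_div₀ zero_le_one h3 h2 h1
  · positivity

lemma blockCompletion_symm (z : ℝ × ℝ) :
    blockCompletion μ k₀ b θ z.swap = blockCompletion μ k₀ b θ z := by
  unfold blockCompletion
  simp only [Prod.fst_swap, Prod.snd_swap]
  by_cases h : b z.1 = b z.2
  · rw [h, mul_comm]
  · rw [if_neg (fun h' => h h'.1.symm), if_neg (fun h' => h h'.1)]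

lemma measurable_blockCompletion : Measurable (blockCompletion μ k₀ b θ) := by
  have hb := hk.measurable_block
  have hu := hk.measurable_rowDefect
  have h1 : Measurable fun j : ℤ => blockDefect μ k₀ b j := measurable_of_countable _
  have h2 : Measurable fun j : ℤ => μ.real (b ⁻¹' {j}) := measurable_of_countable _
  unfold blockCompletion
  refine Measurable.ite ?_ ?_ measurable_const
  · refine MeasurableSet.inter ?_ ?_
    · exact measurableSet_eq_fun (hb.comp measurable_fst) (hb.comp measurable_snd)
    · exact measurableSet_le measurable_const (h2.comp (hb.comp measurable_fst))
  · exact ((hu.comp measurable_fst).mul (hu.comp measurable_snd)).div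
      (h1.comp (hb.comp measurable_fst))

/-- On each block the completion is the product of the defects divided by the total defect, so
integrating one variable over the block leaves the defect of the other. -/
lemma integral_blockCompletion :
    ∀ᵐ x ∂μ, ∫ x', blockCompletion μ k₀ b θ (x, x') ∂μ = rowDefect μ k₀ x := by
  filter_upwards [hk.block] with x hx
  have h1 := hk.le_blockDefect hx
  have h2 := mul_pos hk.ε_pos hk.θ_pos
  have h3 : ∀ x', blockCompletion μ k₀ b θ (x, x') = (b ⁻¹' {b x}).indicator
      (fun x' => rowDefect μ k₀ x / blockDefect μ k₀ b (b x) * rowDefect μ k₀ x') x' := by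
    intro x'
    unfold blockCompletion
    by_cases h : b x' = b x
    · rw [if_pos ⟨h.symm, hx⟩, indicator_of_mem (by exact h)]
      ring
    · rw [if_neg (fun h' => h h'.1.symm), indicator_of_notMem (by exact h)]
  simp_rw [h3]
  rw [integral_indicator (hk.measurable_block (measurableSet_singleton _)), integral_const_mul]
  change _ / _ * blockDefect μ k₀ b (b x) = _
  exact div_mul_cancel₀ _ (by linarith)

lemma integrable_prod : Integrable k₀ (μ.prod μ) :=
  Integrable.of_bound hk.measurable.aestronglyMeasurable B₀
    (Eventually.of_forall fun z => by
      rw [Real.norm_eq_abs, abs_of_nonneg (hk.nonneg z)]; exact hk.le z)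

lemma integrable_row (x : ℝ) : Integrable (fun x' => k₀ (x, x')) μ :=
  Integrable.of_bound (hk.measurable.comp measurable_prodMk_left).aestronglyMeasurable B₀
    (Eventually.of_forall fun x' => by
      rw [Real.norm_eq_abs, abs_of_nonneg (hk.nonneg _)]; exact hk.le _)

lemma integrable_blockCompletion : Integrable (blockCompletion μ k₀ b θ) (μ.prod μ) :=
  Integrable.of_bound hk.measurable_blockCompletion.aestronglyMeasurable (1 / (ε * θ))
    (Eventually.of_forall fun z => by
      rw [Real.norm_eq_abs, abs_of_nonneg (hk.blockCompletion_nonneg z)]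
      exact hk.blockCompletion_le z)

lemma integral_prod_blockCompletion :
    ∫ z, blockCompletion μ k₀ b θ z ∂(μ.prod μ) = 1 - ∫ z, k₀ z ∂(μ.prod μ) := by
  rw [integral_prod _ hk.integrable_blockCompletion, integral_congr_ae hk.integral_blockCompletion,
    integral_prod _ hk.integrable_prod]
  unfold rowDefect
  rw [integral_sub (integrable_const _) hk.integrable_prod.integral_prod_left]
  simp

lemma isSelfCoupling :
    IsSelfCoupling μ (fun z => k₀ z + blockCompletion μ k₀ b θ z) (B₀ + 1 / (ε * θ)) where
  measurable := hk.measurable.add hk.measurable_blockCompletion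
  nonneg := fun z => add_nonneg (hk.nonneg z) (hk.blockCompletion_nonneg z)
  le := fun z => add_le_add (hk.le z) (hk.blockCompletion_le z)
  symm := fun z => by rw [hk.symm, hk.blockCompletion_symm]
  row := by
    filter_upwards [hk.integral_blockCompletion] with x hx
    have h1 : Integrable (fun x' => blockCompletion μ k₀ b θ (x, x')) μ :=
      Integrable.of_bound
        (hk.measurable_blockCompletion.comp measurable_prodMk_left).aestronglyMeasurable
        (1 / (ε * θ)) (Eventually.of_forall fun x' => by
          rw [Real.norm_eq_abs, abs_of_nonneg (hk.blockCompletion_nonneg _)]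
          exact hk.blockCompletion_le _)
    rw [integral_add (hk.integrable_row x) h1, hx, rowDefect]
    ring

end IsCompletable

/-- The entropy of a sum in terms of the entropy of the first summand. -/
lemma add_mul_log_add_le {a l B : ℝ} (ha : 0 ≤ a) (hl : 0 ≤ l) (hB : a + l ≤ B) :
    (a + l) * Real.log (a + l) ≤ a * Real.log a + l * (1 + Real.log B) := by
  rcases ha.eq_or_lt with rfl | ha
  · rcases hl.eq_or_lt with rfl | hl
    · simp
    · have := Real.log_le_log (by linarith : 0 < 0 + l) hB
      simp only [zero_add, zero_mul] at this ⊢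
      nlinarith
  · have h1 := Real.log_le_log (by linarith : 0 < a + l) hB
    -- Adding `l` changes the logarithm by `log (1 + l / a) ≤ l / a`, so the increase is at most `l`
    -- however small `a` is.
    have h2 : a * Real.log (a + l) ≤ a * Real.log a + l := by
      have h3 : a + l = a * (1 + l / a) := by field_simp
      have h4 : Real.log (1 + l / a) ≤ l / a := by
        have := Real.log_le_sub_one_of_pos (by positivity : 0 < 1 + l / a)
        linarith
      rw [h3, Real.log_mul ha.ne' (by positivity), mul_add]
      have : a * Real.log (1 + l / a) ≤ a * (l / a) := by gcongr
      rw [mul_div_cancel₀ _ ha.ne'] at this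
      linarith
    have h5 : l * Real.log (a + l) ≤ l * Real.log B := by gcongr
    nlinarith


/-! ### Symmetrised Gaussian kernels as trial couplings. -/

/-- A continuous function with values in `[m₀, M₀]`, used as a rescaled local variance. -/
structure IsVariance (m : ℝ → ℝ) (m₀ M₀ : ℝ) : Prop where
  continuous : Continuous m
  m₀_pos : 0 < m₀
  le : ∀ x, m₀ ≤ m x
  ge : ∀ x, m x ≤ M₀

lemma IsVariance.pos {m : ℝ → ℝ} {m₀ M₀ : ℝ} (hm : IsVariance m m₀ M₀) (x : ℝ) : 0 < m x :=
  hm.m₀_pos.trans_le (hm.le x)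

/-- The symmetrised Gaussian kernel of local variance `2 h m`, as a density relative to the product
of the measures with density `f₀`. -/
def gaussMinKernel (f₀ m : ℝ → ℝ) (ε h : ℝ) (z : ℝ × ℝ) : ℝ :=
  (1 - ε) * min (heatKernel (h * m z.1) z.1 z.2 / f₀ z.2) (heatKernel (h * m z.2) z.1 z.2 / f₀ z.1)

/-- The logarithmic cost density of the kernel `gaussMinKernel`. -/
def costDensity (f₀ m T : ℝ → ℝ) (h : ℝ) (z : ℝ × ℝ) : ℝ :=
  -(1 / 2) * Real.log (m z.1) - (z.2 - z.1) ^ 2 / (4 * (h * m z.1)) - Real.log (f₀ z.2) +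
    ((z.1 - z.2) * (T z.1 - T z.2)) / (4 * h)

lemma heatKernel_le {s s₀ : ℝ} (hs₀ : 0 < s₀) (hs : s₀ ≤ s) (x y : ℝ) :
    heatKernel s x y ≤ 1 / Real.sqrt (4 * Real.pi * s₀) := by
  have hpos : 0 < s := hs₀.trans_le hs
  unfold heatKernel
  have h1 : Real.exp (-(y - x) ^ 2 / (4 * s)) ≤ 1 :=
    Real.exp_le_one_iff.2 (div_nonpos_of_nonpos_of_nonneg (by nlinarith [sq_nonneg (y - x)])
      (by positivity))
  have h2 : 1 / Real.sqrt (4 * Real.pi * s) ≤ 1 / Real.sqrt (4 * Real.pi * s₀) := by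
    apply one_div_le_one_div_of_le (Real.sqrt_pos.2 (by positivity))
    exact Real.sqrt_le_sqrt (by gcongr)
  calc _ ≤ 1 / Real.sqrt (4 * Real.pi * s) * 1 := by gcongr
    _ ≤ _ := by rwa [mul_one]

lemma log_heatKernel {h m : ℝ} (hh : 0 < h) (hm : 0 < m) (x y : ℝ) :
    Real.log (heatKernel (h * m) x y) = -(1 / 2) * Real.log (4 * Real.pi * h) -
      1 / 2 * Real.log m - (y - x) ^ 2 / (4 * (h * m)) := by
  have hp : 0 < Real.sqrt (4 * Real.pi * (h * m)) := Real.sqrt_pos.2 (by positivity)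
  rw [heatKernel, Real.log_mul (by positivity) (Real.exp_pos _).ne', Real.log_exp, one_div,
    Real.log_inv, Real.log_sqrt (by positivity), show 4 * Real.pi * (h * m) =
      (4 * Real.pi * h) * m by ring, Real.log_mul (by positivity) hm.ne']
  ring

namespace IsNormalizedDensity

variable {L c C : ℝ} {f f₀ : ℝ → ℝ}

lemma le_measureReal_Ioo (hf : IsNormalizedDensity L c C f) {a b : ℝ} (ha : 0 ≤ a) (hab : a ≤ b)
    (hb : b ≤ L) : c * (b - a) ≤ (densityMeasure L f).real (Ioo a b) := by
  have := hf.isProbabilityMeasure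
  have h1 : ENNReal.ofReal (c * (b - a)) ≤ densityMeasure L f (Ioo a b) := by
    rw [densityMeasure, withDensity_apply _ measurableSet_Ioo,
      Measure.restrict_restrict measurableSet_Ioo,
      inter_eq_left.2 (Ioo_subset_Ioo ha hb), ENNReal.ofReal_mul hf.c_pos.le,
      ← Real.volume_Ioo, ← setLIntegral_const]
    exact lintegral_mono fun x => ENNReal.ofReal_le_ofReal (hf.le x)
  have h2 : 0 ≤ c * (b - a) := mul_nonneg hf.c_pos.le (by linarith)
  rw [Measure.real, ← ENNReal.toReal_ofReal h2]
  exact ENNReal.toReal_mono (measure_ne_top _ _) h1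

/-- The minimum makes the kernel symmetric. Its first argument, integrated against `f₀`, is a heat
kernel restricted to `(0, L)`, so the rows have mass at most `1 - ε`. The blocks are `n` intervals
of length `L / n`. -/
lemma isCompletable_gaussMinKernel (hf₀ : IsNormalizedDensity L c C f₀) {m : ℝ → ℝ} {m₀ M₀ : ℝ}
    (hm : IsVariance m m₀ M₀) {ε h : ℝ} (hε : 0 < ε) (hε1 : ε ≤ 1) (hh : 0 < h) {n : ℕ}
    (hn : 0 < n) :
    IsCompletable (densityMeasure L f₀) (gaussMinKernel f₀ m ε h) (fun x => ⌊n * x / L⌋)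
      (1 / Real.sqrt (4 * Real.pi * (h * m₀)) / c) ε (c * (L / n)) := by
  have hL := hf₀.L_pos
  have hc := hf₀.c_pos
  have hn' : (0 : ℝ) < n := Nat.cast_pos.2 hn
  have hmm := hm.continuous.measurable
  have hfm := hf₀.measurable
  have h1ε : 0 ≤ 1 - ε := by linarith
  have hhm : ∀ x, 0 < h * m x := fun x => mul_pos hh (hm.pos x)
  have hnn : ∀ z, 0 ≤ gaussMinKernel f₀ m ε h z := fun z =>
    mul_nonneg h1ε (le_min (div_nonneg (heatKernel_pos (hhm _) _ _).le (hf₀.pos _).le)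
      (div_nonneg (heatKernel_pos (hhm _) _ _).le (hf₀.pos _).le))
  have hmeas : Measurable (gaussMinKernel f₀ m ε h) := by
    unfold gaussMinKernel heatKernel
    fun_prop
  have hle : ∀ z : ℝ × ℝ, gaussMinKernel f₀ m ε h z ≤
      (1 - ε) * (heatKernel (h * m z.1) z.1 z.2 / f₀ z.2) := fun z =>
    mul_le_mul_of_nonneg_left (min_le_left _ _) h1ε
  refine ⟨hmeas, hnn, fun z => ?_, fun z => ?_, hε, fun x => ?_, ?_, by positivity, ?_⟩
  · refine (hle z).trans ?_
    have h1 : heatKernel (h * m z.1) z.1 z.2 / f₀ z.2 ≤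
        1 / Real.sqrt (4 * Real.pi * (h * m₀)) / c :=
      div_le_div₀ (by positivity) (heatKernel_le (mul_pos hh hm.m₀_pos)
        (mul_le_mul_of_nonneg_left (hm.le _) hh.le) _ _) hc (hf₀.le _)
    have h2 : 0 ≤ heatKernel (h * m z.1) z.1 z.2 / f₀ z.2 :=
      div_nonneg (heatKernel_pos (hhm _) _ _).le (hf₀.pos _).le
    nlinarith
  · unfold gaussMinKernel
    simp only [Prod.fst_swap, Prod.snd_swap]
    rw [min_comm, heatKernel_symm _ z.2, heatKernel_symm _ z.2]
  · rw [hf₀.integral_densityMeasure]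
    have hi : Integrable (fun x' => heatKernel (h * m x) x x') := integrable_heatKernel (hhm x) x
    calc ∫ x' in Ioo 0 L, f₀ x' * gaussMinKernel f₀ m ε h (x, x')
        ≤ ∫ x' in Ioo 0 L, (1 - ε) * heatKernel (h * m x) x x' := by
          refine integral_mono_of_nonneg (Eventually.of_forall fun x' =>
            mul_nonneg (hf₀.pos x').le (hnn _)) (hi.const_mul _).restrict
            (Eventually.of_forall fun x' => ?_)
          have h1 := mul_le_mul_of_nonneg_left (hle (x, x')) (hf₀.pos x').le
          refine h1.trans_eq ?_
          have := (hf₀.pos x').ne'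
          simp only
          field_simp
      _ = (1 - ε) * ∫ x' in Ioo 0 L, heatKernel (h * m x) x x' := integral_const_mul _ _
      _ ≤ (1 - ε) * 1 := by
          refine mul_le_mul_of_nonneg_left ?_ h1ε
          rw [← integral_heatKernel (hhm x) x]
          exact setIntegral_le_integral hi
            (Eventually.of_forall fun x' => (heatKernel_pos (hhm x) _ _).le)
      _ = 1 - ε := mul_one _
  · exact Int.measurable_floor.comp (by fun_prop)
  · filter_upwards [ae_densityMeasure_mem L f₀] with x hx
    have := hf₀.isProbabilityMeasure
    set j := ⌊n * x / L⌋ with hj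
    have hj0 : 0 ≤ j := Int.floor_nonneg.2 (by have := hx.1; positivity)
    have hj1 : j + 1 ≤ n := by
      have : j < n := by
        rw [hj, Int.floor_lt]
        rw [div_lt_iff₀ hL]
        push_cast
        exact mul_lt_mul_of_pos_left hx.2 hn'
      omega
    have hj0' : (0 : ℝ) ≤ j := by exact_mod_cast hj0
    have hj1' : (j : ℝ) + 1 ≤ n := by exact_mod_cast hj1
    have hsub : Ioo (L * j / n) (L * (j + 1) / n) ⊆ (fun x => ⌊n * x / L⌋) ⁻¹' {j} := by
      intro y hy
      rw [mem_preimage, mem_singleton_iff, Int.floor_eq_iff]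
      have h1 := hy.1
      have h2 := hy.2
      rw [div_lt_iff₀ hn'] at h1
      rw [lt_div_iff₀ hn'] at h2
      rw [le_div_iff₀ hL, div_lt_iff₀ hL]
      constructor <;> linarith
    refine le_trans ?_ (measureReal_mono hsub)
    refine le_trans (le_of_eq ?_) (hf₀.le_measureReal_Ioo (by positivity) (by gcongr; linarith) ?_)
    · ring
    · rw [div_le_iff₀ hn']
      gcongr

variable (hf₀ : IsNormalizedDensity L c C f₀) (hf : IsNormalizedDensity L c C f)

include hf₀ hf

lemma abs_cost_le (z : ℝ × ℝ) :
    |(z.1 - z.2) * (transportMap f₀ f z.1 - transportMap f₀ f z.2)| ≤ C / c * (z.1 - z.2) ^ 2 := by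
  rw [abs_mul, ← sq_abs (z.1 - z.2)]
  have h1 := abs_transportMap_sub_le hf₀ hf z.2 z.1
  have h2 := abs_nonneg (z.1 - z.2)
  nlinarith

lemma measurable_costDensity {m : ℝ → ℝ} {m₀ M₀ : ℝ} (hm : IsVariance m m₀ M₀) (h : ℝ) :
    Measurable (costDensity f₀ m (transportMap f₀ f) h) := by
  have h1 := (continuous_transportMap hf₀ hf).measurable
  have h2 := hm.continuous.measurable
  have h3 := hf₀.measurable
  unfold costDensity
  fun_prop

lemma abs_costDensity_le {m : ℝ → ℝ} {m₀ M₀ : ℝ} (hm : IsVariance m m₀ M₀) {h : ℝ} (hh : 0 < h)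
    (z : ℝ × ℝ) : |costDensity f₀ m (transportMap f₀ f) h z| ≤
      (|Real.log m₀| + |Real.log M₀| + |Real.log c| + |Real.log C|) +
        (1 / (4 * m₀) + C / c / 4) * ((z.2 - z.1) ^ 2 / h) := by
  have hm0 := hm.m₀_pos
  have a1 : |Real.log (m z.1)| ≤ |Real.log m₀| + |Real.log M₀| := by
    have h1 := Real.log_le_log hm0 (hm.le z.1)
    have h2 := Real.log_le_log (hm.pos z.1) (hm.ge z.1)
    rw [abs_le]
    constructor
    · linarith [neg_abs_le (Real.log m₀), abs_nonneg (Real.log M₀)]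
    · linarith [le_abs_self (Real.log M₀), abs_nonneg (Real.log m₀)]
  have a2 := abs_le.1 (hf₀.abs_log_le z.2)
  have a3 : (z.2 - z.1) ^ 2 / (4 * (h * m z.1)) ≤ 1 / (4 * m₀) * ((z.2 - z.1) ^ 2 / h) := by
    have : (z.2 - z.1) ^ 2 / (4 * (h * m z.1)) = 1 / (4 * m z.1) * ((z.2 - z.1) ^ 2 / h) := by
      have := (hm.pos z.1).ne'
      field_simp
    rw [this]
    have := hm.le z.1
    gcongr
  have a3' : 0 ≤ (z.2 - z.1) ^ 2 / (4 * (h * m z.1)) := by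
    have := hm.pos z.1
    positivity
  have a4 : |((z.1 - z.2) * (transportMap f₀ f z.1 - transportMap f₀ f z.2)) / (4 * h)| ≤
      C / c / 4 * ((z.2 - z.1) ^ 2 / h) := by
    rw [abs_div, abs_of_pos (by positivity : 0 < 4 * h), div_le_iff₀ (by positivity)]
    refine (abs_cost_le hf₀ hf z).trans_eq ?_
    have := hf.c_pos.ne'
    field_simp
    ring
  have a1' := abs_le.1 a1
  have a4' := abs_le.1 a4
  unfold costDensity
  rw [abs_le]
  constructor <;> linarith [abs_nonneg (Real.log m₀), abs_nonneg (Real.log M₀)]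

/-- The upper bound for the rate functional in terms of the Gaussian kernel. -/
theorem rateFunctional_le_gaussMinKernel {m : ℝ → ℝ} {m₀ M₀ : ℝ} (hm : IsVariance m m₀ M₀) :
    ∃ K : ℝ, ∀ ε h : ℝ, 0 < ε → ε ≤ 1 → 0 < h → h ≤ 1 →
      rateFunctional h (densityMeasure L f) (densityMeasure L f₀) ≤
        ENNReal.ofReal (entropy (densityMeasure L f)
          + (∫ x, (x - transportMap f₀ f x) ^ 2 ∂(densityMeasure L f₀)) / (4 * h)
          + ∫ z, gaussMinKernel f₀ m ε h z * costDensity f₀ m (transportMap f₀ f) h z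
            ∂((densityMeasure L f₀).prod (densityMeasure L f₀))
          + (1 - ∫ z, gaussMinKernel f₀ m ε h z
            ∂((densityMeasure L f₀).prod (densityMeasure L f₀))) * (K - Real.log ε)) := by
  have hL := hf.L_pos
  have hc := hf.c_pos
  have hC := hf.C_pos
  have hm0 := hm.m₀_pos
  have hprob := hf₀.isProbabilityMeasure
  -- Chosen so that `D / (ε √h)` dominates both the height of the Gaussian kernel and the bound `1 /
  -- (ε θ)` for the completion.
  set D : ℝ := 1 / Real.sqrt (4 * Real.pi * m₀) / c + 2 / (c * L) with hD
  have hD0 : 0 < D := by positivity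
  refine ⟨1 + Real.log D + 1 / 2 * Real.log (4 * Real.pi) + C / c * L ^ 2 / 4,
    fun ε h hε hε1 hh hh1 => ?_⟩
  set r := Real.sqrt h with hr
  have hr0 : 0 < r := Real.sqrt_pos.2 hh
  have hr1 : r ≤ 1 := Real.sqrt_le_one.2 hh1
  have hrh : r ^ 2 = h := Real.sq_sqrt hh.le
  -- Blocks of length at most `L √h`: short enough for the transport cost over `4h` to stay bounded
  -- on a block, and long enough for the completion to be of order `1 / √h`.
  set n := ⌈1 / r⌉₊ with hn
  have hn1 : 1 / r ≤ n := Nat.le_ceil _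
  have hn2 : (n : ℝ) ≤ 2 / r := by
    have h1 := (Nat.ceil_lt_add_one (by positivity : 0 ≤ 1 / r)).le
    have h2 : (1 : ℝ) ≤ 1 / r := by rw [le_div_iff₀ hr0]; linarith
    have h3 : 2 / r = 1 / r + 1 / r := by ring
    rw [h3]
    exact h1.trans (by linarith)
  have hn0' : (0 : ℝ) < n := lt_of_lt_of_le (by positivity) hn1
  have hn0 : 0 < n := Nat.cast_pos.1 hn0'
  have hcomp := isCompletable_gaussMinKernel hf₀ hm hε hε1 hh hn0
  set μ := densityMeasure L f₀ with hμ
  set T := transportMap f₀ f with hT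
  set k₀ := gaussMinKernel f₀ m ε h with hk₀
  set b : ℝ → ℤ := fun x => ⌊n * x / L⌋ with hb
  set θ := c * (L / n) with hθ
  have hsc := hcomp.isSelfCoupling
  set l := blockCompletion μ k₀ b θ with hl
  set B' := D / (ε * r) with hB'
  have hBB : 1 / Real.sqrt (4 * Real.pi * (h * m₀)) / c + 1 / (ε * θ) ≤ B' := by
    have h1 : Real.sqrt (4 * Real.pi * (h * m₀)) = r * Real.sqrt (4 * Real.pi * m₀) := by
      rw [hr, ← Real.sqrt_mul hh.le]; congr 1; ring
    have h2 : 1 / (ε * θ) ≤ 2 / (c * L) / (ε * r) := by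
      have : 1 / (ε * θ) = n / (ε * c * L) := by rw [hθ]; field_simp
      rw [this, div_le_iff₀ (by positivity)]
      refine hn2.trans_eq ?_
      field_simp
    have h3 : 1 / Real.sqrt (4 * Real.pi * (h * m₀)) / c ≤
        1 / Real.sqrt (4 * Real.pi * m₀) / c / (ε * r) := by
      have hs : 0 < Real.sqrt (4 * Real.pi * m₀) := Real.sqrt_pos.2 (by positivity)
      rw [h1]
      have : 1 / (r * Real.sqrt (4 * Real.pi * m₀)) / c =
        1 / Real.sqrt (4 * Real.pi * m₀) / c / r := by field_simp
      rw [this]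
      apply div_le_div_of_nonneg_left (by positivity) (by positivity)
      nlinarith
    rw [hB', hD, add_div]
    exact add_le_add h3 h2
  have hlogB : Real.log B' = Real.log D - Real.log ε - 1 / 2 * Real.log h := by
    rw [hB', Real.log_div hD0.ne' (by positivity), Real.log_mul hε.ne' hr0.ne', hr,
      Real.log_sqrt hh.le]
    ring
  have hlog4 : Real.log (4 * Real.pi * h) = Real.log (4 * Real.pi) + Real.log h :=
    Real.log_mul (by positivity) hh.ne'
  set K := 1 + Real.log D + 1 / 2 * Real.log (4 * Real.pi) + C / c * L ^ 2 / 4 with hK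
  set Δ : ℝ × ℝ → ℝ := fun z => (z.1 - z.2) * (T z.1 - T z.2) with hΔ
  have hTm : Measurable T := (continuous_transportMap hf₀ hf).measurable
  have hpt : ∀ z, (k₀ z + l z) * Real.log (k₀ z + l z) +
      (k₀ z + l z) * (1 / 2 * Real.log (4 * Real.pi * h)) + (k₀ z + l z) * Δ z / (4 * h) ≤
      k₀ z * costDensity f₀ m T h z + l z * (K - Real.log ε) := by
    intro z
    have hk0 := hcomp.nonneg z
    have hl0 := hcomp.blockCompletion_nonneg z
    have e1 := add_mul_log_add_le hk0 hl0 ((hsc.le z).trans hBB)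
    -- For an upper bound the logarithm of the minimum may be replaced by that of its first
    -- argument; the factor `1 - ε` is dropped as well.
    have e2 : k₀ z * Real.log (k₀ z) ≤ k₀ z * (-(1 / 2) * Real.log (4 * Real.pi * h) -
        1 / 2 * Real.log (m z.1) - (z.2 - z.1) ^ 2 / (4 * (h * m z.1)) - Real.log (f₀ z.2)) := by
      rcases hk0.eq_or_lt with h0 | h0
      · rw [← h0]; simp
      · refine mul_le_mul_of_nonneg_left ?_ hk0
        rw [← log_heatKernel hh (hm.pos _), ← Real.log_div
          (heatKernel_pos (mul_pos hh (hm.pos _)) _ _).ne' (hf₀.pos _).ne']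
        refine Real.log_le_log h0 ?_
        have h1 : k₀ z ≤ (1 - ε) * (heatKernel (h * m z.1) z.1 z.2 / f₀ z.2) :=
          mul_le_mul_of_nonneg_left (min_le_left _ _) (by linarith)
        have h2 : 0 ≤ heatKernel (h * m z.1) z.1 z.2 / f₀ z.2 :=
          div_nonneg (heatKernel_pos (mul_pos hh (hm.pos _)) _ _).le (hf₀.pos _).le
        nlinarith
    have e3 : l z * Δ z / (4 * h) ≤ l z * (C / c * L ^ 2 / 4) := by
      by_cases hz : b z.1 = b z.2
      · rw [mul_div_assoc]
        refine mul_le_mul_of_nonneg_left ?_ hl0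
        rw [div_le_iff₀ (by positivity)]
        refine (le_abs_self _).trans ((abs_cost_le hf₀ hf z).trans ?_)
        have h1 := Int.abs_sub_lt_one_of_floor_eq_floor hz
        have h2 : |z.1 - z.2| ≤ L * r := by
          have h3 : n * z.1 / L - n * z.2 / L = n * (z.1 - z.2) / L := by ring
          rw [h3, abs_div, abs_mul, abs_of_pos hL, abs_of_pos hn0', div_lt_iff₀ hL, one_mul] at h1
          have h4 : 1 / r * |z.1 - z.2| ≤ n * |z.1 - z.2| := by gcongr
          have h5 : 1 / r * |z.1 - z.2| ≤ L := h4.trans h1.le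
          rw [one_div_mul_eq_div, div_le_iff₀ hr0] at h5
          exact h5
        have h6 : (z.1 - z.2) ^ 2 ≤ L ^ 2 * h := by
          rw [← sq_abs, ← hrh, ← mul_pow]
          exact pow_le_pow_left₀ (abs_nonneg _) h2 2
        calc C / c * (z.1 - z.2) ^ 2 ≤ C / c * (L ^ 2 * h) := by gcongr
          _ = C / c * L ^ 2 / 4 * (4 * h) := by ring
      · have : l z = 0 := by
          simp only [hl, blockCompletion]
          rw [if_neg fun h' => hz h'.1]
        rw [this]; simp
    have e4 : k₀ z * costDensity f₀ m T h z = k₀ z * (-(1 / 2) * Real.log (4 * Real.pi * h) -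
        1 / 2 * Real.log (m z.1) - (z.2 - z.1) ^ 2 / (4 * (h * m z.1)) - Real.log (f₀ z.2)) +
        k₀ z * (1 / 2 * Real.log (4 * Real.pi * h)) + k₀ z * Δ z / (4 * h) := by
      simp only [costDensity, hΔ]; ring
    -- The term `-½ log h` in `log B'` cancels `½ log (4πh)`, so the cost per unit of completed mass
    -- is bounded uniformly in `h`.
    have e5 : l z * (1 + Real.log B') + l z * (1 / 2 * Real.log (4 * Real.pi * h)) +
        l z * (C / c * L ^ 2 / 4) = l z * (K - Real.log ε) := by
      rw [hlogB, hlog4, hK]; ring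
    have e6 : (k₀ z + l z) * Δ z / (4 * h) = k₀ z * Δ z / (4 * h) + l z * Δ z / (4 * h) := by ring
    have e7 : (k₀ z + l z) * (1 / 2 * Real.log (4 * Real.pi * h)) =
      k₀ z * (1 / 2 * Real.log (4 * Real.pi * h)) + l z * (1 / 2 * Real.log (4 * Real.pi * h)) := by
      ring
    linarith
  have hmem := ae_densityMeasure_mem L f₀
  have hmem2 : ∀ᵐ z ∂(μ.prod μ), z.1 ∈ Ioo 0 L ∧ z.2 ∈ Ioo 0 L := by
    filter_upwards [Measure.quasiMeasurePreserving_fst.ae hmem,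
      Measure.quasiMeasurePreserving_snd.ae hmem] with z h1 h2 using ⟨h1, h2⟩
  have hsq : ∀ z : ℝ × ℝ, z.1 ∈ Ioo 0 L ∧ z.2 ∈ Ioo 0 L → (z.2 - z.1) ^ 2 ≤ L ^ 2 := fun z hz =>
    sq_le_sq' (by linarith [hz.1.2, hz.2.1]) (by linarith [hz.1.1, hz.2.2])
  have I1 := hsc.integrable_mul_log
  have I2 : Integrable (fun z => (k₀ z + l z) * (1 / 2 * Real.log (4 * Real.pi * h)))
      (μ.prod μ) := hsc.integrable_mul measurable_const (Eventually.of_forall fun z => le_rfl)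
  have I3 : Integrable (fun z => (k₀ z + l z) * Δ z) (μ.prod μ) :=
    hsc.integrable_mul (D := C / c * L ^ 2) (by simp only [hΔ]; fun_prop) (by
      filter_upwards [hmem2] with z hz
      refine (abs_cost_le hf₀ hf z).trans ?_
      have := hsq z hz
      rw [show (z.1 - z.2) ^ 2 = (z.2 - z.1) ^ 2 by ring]
      gcongr)
  have I4 : Integrable (fun z => k₀ z * costDensity f₀ m T h z) (μ.prod μ) := by
    refine Integrable.bdd_mul (c := 1 / Real.sqrt (4 * Real.pi * (h * m₀)) / c) ?_
      hcomp.measurable.aestronglyMeasurable (Eventually.of_forall fun z => by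
        rw [Real.norm_eq_abs, abs_of_nonneg (hcomp.nonneg z)]; exact hcomp.le z)
    refine Integrable.of_bound (measurable_costDensity hf₀ hf hm h).aestronglyMeasurable
      ((|Real.log m₀| + |Real.log M₀| + |Real.log c| + |Real.log C|) +
        (1 / (4 * m₀) + C / c / 4) * (L ^ 2 / h)) ?_
    filter_upwards [hmem2] with z hz
    refine (abs_costDensity_le hf₀ hf hm hh z).trans ?_
    have := hsq z hz
    gcongr
  have I5 : Integrable (fun z => l z * (K - Real.log ε)) (μ.prod μ) :=
    hcomp.integrable_blockCompletion.mul_const _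
  have I12 : Integrable (fun z => (k₀ z + l z) * Real.log (k₀ z + l z) +
      (k₀ z + l z) * (1 / 2 * Real.log (4 * Real.pi * h))) (μ.prod μ) := I1.add I2
  have I3' : Integrable (fun z => (k₀ z + l z) * Δ z / (4 * h)) (μ.prod μ) := I3.div_const _
  have hfin := integral_mono (I12.add I3') (I4.add I5) hpt
  simp only [Pi.add_apply] at hfin
  rw [integral_add I12 I3', integral_add I1 I2, integral_add I4 I5, integral_div,
    integral_mul_const (K - Real.log ε), hcomp.integral_prod_blockCompletion,
    hsc.integral_fst (ψ := fun _ => 1 / 2 * Real.log (4 * Real.pi * h)) measurable_const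
      (Eventually.of_forall fun x => le_rfl)] at hfin
  simp only [integral_const, probReal_univ, one_smul] at hfin
  refine (rateFunctional_le_ofReal hf₀ hf hh hsc).trans (ENNReal.ofReal_le_ofReal ?_)
  linarith

end IsNormalizedDensity


/-! ### Limits of the trial couplings in the parabolic scaling. -/

lemma sqrt_mul_heatKernel {h s : ℝ} (hh : 0 < h) (hs : 0 < s) (x z : ℝ) :
    Real.sqrt h * heatKernel (h * s) x (x + Real.sqrt h * z) = heatKernel s 0 z := by
  have hr := Real.sqrt_pos.2 hh
  have h1 : Real.sqrt (4 * Real.pi * (h * s)) = Real.sqrt h * Real.sqrt (4 * Real.pi * s) := by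
    rw [← Real.sqrt_mul hh.le]; congr 1; ring
  have h2 : -(x + Real.sqrt h * z - x) ^ 2 / (4 * (h * s)) = -(z - 0) ^ 2 / (4 * s) := by
    rw [add_sub_cancel_left, mul_pow, Real.sq_sqrt hh.le]
    field_simp
    ring
  have h3 := Real.sqrt_pos.2 (by positivity : 0 < 4 * Real.pi * s)
  rw [heatKernel, heatKernel, h1, h2]
  field_simp

lemma integral_eq_sqrt_mul_integral {h : ℝ} (hh : 0 < h) (g : ℝ → ℝ) (x : ℝ) :
    ∫ y, g y = ∫ z, Real.sqrt h * g (x + Real.sqrt h * z) := by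
  have hr := Real.sqrt_pos.2 hh
  rw [integral_const_mul, Measure.integral_comp_mul_left (fun y => g (x + y)),
    integral_add_left_eq_self g x, abs_of_pos (inv_pos.2 hr), smul_eq_mul,
    mul_inv_cancel_left₀ hr.ne']

lemma heatKernel_zero_le {s s₀ S : ℝ} (hs₀ : 0 < s₀) (hs : s₀ ≤ s) (hS : s ≤ S) (z : ℝ) :
    heatKernel s 0 z ≤ 1 / Real.sqrt (4 * Real.pi * s₀) * Real.exp (-(1 / (4 * S)) * z ^ 2) := by
  have hpos : 0 < s := hs₀.trans_le hs
  have hSpos : 0 < S := hpos.trans_le hS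
  unfold heatKernel
  have h2 : 1 / Real.sqrt (4 * Real.pi * s) ≤ 1 / Real.sqrt (4 * Real.pi * s₀) := by
    apply one_div_le_one_div_of_le (Real.sqrt_pos.2 (by positivity))
    exact Real.sqrt_le_sqrt (by gcongr)
  have h3 : -(z - 0) ^ 2 / (4 * s) ≤ -(1 / (4 * S)) * z ^ 2 := by
    rw [sub_zero, neg_div, neg_mul, neg_le_neg_iff, one_div_mul_eq_div]
    gcongr
  gcongr

lemma integrable_one_add_sq_mul_gaussian {b : ℝ} (hb : 0 < b) :
    Integrable fun z : ℝ => Real.exp (-b * z ^ 2) * (1 + z ^ 2) := by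
  have h1 := integrable_exp_neg_mul_sq hb
  have h2 := integrable_rpow_mul_exp_neg_mul_sq hb (s := 2) (by norm_num)
  refine (h1.add h2).congr (Eventually.of_forall fun z => ?_)
  simp only [Pi.add_apply, Real.rpow_two]
  ring

/-- The second moment of the heat kernel. -/
lemma integral_sq_mul_heatKernel {s : ℝ} (hs : 0 < s) :
    ∫ z, heatKernel s 0 z * z ^ 2 = 2 * s := by
  obtain ⟨B, β, hB, hβ, hbd⟩ := exists_heatKernel_bounds 0 hs le_rfl
  have hb := fun z => hbd s ⟨le_rfl, le_rfl⟩ 0 (by simp) z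
  have c0 : Continuous (heatKernel s 0) := by unfold heatKernel; fun_prop
  have c1 : Continuous (heatKernelDeriv s 0) := by unfold heatKernelDeriv; fun_prop
  have c2 : Continuous (heatKernelDeriv2 s 0) := by unfold heatKernelDeriv2; fun_prop
  have i1 : Integrable (heatKernelDeriv s 0) :=
    integrable_of_gaussian_bound c1 hβ fun z => (hb z).2.1
  have i2 : Integrable (heatKernelDeriv2 s 0) :=
    integrable_of_gaussian_bound c2 hβ fun z => (hb z).2.2
  have i0 := integrable_heatKernel hs 0
  have h0 : ∫ z, heatKernelDeriv2 s 0 z = 0 :=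
    integral_eq_zero_of_hasDerivAt_of_integrable (fun z => hasDerivAt_heatKernelDeriv hs 0 z) i2 i1
  -- The second moment is read off from `heatKernelDeriv2`, whose integral is zero.
  have h1 : ∀ z, heatKernel s 0 z * z ^ 2 =
      4 * s ^ 2 * heatKernelDeriv2 s 0 z + 2 * s * heatKernel s 0 z := fun z => by
    rw [heatKernelDeriv2]
    field_simp
    ring
  simp_rw [h1]
  rw [integral_add (i2.const_mul _) (i0.const_mul _), integral_const_mul, integral_const_mul, h0,
    integral_heatKernel hs]
  ring

/-- A non-integrable function would have integral zero by convention, which contradicts the value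
`2s`. -/
lemma integrable_sq_mul_heatKernel {s : ℝ} (hs : 0 < s) :
    Integrable fun z => heatKernel s 0 z * z ^ 2 := by
  by_contra h
  have := integral_undef h
  rw [integral_sq_mul_heatKernel hs] at this
  linarith

lemma tendsto_add_sqrt_mul (x z : ℝ) :
    Tendsto (fun h => x + Real.sqrt h * z) (𝓝[>] 0) (𝓝 x) := by
  have : Tendsto (fun h => x + Real.sqrt h * z) (𝓝 0) (𝓝 (x + Real.sqrt 0 * z)) :=
    Continuous.tendsto (by fun_prop) 0
  simp only [Real.sqrt_zero, zero_mul, add_zero] at this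
  exact this.mono_left nhdsWithin_le_nhds

namespace IsNormalizedDensity

variable {L c C : ℝ} {f f₀ : ℝ → ℝ}

/-- The integral against `gaussMinKernel` in the parabolically rescaled variable. -/
lemma integral_gaussMinKernel_mul (hf₀ : IsNormalizedDensity L c C f₀) {m : ℝ → ℝ} {m₀ M₀ : ℝ}
    (hm : IsVariance m m₀ M₀) {ε h : ℝ} (hε : 0 < ε) (hε1 : ε ≤ 1) (hh : 0 < h)
    {φ : ℝ × ℝ → ℝ} {D : ℝ} (hφm : Measurable φ) (hD : 0 ≤ D)
    (hφ : ∀ z, |φ z| ≤ D * (1 + (z.2 - z.1) ^ 2 / h)) :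
    ∫ z, gaussMinKernel f₀ m ε h z * φ z ∂((densityMeasure L f₀).prod (densityMeasure L f₀)) =
      (1 - ε) * ∫ x in Ioo 0 L, ∫ z, (Ioo 0 L).indicator (fun x' =>
        min (f₀ x * heatKernel (m x) 0 z) (f₀ x' * heatKernel (m x') 0 z) * φ (x, x'))
          (x + Real.sqrt h * z) := by
  have hprob := hf₀.isProbabilityMeasure
  have hcomp := isCompletable_gaussMinKernel hf₀ hm hε hε1 hh one_pos
  have hmem := ae_densityMeasure_mem L f₀
  have hmem2 : ∀ᵐ z ∂((densityMeasure L f₀).prod (densityMeasure L f₀)),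
      z.1 ∈ Ioo 0 L ∧ z.2 ∈ Ioo 0 L := by
    filter_upwards [Measure.quasiMeasurePreserving_fst.ae hmem,
      Measure.quasiMeasurePreserving_snd.ae hmem] with z h1 h2 using ⟨h1, h2⟩
  have I : Integrable (fun z => gaussMinKernel f₀ m ε h z * φ z)
      ((densityMeasure L f₀).prod (densityMeasure L f₀)) := by
    refine Integrable.bdd_mul (c := 1 / Real.sqrt (4 * Real.pi * (h * m₀)) / c) ?_
      hcomp.measurable.aestronglyMeasurable (Eventually.of_forall fun z => by
        rw [Real.norm_eq_abs, abs_of_nonneg (hcomp.nonneg z)]; exact hcomp.le z)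
    refine Integrable.of_bound hφm.aestronglyMeasurable (D * (1 + L ^ 2 / h)) ?_
    filter_upwards [hmem2] with z hz
    refine (hφ z).trans ?_
    have : (z.2 - z.1) ^ 2 ≤ L ^ 2 :=
      sq_le_sq' (by linarith [hz.1.2, hz.2.1]) (by linarith [hz.1.1, hz.2.2])
    gcongr
  rw [integral_prod _ I, hf₀.integral_densityMeasure, ← integral_const_mul]
  refine integral_congr_ae (Eventually.of_forall fun x => ?_)
  simp only
  rw [hf₀.integral_densityMeasure, ← integral_const_mul, ← integral_indicator measurableSet_Ioo,
    integral_eq_sqrt_mul_integral hh _ x, ← integral_const_mul]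
  refine integral_congr_ae (Eventually.of_forall fun z => ?_)
  simp only
  by_cases hx' : x + Real.sqrt h * z ∈ Ioo 0 L
  · rw [indicator_of_mem hx', indicator_of_mem hx']
    have e1 := sqrt_mul_heatKernel hh (hm.pos x) x z
    have e2 := sqrt_mul_heatKernel hh (hm.pos (x + Real.sqrt h * z)) x z
    have hr := Real.sqrt_pos.2 hh
    set x' := x + Real.sqrt h * z with hx'
    have p1 := hf₀.pos x
    have p2 := hf₀.pos x'
    rw [gaussMinKernel, ← e1, ← e2]
    simp only
    -- The two densities of the product measure move into the minimum and cancel one denominator in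
    -- each argument; the Jacobian `√h` rescales the kernels to time of order one.
    have e3 : min (f₀ x * (Real.sqrt h * heatKernel (h * m x) x x'))
        (f₀ x' * (Real.sqrt h * heatKernel (h * m x') x x')) = f₀ x * f₀ x' * Real.sqrt h *
        min (heatKernel (h * m x) x x' / f₀ x') (heatKernel (h * m x') x x' / f₀ x) := by
      rw [mul_min_of_nonneg _ _ (by positivity)]
      congr 1 <;> field_simp
    rw [e3]
    ring
  · rw [indicator_of_notMem hx', indicator_of_notMem hx', mul_zero, mul_zero]

/-- The limit of integrals against `gaussMinKernel` of functions that converge in the parabolic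
scaling. -/
theorem tendsto_integral_gaussMinKernel_mul (hf₀ : IsNormalizedDensity L c C f₀)
    (hcont : ContinuousOn f₀ (Ioo 0 L)) {m : ℝ → ℝ} {m₀ M₀ : ℝ} (hm : IsVariance m m₀ M₀)
    {ε : ℝ} (hε : 0 < ε) (hε1 : ε ≤ 1) {φ : ℝ → ℝ × ℝ → ℝ} {φ₀ : ℝ → ℝ → ℝ} {D : ℝ} (hD : 0 ≤ D)
    (hφm : ∀ h, Measurable (φ h))
    (hφ : ∀ h, 0 < h → ∀ z, |φ h z| ≤ D * (1 + (z.2 - z.1) ^ 2 / h))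
    (hlim : ∀ᵐ x, x ∈ Ioo 0 L → ∀ z, Tendsto (fun h => φ h (x, x + Real.sqrt h * z)) (𝓝[>] 0)
      (𝓝 (φ₀ x z))) :
    Tendsto (fun h => ∫ z, gaussMinKernel f₀ m ε h z * φ h z
        ∂((densityMeasure L f₀).prod (densityMeasure L f₀))) (𝓝[>] 0)
      (𝓝 ((1 - ε) * ∫ x, (∫ z, heatKernel (m x) 0 z * φ₀ x z) ∂(densityMeasure L f₀))) := by
  have hm0 := hm.m₀_pos
  have hM0 : 0 < M₀ := hm0.trans_le ((hm.le 0).trans (hm.ge 0))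
  have hC := hf₀.C_pos
  have hfm := hf₀.measurable
  have hmm := hm.continuous.measurable
  set G : ℝ → ℝ → ℝ → ℝ := fun h x z => (Ioo 0 L).indicator (fun x' =>
    min (f₀ x * heatKernel (m x) 0 z) (f₀ x' * heatKernel (m x') 0 z) * φ h (x, x'))
      (x + Real.sqrt h * z) with hG
  have key : Tendsto (fun h => ∫ x in Ioo 0 L, ∫ z, G h x z) (𝓝[>] 0)
      (𝓝 (∫ x in Ioo 0 L, ∫ z, f₀ x * (heatKernel (m x) 0 z * φ₀ x z))) := by
    have hGm : ∀ h, Measurable fun p : ℝ × ℝ => G h p.1 p.2 := by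
      intro h
      have : (fun p : ℝ × ℝ => G h p.1 p.2) = ((fun p : ℝ × ℝ => p.1 + Real.sqrt h * p.2) ⁻¹'
          (Ioo 0 L)).indicator (fun p => min (f₀ p.1 * heatKernel (m p.1) 0 p.2)
            (f₀ (p.1 + Real.sqrt h * p.2) * heatKernel (m (p.1 + Real.sqrt h * p.2)) 0 p.2) *
              φ h (p.1, p.1 + Real.sqrt h * p.2)) := by
        ext p
        simp only [hG, indicator, mem_preimage]
      rw [this]
      refine Measurable.indicator ?_ (measurableSet_Ioo.preimage (by fun_prop))
      have := hφm h
      unfold heatKernel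
      fun_prop
    set A := C * (1 / Real.sqrt (4 * Real.pi * m₀)) * D with hA
    -- Dominating function uniform in `h` and `x`: the variance is at least `m₀` in the prefactor
    -- and at most `M₀` in the exponent.
    set g : ℝ → ℝ := fun z => A * (Real.exp (-(1 / (4 * M₀)) * z ^ 2) * (1 + z ^ 2)) with hg
    have hgi : Integrable g := (integrable_one_add_sq_mul_gaussian (by positivity)).const_mul _
    have hg0 : ∀ z, 0 ≤ g z := fun z => by positivity
    have hbd : ∀ h, 0 < h → ∀ x z, ‖G h x z‖ ≤ g z := by
      intro h hh x z
      by_cases hx' : x + Real.sqrt h * z ∈ Ioo 0 L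
      · simp only [hG, indicator_of_mem hx']
        have e1 := hφ h hh (x, x + Real.sqrt h * z)
        simp only [add_sub_cancel_left, mul_pow, Real.sq_sqrt hh.le,
          mul_div_cancel_left₀ _ hh.ne'] at e1
        have e2 : 0 ≤ min (f₀ x * heatKernel (m x) 0 z) (f₀ (x + Real.sqrt h * z) *
            heatKernel (m (x + Real.sqrt h * z)) 0 z) :=
          le_min (mul_pos (hf₀.pos _) (heatKernel_pos (hm.pos _) _ _)).le
            (mul_pos (hf₀.pos _) (heatKernel_pos (hm.pos _) _ _)).le
        have e3 : min (f₀ x * heatKernel (m x) 0 z) (f₀ (x + Real.sqrt h * z) *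
            heatKernel (m (x + Real.sqrt h * z)) 0 z) ≤ C * (1 / Real.sqrt (4 * Real.pi * m₀) *
              Real.exp (-(1 / (4 * M₀)) * z ^ 2)) :=
          (min_le_left _ _).trans (mul_le_mul (hf₀.ge x)
            (heatKernel_zero_le hm0 (hm.le x) (hm.ge x) z) (heatKernel_pos (hm.pos _) _ _).le hC.le)
        rw [Real.norm_eq_abs, abs_mul, abs_of_nonneg e2]
        refine (mul_le_mul e3 e1 (abs_nonneg _) (e2.trans e3)).trans_eq ?_
        rw [hg, hA]; ring
      · simp only [hG, indicator_of_notMem hx', norm_zero]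
        exact hg0 z
    refine tendsto_integral_filter_of_dominated_convergence (fun _ => ∫ z, g z) ?_ ?_
      (integrable_const _) ?_
    · exact Eventually.of_forall fun h =>
        (hGm h).stronglyMeasurable.integral_prod_right.aestronglyMeasurable
    · filter_upwards [self_mem_nhdsWithin] with h hh
      refine Eventually.of_forall fun x => ?_
      exact norm_integral_le_of_norm_le hgi (Eventually.of_forall (hbd h hh x))
    · filter_upwards [ae_restrict_mem measurableSet_Ioo, ae_restrict_of_ae hlim] with x hx hx2
      refine tendsto_integral_filter_of_dominated_convergence g ?_ ?_ hgi ?_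
      · exact Eventually.of_forall fun h =>
          ((hGm h).comp measurable_prodMk_left).aestronglyMeasurable
      · filter_upwards [self_mem_nhdsWithin] with h hh
        exact Eventually.of_forall (hbd h hh x)
      · refine Eventually.of_forall fun z => ?_
        have t0 := tendsto_add_sqrt_mul x z
        have t1 : Tendsto (fun h => f₀ (x + Real.sqrt h * z)) (𝓝[>] 0) (𝓝 (f₀ x)) :=
          (hcont.continuousAt (isOpen_Ioo.mem_nhds hx)).tendsto.comp t0
        have t2 : Tendsto (fun h => heatKernel (m (x + Real.sqrt h * z)) 0 z) (𝓝[>] 0)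
            (𝓝 (heatKernel (m x) 0 z)) :=
          ((hasDerivAt_heatKernel_time (hm.pos x) 0 z).continuousAt.tendsto.comp
            (hm.continuous.tendsto x)).comp t0
        -- Continuity of `f₀` and `m` at `x` makes both arguments of the minimum tend to the same
        -- limit, so symmetrisation loses nothing in the limit.
        have t3 := (((tendsto_const_nhds (x := f₀ x * heatKernel (m x) 0 z)).min
          (t1.mul t2)).mul (hx2 hx z))
        rw [min_self, mul_assoc] at t3
        refine t3.congr' ?_
        filter_upwards [t0.eventually (isOpen_Ioo.mem_nhds hx)] with h hh
        have hh' : x + Real.sqrt h * z ∈ Ioo 0 L := hh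
        simp only [hG]
        rw [indicator_of_mem hh']
  have hrhs : ∫ x, (∫ z, heatKernel (m x) 0 z * φ₀ x z) ∂(densityMeasure L f₀) =
      ∫ x in Ioo 0 L, ∫ z, f₀ x * (heatKernel (m x) 0 z * φ₀ x z) := by
    rw [hf₀.integral_densityMeasure]
    simp_rw [integral_const_mul]
  rw [hrhs]
  refine (key.const_mul (1 - ε)).congr' ?_
  filter_upwards [self_mem_nhdsWithin] with h hh
  rw [hf₀.integral_gaussMinKernel_mul hm hε hε1 hh (hφm h) hD (hφ h hh)]

lemma tendsto_integral_gaussMinKernel (hf₀ : IsNormalizedDensity L c C f₀)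
    (hcont : ContinuousOn f₀ (Ioo 0 L)) {m : ℝ → ℝ} {m₀ M₀ : ℝ}
    (hm : IsVariance m m₀ M₀) {ε : ℝ} (hε : 0 < ε) (hε1 : ε ≤ 1) :
    Tendsto (fun h => ∫ z, gaussMinKernel f₀ m ε h z
        ∂((densityMeasure L f₀).prod (densityMeasure L f₀))) (𝓝[>] 0) (𝓝 (1 - ε)) := by
  have hprob := hf₀.isProbabilityMeasure
  have h1 := hf₀.tendsto_integral_gaussMinKernel_mul hcont hm hε hε1 (φ := fun _ _ => 1)
    (φ₀ := fun _ _ => 1) zero_le_one (fun h => measurable_const) (fun h hh z => by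
      rw [abs_one, one_mul]
      have : 0 ≤ (z.2 - z.1) ^ 2 / h := by positivity
      linarith) (Eventually.of_forall fun x _ z => tendsto_const_nhds)
  simp only [mul_one] at h1
  simp_rw [integral_heatKernel (hm.pos _)] at h1
  simpa using h1

end IsNormalizedDensity


/-! ### The optimal local variance and the sharp upper bound. -/

/-- Approximation in `L¹` of a function with values in `[a, b]` by a continuous one. -/
lemma exists_continuous_integral_abs_sub_le {μ : Measure ℝ} [IsFiniteMeasure μ] {v : ℝ → ℝ}
    {a b : ℝ} (hv : Measurable v) (ha : ∀ x, a ≤ v x) (hb : ∀ x, v x ≤ b) {η : ℝ} (hη : 0 < η) :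
    ∃ m : ℝ → ℝ, Continuous m ∧ (∀ x, a ≤ m x) ∧ (∀ x, m x ≤ b) ∧ ∫ x, |v x - m x| ∂μ ≤ η := by
  have hvi : Integrable v μ := Integrable.of_bound hv.aestronglyMeasurable (max |a| |b|)
    (Eventually.of_forall fun x => abs_le_max_abs_abs (ha x) (hb x))
  obtain ⟨g, hg, hgi⟩ := hvi.exists_boundedContinuous_integral_sub_le hη
  have hab : a ≤ b := (ha 0).trans (hb 0)
  have hm : Continuous fun x => max a (min (g x) b) := by fun_prop
  refine ⟨fun x => max a (min (g x) b), hm, fun x => le_max_left _ _,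
    fun x => max_le hab (min_le_right _ _), le_trans ?_ hg⟩
  refine integral_mono_of_nonneg (Eventually.of_forall fun x => abs_nonneg _)
    (hvi.sub hgi).norm (Eventually.of_forall fun x => ?_)
  have h1 : v x = max a (min (v x) b) := by rw [min_eq_left (hb x), max_eq_right (ha x)]
  simp only [Real.norm_eq_abs]
  nth_rw 1 [h1]
  have h2 := abs_max_sub_max_le_max a (min (v x) b) a (min (g x) b)
  have h3 := abs_min_sub_min_le_max (v x) b (g x) b
  simp only [sub_self, abs_zero, abs_nonneg, max_eq_left, max_eq_right] at h2 h3
  exact h2.trans h3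

namespace IsNormalizedDensity

variable {L c C : ℝ} {f f₀ : ℝ → ℝ}

variable (hf₀ : IsNormalizedDensity L c C f₀) (hf : IsNormalizedDensity L c C f)

include hf₀ hf

/-- Measurability of the derivative of the monotone rearrangement. -/
lemma measurable_transportDeriv :
    Measurable fun x => f₀ x / f (transportMap f₀ f x) :=
  hf₀.measurable.div (hf.measurable.comp (continuous_transportMap hf₀ hf).measurable)

/-- After rescaling, the term `(x - x')(T x - T x') / (4h)` is a difference quotient of `T` with
step `√h`, so it converges at every point of differentiability of `T`. Continuity of `f` is not
needed. -/
lemma tendsto_costDensity (hcont : ContinuousOn f₀ (Ioo 0 L)) {m : ℝ → ℝ} {m₀ M₀ : ℝ}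
    (hm : IsVariance m m₀ M₀) :
    ∀ᵐ x, x ∈ Ioo 0 L → ∀ z, Tendsto
      (fun h => costDensity f₀ m (transportMap f₀ f) h (x, x + Real.sqrt h * z)) (𝓝[>] 0)
      (𝓝 ((-(1 / 2) * Real.log (m x) - Real.log (f₀ x)) +
        (f₀ x / f (transportMap f₀ f x) / 4 - 1 / (4 * m x)) * z ^ 2)) := by
  filter_upwards [ae_hasDerivAt_transportMap hf₀ hf] with x hT hx z
  have t0 := tendsto_add_sqrt_mul x z
  have t1 : Tendsto (fun h => Real.log (f₀ (x + Real.sqrt h * z))) (𝓝[>] 0)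
      (𝓝 (Real.log (f₀ x))) :=
    ((Real.continuousAt_log (hf₀.pos x).ne').tendsto.comp
      (hcont.continuousAt (isOpen_Ioo.mem_nhds hx)).tendsto).comp t0
  have hr : Tendsto Real.sqrt (𝓝[>] 0) (𝓝[>] 0) := by
    refine tendsto_nhdsWithin_iff.2 ⟨?_, ?_⟩
    · have := (Real.continuous_sqrt.tendsto 0).mono_left (nhdsWithin_le_nhds (s := Ioi 0))
      rwa [Real.sqrt_zero] at this
    · filter_upwards [self_mem_nhdsWithin] with h hh using Real.sqrt_pos.2 hh
  have t2 : Tendsto (fun h => (Real.sqrt h)⁻¹ • (transportMap f₀ f (x + Real.sqrt h * z) -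
      transportMap f₀ f x)) (𝓝[>] 0) (𝓝 (f₀ x / f (transportMap f₀ f x) * z)) := by
    have d1 : HasDerivAt (fun t => x + t * z) z 0 := by
      simpa using ((hasDerivAt_id (0 : ℝ)).mul_const z).const_add x
    have hT' : HasDerivAt (transportMap f₀ f) (f₀ x / f (transportMap f₀ f x)) (x + 0 * z) := by
      simpa using hT
    have d2 := (hT'.comp (0 : ℝ) d1).tendsto_slope_zero_right.comp hr
    refine d2.congr fun h => ?_
    simp [Function.comp]
  have t3 := ((tendsto_const_nhds (x := -(1 / 2) * Real.log (m x) - z ^ 2 / (4 * m x))).sub t1).add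
    (t2.mul_const (z / 4))
  have e : (-(1 / 2) * Real.log (m x) - Real.log (f₀ x)) +
        (f₀ x / f (transportMap f₀ f x) / 4 - 1 / (4 * m x)) * z ^ 2 =
      -(1 / 2) * Real.log (m x) - z ^ 2 / (4 * m x) - Real.log (f₀ x) +
        f₀ x / f (transportMap f₀ f x) * z * (z / 4) := by ring
  rw [e]
  refine t3.congr' ?_
  filter_upwards [self_mem_nhdsWithin] with h hh
  have hh' : 0 < h := hh
  have hs := Real.sqrt_pos.2 hh'
  have hmx := hm.pos x
  simp only [costDensity, add_sub_cancel_left, sub_add_cancel_left, mul_pow, Real.sq_sqrt hh'.le,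
    smul_eq_mul]
  have e1 : h * z ^ 2 / (4 * (h * m x)) = z ^ 2 / (4 * m x) := by field_simp
  have e2 : ∀ d : ℝ, -(Real.sqrt h * z) * d / (4 * h) = (Real.sqrt h)⁻¹ * (-d) * (z / 4) := by
    intro d
    nth_rw 2 [← Real.sq_sqrt hh'.le]
    field_simp
  rw [e1, e2, neg_sub]

/-- The limit cost of the Gaussian kernel of local variance `m`. -/
lemma tendsto_integral_costDensity (hcont : ContinuousOn f₀ (Ioo 0 L)) {m : ℝ → ℝ} {m₀ M₀ : ℝ}
    (hm : IsVariance m m₀ M₀) {ε : ℝ} (hε : 0 < ε) (hε1 : ε ≤ 1) :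
    Tendsto (fun h => ∫ z, gaussMinKernel f₀ m ε h z * costDensity f₀ m (transportMap f₀ f) h z
        ∂((densityMeasure L f₀).prod (densityMeasure L f₀))) (𝓝[>] 0)
      (𝓝 ((1 - ε) * ∫ x, (-(1 / 2) * Real.log (m x) - Real.log (f₀ x) +
        1 / 2 * (m x * (f₀ x / f (transportMap f₀ f x))) - 1 / 2) ∂(densityMeasure L f₀))) := by
  have hc := hf.c_pos
  have hC := hf.C_pos
  have hm0 := hm.m₀_pos
  set D := max (|Real.log m₀| + |Real.log M₀| + |Real.log c| + |Real.log C|)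
    (1 / (4 * m₀) + C / c / 4) with hD
  have hD0 : 0 ≤ D := le_trans (by positivity) (le_max_left _ _)
  have h1 := hf₀.tendsto_integral_gaussMinKernel_mul hcont hm hε hε1 hD0
    (measurable_costDensity hf₀ hf hm) (fun h hh z => by
      refine (abs_costDensity_le hf₀ hf hm hh z).trans ?_
      rw [mul_add, mul_one]
      gcongr
      · exact le_max_left _ _
      · exact le_max_right _ _) (tendsto_costDensity hf₀ hf hcont hm)
  convert h1 using 3
  refine integral_congr_ae (Eventually.of_forall fun x => ?_)
  have hs := hm.pos x
  simp only
  set A := -(1 / 2) * Real.log (m x) - Real.log (f₀ x)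
  set w := f₀ x / f (transportMap f₀ f x)
  have e : ∀ z, heatKernel (m x) 0 z * (A + (w / 4 - 1 / (4 * m x)) * z ^ 2) =
      A * heatKernel (m x) 0 z + (w / 4 - 1 / (4 * m x)) * (heatKernel (m x) 0 z * z ^ 2) :=
    fun z => by ring
  simp_rw [e]
  rw [integral_add ((integrable_heatKernel hs 0).const_mul _)
    ((integrable_sq_mul_heatKernel hs).const_mul _), integral_const_mul, integral_const_mul,
    integral_heatKernel hs, integral_sq_mul_heatKernel hs]
  field_simp
  ring

/-- A local variance for which the limit cost is close to the entropy difference. -/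
lemma exists_isVariance_integral_lt {η : ℝ} (hη : 0 < η) :
    ∃ m : ℝ → ℝ, IsVariance m (c / C) (C / c) ∧ entropy (densityMeasure L f) +
      ∫ x, (-(1 / 2) * Real.log (m x) - Real.log (f₀ x) +
        1 / 2 * (m x * (f₀ x / f (transportMap f₀ f x))) - 1 / 2) ∂(densityMeasure L f₀) <
      1 / 2 * entropy (densityMeasure L f) - 1 / 2 * entropy (densityMeasure L f₀) + η := by
  have hprob := hf₀.isProbabilityMeasure
  have hc := hf.c_pos
  have hC := hf.C_pos
  set μ := densityMeasure L f₀ with hμ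
  set T := transportMap f₀ f with hT
  have hTm : Measurable T := (continuous_transportMap hf₀ hf).measurable
  set w : ℝ → ℝ := fun x => f₀ x / f (T x) with hw
  have hfm := hf.measurable
  have hf₀m := hf₀.measurable
  have hwm : Measurable w := measurable_transportDeriv hf₀ hf
  have hw0 : ∀ x, 0 < w x := fun x => div_pos (hf₀.pos x) (hf.pos _)
  have hwle : ∀ x, w x ≤ C / c := fun x => div_le_div₀ hC.le (hf₀.ge x) hc (hf.le _)
  have hlew : ∀ x, c / C ≤ w x := fun x => div_le_div₀ (hf₀.pos x).le (hf₀.le x) (hf.pos _) (hf.ge _)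
  set S := C / c with hS
  have hS0 : 0 < S := by positivity
  have hSinv : c / C = S⁻¹ := by rw [hS, inv_div]
  -- Pointwise, `-½ log m + ½ m w` is minimal at `m = 1 / w`. This is only measurable, hence the
  -- continuous approximation, with a tolerance that compensates the factor `S ^ 3` below.
  obtain ⟨m, hmc, hma, hmb, hmi⟩ := exists_continuous_integral_abs_sub_le (μ := μ)
    (v := fun x => (w x)⁻¹) (a := c / C) (b := S) hwm.inv
    (fun x => by rw [hSinv]; exact inv_anti₀ (hw0 x) (hwle x))
    (fun x => by rw [hS, ← inv_div]; exact inv_anti₀ (by positivity) (hlew x))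
    (η := η / S ^ 3) (by positivity)
  have hm : IsVariance m (c / C) S := ⟨hmc, by positivity, hma, hmb⟩
  refine ⟨m, hm, ?_⟩
  -- The excess over the optimal value is `½ (mw - 1 - log (mw))`. By `log a ≥ 1 - 1/a` it is at
  -- most `(mw - 1)² / (2mw)`, which is controlled by `|1/w - m|` because `m` and `w` are bounded
  -- above and below.
  have hpt : ∀ x, -(1 / 2) * Real.log (m x) - Real.log (f₀ x) + 1 / 2 * (m x * w x) - 1 / 2 ≤
      -(1 / 2) * Real.log (f (T x)) - 1 / 2 * Real.log (f₀ x) +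
        1 / 2 * S ^ 3 * |(w x)⁻¹ - m x| := by
    intro x
    have hmx := hm.pos x
    have hwx := hw0 x
    have e1 := Real.one_sub_inv_le_log_of_pos (mul_pos hmx hwx)
    rw [Real.log_mul hmx.ne' hwx.ne', hw, Real.log_div (hf₀.pos x).ne' (hf.pos _).ne'] at e1
    have e2 : m x * w x - 2 + (m x * w x)⁻¹ = (w x / m x * |(w x)⁻¹ - m x|) * |(w x)⁻¹ - m x| := by
      rw [mul_assoc, ← pow_two, sq_abs]
      field_simp
      ring
    have e3 : w x / m x * |(w x)⁻¹ - m x| ≤ S ^ 3 := by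
      have a1 : |(w x)⁻¹ - m x| ≤ S := by
        have b1 : 0 < (w x)⁻¹ := inv_pos.2 hwx
        have b2 : (w x)⁻¹ ≤ S := by rw [hS, ← inv_div]; exact inv_anti₀ (by positivity) (hlew x)
        rw [abs_le]
        constructor <;> linarith [hmb x]
      have a2 : w x / m x ≤ S * S := by
        rw [div_eq_mul_inv]
        refine mul_le_mul (hwle x) ?_ (inv_pos.2 hmx).le hS0.le
        rw [hS, ← inv_div]; exact inv_anti₀ (by positivity) (hma x)
      calc _ ≤ S * S * S := by gcongr
        _ = S ^ 3 := by ring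
    have e4 := mul_le_mul_of_nonneg_right e3 (abs_nonneg ((w x)⁻¹ - m x))
    simp only [hw] at e1 e2 e4 ⊢
    linarith
  have b0 : ∀ x, |Real.log (f (T x))| ≤ |Real.log c| + |Real.log C| := fun x => hf.abs_log_le _
  have i1 : Integrable (fun x => Real.log (f (T x))) μ :=
    Integrable.of_bound (hfm.comp hTm).log.aestronglyMeasurable _ (Eventually.of_forall b0)
  have i2 : Integrable (fun x => Real.log (f₀ x)) μ :=
    Integrable.of_bound hf₀m.log.aestronglyMeasurable _ (Eventually.of_forall hf₀.abs_log_le)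
  have i3 : Integrable (fun x => |(w x)⁻¹ - m x|) μ := by
    refine Integrable.of_bound (C := S) (by have := hmc.measurable; fun_prop) (Eventually.of_forall fun x => ?_)
    have b1 : 0 < (w x)⁻¹ := inv_pos.2 (hw0 x)
    have b2 : (w x)⁻¹ ≤ S := by rw [hS, ← inv_div]; exact inv_anti₀ (by positivity) (hlew x)
    rw [Real.norm_eq_abs, abs_abs, abs_le]
    constructor <;> linarith [hmb x, hm.pos x]
  have i4 : Integrable (fun x => -(1 / 2) * Real.log (m x) - Real.log (f₀ x) +
      1 / 2 * (m x * w x) - 1 / 2) μ := by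
    have j1 : Integrable (fun x => Real.log (m x)) μ := by
      refine Integrable.of_bound (C := |Real.log (c / C)| + |Real.log S|)
        hmc.measurable.log.aestronglyMeasurable (Eventually.of_forall fun x => ?_)
      have h1 := Real.log_le_log hm.m₀_pos (hm.le x)
      have h2 := Real.log_le_log (hm.pos x) (hm.ge x)
      rw [Real.norm_eq_abs, abs_le]
      constructor
      · linarith [neg_abs_le (Real.log (c / C)), abs_nonneg (Real.log S)]
      · linarith [le_abs_self (Real.log S), abs_nonneg (Real.log (c / C))]
    have j2 : Integrable (fun x => m x * w x) μ := by
      refine Integrable.of_bound (C := S * S) (by have := hmc.measurable; fun_prop)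
        (Eventually.of_forall fun x => ?_)
      rw [Real.norm_eq_abs, abs_of_pos (mul_pos (hm.pos x) (hw0 x))]
      exact mul_le_mul (hmb x) (hwle x) (hw0 x).le hS0.le
    exact (((j1.const_mul _).sub i2).add (j2.const_mul _)).sub (integrable_const _)
  have hT' : ∫ x, Real.log (f (T x)) ∂μ = entropy (densityMeasure L f) := by
    rw [hf.entropy_densityMeasure, ← map_transportMap hf₀ hf, integral_map
      hTm.aemeasurable hfm.log.aestronglyMeasurable]
  have hfin := integral_mono i4 (((i1.const_mul (-(1 / 2))).sub (i2.const_mul (1 / 2))).add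
    (i3.const_mul (1 / 2 * S ^ 3))) hpt
  rw [integral_add' ((i1.const_mul _).sub (i2.const_mul _)) (i3.const_mul _),
    integral_sub' (i1.const_mul _) (i2.const_mul _), integral_const_mul, integral_const_mul,
    integral_const_mul, hT', ← hf₀.entropy_densityMeasure] at hfin
  have h5 : 1 / 2 * S ^ 3 * ∫ x, |(w x)⁻¹ - m x| ∂μ ≤ η / 2 := by
    calc _ ≤ 1 / 2 * S ^ 3 * (η / S ^ 3) := by gcongr
      _ = η / 2 := by field_simp
  linarith

/-- The upper bound for the rate functional at fixed endpoints. -/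
theorem eventually_rateFunctional_le (hcont : ContinuousOn f₀ (Ioo 0 L)) {η : ℝ} (hη : 0 < η) :
    ∀ᶠ h in 𝓝[>] (0 : ℝ), rateFunctional h (densityMeasure L f) (densityMeasure L f₀) ≤
      ENNReal.ofReal (1 / 2 * entropy (densityMeasure L f) - 1 / 2 * entropy (densityMeasure L f₀)
        + η + (∫ x, (x - transportMap f₀ f x) ^ 2 ∂(densityMeasure L f₀)) / (4 * h)) := by
  obtain ⟨m, hm, hlt⟩ := exists_isVariance_integral_lt hf₀ hf hη
  obtain ⟨K, hK⟩ := rateFunctional_le_gaussMinKernel hf₀ hf hm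
  set A := ∫ x, (-(1 / 2) * Real.log (m x) - Real.log (f₀ x) +
        1 / 2 * (m x * (f₀ x / f (transportMap f₀ f x))) - 1 / 2) ∂(densityMeasure L f₀) with hA
  -- First `ε` is fixed, using `ε log ε → 0` and the strict inequality for `m`; only then does `h`
  -- tend to zero, where the missing mass tends to `ε`.
  have hε : ∀ᶠ ε in 𝓝[>] (0 : ℝ), entropy (densityMeasure L f) + (1 - ε) * A +
      ε * (K - Real.log ε) < 1 / 2 * entropy (densityMeasure L f) -
        1 / 2 * entropy (densityMeasure L f₀) + η := by
    have h1 : Tendsto (fun ε : ℝ => entropy (densityMeasure L f) + (1 - ε) * A +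
        (ε * K - ε * Real.log ε)) (𝓝 0) (𝓝 (entropy (densityMeasure L f) + (1 - 0) * A +
          (0 * K - 0 * Real.log 0))) := by
      refine Continuous.tendsto ?_ 0
      have := Real.continuous_mul_log
      fun_prop
    simp only [sub_zero, one_mul, zero_mul, add_zero] at h1
    filter_upwards [(h1.mono_left nhdsWithin_le_nhds).eventually (gt_mem_nhds hlt)] with ε he
    rwa [mul_sub]
  obtain ⟨ε, hε, hε0, hε1⟩ := (hε.and (Ioc_mem_nhdsGT (zero_lt_one' ℝ))).exists
  have hlim : Tendsto (fun h => entropy (densityMeasure L f) +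
      (∫ z, gaussMinKernel f₀ m ε h z * costDensity f₀ m (transportMap f₀ f) h z
        ∂((densityMeasure L f₀).prod (densityMeasure L f₀))) + (1 - ∫ z, gaussMinKernel f₀ m ε h z
          ∂((densityMeasure L f₀).prod (densityMeasure L f₀))) * (K - Real.log ε)) (𝓝[>] 0)
      (𝓝 (entropy (densityMeasure L f) + (1 - ε) * A + (1 - (1 - ε)) * (K - Real.log ε))) :=
    ((tendsto_integral_costDensity hf₀ hf hcont hm hε0 hε1).const_add _).add
      (((hf₀.tendsto_integral_gaussMinKernel hcont hm hε0 hε1).const_sub 1).mul_const _)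
  rw [sub_sub_cancel] at hlim
  filter_upwards [hlim.eventually (gt_mem_nhds hε), Ioc_mem_nhdsGT (zero_lt_one' ℝ)] with h h1 h2
  refine (hK ε h hε0 hε1 h2.1 h2.2).trans (ENNReal.ofReal_le_ofReal ?_)
  linarith

end IsNormalizedDensity


/-! ### The dual formula for the entropy and its lower semicontinuity. -/

namespace IsNormalizedDensity

variable {L c C : ℝ} {f f₀ : ℝ → ℝ}

/-- The dual lower bound for the entropy. -/
lemma integral_sub_integral_exp_le_entropy (hf : IsNormalizedDensity L c C f) {ψ : ℝ → ℝ}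
    {a b : ℝ} (hψ : Continuous ψ) (ha : ∀ x, a ≤ ψ x) (hb : ∀ x, ψ x ≤ b) :
    ∫ x, ψ x ∂(densityMeasure L f) - ∫ x in Ioo 0 L, Real.exp (ψ x - 1) ≤
      entropy (densityMeasure L f) := by
  rw [hf.entropy_densityMeasure, hf.integral_densityMeasure, hf.integral_densityMeasure]
  have hfi := hf.integrable_restrict (Ioo 0 L) (by simp)
  have i1 : Integrable (fun x => f x * ψ x) (volume.restrict (Ioo 0 L)) :=
    hfi.mul_bdd (c := max |a| |b|) hψ.aestronglyMeasurable
      (Eventually.of_forall fun x => abs_le_max_abs_abs (ha x) (hb x))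
  have i2 : Integrable (fun x => f x * Real.log (f x)) (volume.restrict (Ioo 0 L)) :=
    hfi.mul_bdd (c := |Real.log c| + |Real.log C|) hf.measurable.log.aestronglyMeasurable
      (Eventually.of_forall hf.abs_log_le)
  have i3 : Integrable (fun x => Real.exp (ψ x - 1)) (volume.restrict (Ioo 0 L)) := by
    refine Integrable.of_bound (C := Real.exp (b - 1))
      (Continuous.aestronglyMeasurable (by fun_prop)) (Eventually.of_forall fun x => ?_)
    rw [Real.norm_eq_abs, Real.abs_exp]
    gcongr
    exact hb x
  rw [← integral_sub i1 i3]
  refine integral_mono (i1.sub i3) i2 fun x => ?_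
  have hx := hf.pos x
  -- The Fenchel-Young inequality for `t log t`, whose conjugate is `exp (ψ - 1)`.
  have h1 := Real.add_one_le_exp (ψ x - 1 - Real.log (f x))
  rw [Real.exp_sub, Real.exp_log hx, le_div_iff₀ hx] at h1
  simp only
  linarith

/-- The dual formula for the entropy is almost attained by continuous functions. -/
lemma exists_entropy_le_integral_sub (hf : IsNormalizedDensity L c C f) {η : ℝ} (hη : 0 < η) :
    ∃ ψ : ℝ → ℝ, Continuous ψ ∧ (∀ x, 1 + Real.log c ≤ ψ x) ∧ (∀ x, ψ x ≤ 1 + Real.log C) ∧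
      entropy (densityMeasure L f) - η ≤
        ∫ x, ψ x ∂(densityMeasure L f) - ∫ x in Ioo 0 L, Real.exp (ψ x - 1) := by
  have hC := hf.C_pos
  -- Equality in Fenchel-Young holds for `ψ = 1 + log f`, which is approximated in `L¹` by
  -- continuous functions with the same bounds.
  obtain ⟨ψ, hψ, ha, hb, hi⟩ := exists_continuous_integral_abs_sub_le
    (μ := volume.restrict (Ioo 0 L)) (v := fun x => 1 + Real.log (f x)) (a := 1 + Real.log c)
    (b := 1 + Real.log C) (measurable_const.add hf.measurable.log)
    (fun x => by linarith [Real.log_le_log hf.c_pos (hf.le x)])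
    (fun x => by linarith [Real.log_le_log (hf.pos x) (hf.ge x)]) (η := η / (2 * C)) (by positivity)
  refine ⟨ψ, hψ, ha, hb, ?_⟩
  rw [hf.entropy_densityMeasure, hf.integral_densityMeasure, hf.integral_densityMeasure]
  have hfi := hf.integrable_restrict (Ioo 0 L) (by simp)
  have i1 : Integrable (fun x => f x * ψ x) (volume.restrict (Ioo 0 L)) :=
    hfi.mul_bdd (c := max |1 + Real.log c| |1 + Real.log C|) hψ.aestronglyMeasurable
      (Eventually.of_forall fun x => abs_le_max_abs_abs (ha x) (hb x))
  have i2 : Integrable (fun x => f x * Real.log (f x)) (volume.restrict (Ioo 0 L)) :=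
    hfi.mul_bdd (c := |Real.log c| + |Real.log C|) hf.measurable.log.aestronglyMeasurable
      (Eventually.of_forall hf.abs_log_le)
  have hexp : ∀ x, Real.exp (ψ x - 1) ≤ C := fun x => by
    rw [← Real.exp_log hC]
    exact Real.exp_le_exp.2 (by linarith [hb x])
  have i3 : Integrable (fun x => Real.exp (ψ x - 1)) (volume.restrict (Ioo 0 L)) := by
    refine Integrable.of_bound (C := C)
      (Continuous.aestronglyMeasurable (by fun_prop)) (Eventually.of_forall fun x => ?_)
    rw [Real.norm_eq_abs, Real.abs_exp]
    exact hexp x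
  have i4 : Integrable (fun x => |1 + Real.log (f x) - ψ x|) (volume.restrict (Ioo 0 L)) := by
    refine Integrable.of_bound (C := |Real.log C - Real.log c|)
      (((measurable_const.add hf.measurable.log).sub hψ.measurable).abs).aestronglyMeasurable
      (Eventually.of_forall fun x => ?_)
    have h1 := Real.log_le_log hf.c_pos (hf.le x)
    have h2 := Real.log_le_log (hf.pos x) (hf.ge x)
    rw [Real.norm_eq_abs, abs_abs]
    refine le_trans ?_ (le_abs_self _)
    rw [abs_le]
    constructor <;> linarith [ha x, hb x]
  have hpt : ∀ x, f x * Real.log (f x) ≤ f x * ψ x - Real.exp (ψ x - 1) +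
      2 * C * |1 + Real.log (f x) - ψ x| := by
    intro x
    have hx := hf.pos x
    set d := 1 + Real.log (f x) - ψ x with hd
    have h1 := Real.add_one_le_exp d
    have h2 : Real.exp (ψ x - 1) * Real.exp d = f x := by
      rw [← Real.exp_add, hd, show ψ x - 1 + (1 + Real.log (f x) - ψ x) = Real.log (f x) by ring,
        Real.exp_log hx]
    have h3 := mul_le_mul_of_nonneg_left h1 (Real.exp_pos (ψ x - 1)).le
    have h4 : -(Real.exp (ψ x - 1) * d) ≤ C * |d| := by
      rw [← mul_neg]
      calc _ ≤ Real.exp (ψ x - 1) * |d| :=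
            mul_le_mul_of_nonneg_left (neg_le_abs d) (Real.exp_pos _).le
        _ ≤ C * |d| := mul_le_mul_of_nonneg_right (hexp x) (abs_nonneg d)
    have h5 : f x * d ≤ C * |d| := by
      calc f x * d ≤ f x * |d| := mul_le_mul_of_nonneg_left (le_abs_self d) hx.le
        _ ≤ C * |d| := mul_le_mul_of_nonneg_right (hf.ge x) (abs_nonneg d)
    have h6 : f x * d = f x + f x * Real.log (f x) - f x * ψ x := by rw [hd]; ring
    linarith
  have hfin := integral_mono i2 ((i1.sub i3).add (i4.const_mul (2 * C))) hpt
  rw [integral_add' (i1.sub i3) (i4.const_mul _), integral_sub' i1 i3, integral_const_mul] at hfin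
  have h5 : 2 * C * ∫ x in Ioo 0 L, |1 + Real.log (f x) - ψ x| ≤ η := by
    calc _ ≤ 2 * C * (η / (2 * C)) := by gcongr
      _ = η := by field_simp
  linarith

/-- Lower semicontinuity of the entropy under narrow convergence. -/
theorem eventually_lt_entropy (hf : IsNormalizedDensity L c C f) {ι : Type*} {l : Filter ι}
    {u : ι → ProbabilityMeasure ℝ} {ρ : ProbabilityMeasure ℝ}
    (hρ : (ρ : Measure ℝ) = densityMeasure L f)
    (hu : ∀ᶠ i in l, ∃ g, IsNormalizedDensity L c C g ∧ (u i : Measure ℝ) = densityMeasure L g)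
    (hlim : Tendsto u l (𝓝 ρ)) {E : ℝ} (hE : E < entropy ρ) :
    ∀ᶠ i in l, E < entropy (u i) := by
  obtain ⟨ψ, hψ, ha, hb, hi⟩ := hf.exists_entropy_le_integral_sub
    (η := (entropy ρ - E) / 2) (by linarith)
  let Ψ : BoundedContinuousFunction ℝ ℝ := BoundedContinuousFunction.ofNormedAddCommGroup ψ hψ
    (max |1 + Real.log c| |1 + Real.log C|) fun x => abs_le_max_abs_abs (ha x) (hb x)
  have h1 := ProbabilityMeasure.tendsto_iff_forall_integral_tendsto.1 hlim Ψ
  have h2 : ∀ x, Ψ x = ψ x := fun x => rfl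
  simp_rw [h2] at h1
  rw [← hρ] at hi
  have h3 : E + ∫ x in Ioo 0 L, Real.exp (ψ x - 1) < ∫ x, ψ x ∂(ρ : Measure ℝ) := by linarith
  filter_upwards [h1.eventually (lt_mem_nhds h3), hu] with i h4 ⟨g, hg, hgi⟩
  have h5 := hg.integral_sub_integral_exp_le_entropy hψ ha hb
  rw [← hgi] at h5
  linarith

end IsNormalizedDensity

/-! ### Pointwise bounded representatives of the elements of `A_δ`. -/

/-- The truncation of `f` to `[c, C]` on `(0, L)`, continued by `L⁻¹`. -/
def truncatedDensity (L c C : ℝ) (f : ℝ → ℝ) : ℝ → ℝ :=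
  (Ioo 0 L).piecewise (fun x => max c (min (f x) C)) fun _ => L⁻¹

lemma truncatedDensity_ae_eq {L c C : ℝ} {f : ℝ → ℝ}
    (hb : ∀ᵐ x ∂(volume.restrict (Ioo 0 L)), c ≤ f x ∧ f x ≤ C) :
    truncatedDensity L c C f =ᵐ[volume.restrict (Ioo 0 L)] f := by
  filter_upwards [hb, ae_restrict_mem measurableSet_Ioo] with x hx hx'
  rw [truncatedDensity, piecewise_eq_of_mem _ _ _ hx', min_eq_left hx.2, max_eq_right hx.1]

lemma isNormalizedDensity_truncatedDensity {L c C : ℝ} {f : ℝ → ℝ} (hL : 0 < L) (hc : 0 < c)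
    (hcL : c ≤ L⁻¹) (hLC : L⁻¹ ≤ C) (hf : Measurable f)
    (hb : ∀ᵐ x ∂(volume.restrict (Ioo 0 L)), c ≤ f x ∧ f x ≤ C)
    (h1 : ∫ x in Ioo 0 L, f x = 1) :
    IsNormalizedDensity L c C (truncatedDensity L c C f) where
  L_pos := hL
  c_pos := hc
  measurable := Measurable.piecewise measurableSet_Ioo (by fun_prop) measurable_const
  le x := by
    by_cases hx : x ∈ Ioo 0 L
    · rw [truncatedDensity, piecewise_eq_of_mem _ _ _ hx]; exact le_max_left _ _
    · rwa [truncatedDensity, piecewise_eq_of_notMem _ _ _ hx]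
  ge x := by
    by_cases hx : x ∈ Ioo 0 L
    · rw [truncatedDensity, piecewise_eq_of_mem _ _ _ hx]
      exact max_le (hcL.trans hLC) (min_le_right _ _)
    · rwa [truncatedDensity, piecewise_eq_of_notMem _ _ _ hx]
  integral := by rw [integral_congr_ae (truncatedDensity_ae_eq hb), h1]
  outside x hx := by rw [truncatedDensity, piecewise_eq_of_notMem _ _ _ hx]

lemma densityMeasure_congr {L : ℝ} {f g : ℝ → ℝ} (h : f =ᵐ[volume.restrict (Ioo 0 L)] g) :
    densityMeasure L f = densityMeasure L g :=
  withDensity_congr_ae (h.mono fun x hx => by simp only [hx])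

lemma ae_mem_of_eLpNorm_sub_lt {L δ : ℝ} {f : ℝ → ℝ} (hδ : δ ≤ 1 / (2 * L))
    (h : eLpNorm (fun x => f x - L⁻¹) ∞ (volume.restrict (Ioo 0 L)) < ENNReal.ofReal δ) :
    ∀ᵐ x ∂(volume.restrict (Ioo 0 L)), 1 / (2 * L) ≤ f x ∧ f x ≤ 3 / (2 * L) := by
  rw [eLpNorm_exponent_top] at h
  filter_upwards [ae_le_eLpNormEssSup (f := fun x => f x - L⁻¹)
    (μ := volume.restrict (Ioo 0 L))] with x hx
  have h1 := hx.trans_lt h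
  rw [← ofReal_norm, Real.norm_eq_abs] at h1
  have h2 := abs_lt.1 ((ENNReal.ofReal_lt_ofReal_iff_of_nonneg (abs_nonneg _)).1 h1)
  have h3 : 1 / (2 * L) = L⁻¹ / 2 := by rw [one_div, mul_inv]; ring
  have h4 : 3 / (2 * L) = 3 * (L⁻¹ / 2) := by rw [← h3]; ring
  rw [h4]
  rw [h3] at hδ ⊢
  constructor <;> linarith

lemma exists_isNormalizedDensity {L δ : ℝ} (hL : 0 < L) (hδ : δ ≤ 1 / (2 * L))
    {ρ : ProbabilityMeasure ℝ} (hρ : ρ ∈ nearUniform L δ) :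
    ∃ f, IsNormalizedDensity L (1 / (2 * L)) (3 / (2 * L)) f ∧
      (ρ : Measure ℝ) = densityMeasure L f := by
  obtain ⟨f, hf, h1, hδf, hd⟩ := hρ
  have hae := hf.1.ae_eq_mk
  have hb : ∀ᵐ x ∂(volume.restrict (Ioo 0 L)), 1 / (2 * L) ≤ hf.1.mk f x ∧
      hf.1.mk f x ≤ 3 / (2 * L) := by
    filter_upwards [hae, ae_mem_of_eLpNorm_sub_lt hδ hδf] with x hx hx'
    rwa [← hx]
  have hLi := inv_pos.2 hL
  have h3 : 1 / (2 * L) = L⁻¹ / 2 := by rw [one_div, mul_inv]; ring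
  have h4 : 3 / (2 * L) = 3 * (L⁻¹ / 2) := by rw [← h3]; ring
  refine ⟨truncatedDensity L (1 / (2 * L)) (3 / (2 * L)) (hf.1.mk f),
    isNormalizedDensity_truncatedDensity hL (by positivity) (by linarith) (by linarith)
      hf.1.stronglyMeasurable_mk.measurable hb (by rw [← integral_congr_ae hae, h1]), ?_⟩
  rw [densityMeasure_congr ((truncatedDensity_ae_eq hb).trans hae.symm)]
  exact hd

/-- The continuous density agrees almost everywhere with a bounded representative, and truncation
preserves continuity. Continuity is kept only on the open interval, because the continuation by
`L⁻¹` may jump at the endpoints. -/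
lemma exists_isNormalizedDensity_continuousOn {L δ : ℝ} (hL : 0 < L) (hδ : δ ≤ 1 / (2 * L))
    {ρ : ProbabilityMeasure ℝ} (hρ : ρ ∈ nearUniform L δ) {f : ℝ → ℝ}
    (hf : ContinuousOn f (Icc 0 L)) (hd : HasDensityOn L ρ f) :
    ∃ f, IsNormalizedDensity L (1 / (2 * L)) (3 / (2 * L)) f ∧ ContinuousOn f (Ioo 0 L) ∧
      (ρ : Measure ℝ) = densityMeasure L f := by
  obtain ⟨g, hg, hρg⟩ := exists_isNormalizedDensity hL hδ hρ
  set F : ℝ → ℝ := IccExtend hL.le ((Icc 0 L).domRestrict f) with hF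
  have hFc : Continuous F := (continuousOn_iff_continuous_domRestrict.1 hf).Icc_extend'
  have hFf : F =ᵐ[volume.restrict (Ioo 0 L)] f := by
    filter_upwards [ae_restrict_mem measurableSet_Ioo] with x hx
    exact IccExtend_of_mem _ _ (Ioo_subset_Icc_self hx)
  have hFg : F =ᵐ[volume.restrict (Ioo 0 L)] g := by
    have h1 : densityMeasure L F = densityMeasure L g := by
      rw [densityMeasure_congr hFf, ← hρg]; exact hd.symm
    have h2 := (withDensity_eq_iff_of_sigmaFinite
      hFc.measurable.ennreal_ofReal.aemeasurable hg.measurable.ennreal_ofReal.aemeasurable).1 h1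
    filter_upwards [h2] with x hx
    have h3 := hg.pos x
    have h4 : 0 < F x := by
      rw [← ENNReal.ofReal_pos, hx]; exact ENNReal.ofReal_pos.2 h3
    exact (ENNReal.ofReal_eq_ofReal_iff h4.le h3.le).1 hx
  have hb : ∀ᵐ x ∂(volume.restrict (Ioo 0 L)), 1 / (2 * L) ≤ F x ∧ F x ≤ 3 / (2 * L) := by
    filter_upwards [hFg] with x hx
    rw [hx]
    exact ⟨hg.le x, hg.ge x⟩
  have hLi := inv_pos.2 hL
  have h3 : 1 / (2 * L) = L⁻¹ / 2 := by rw [one_div, mul_inv]; ring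
  have h4 : 3 / (2 * L) = 3 * (L⁻¹ / 2) := by rw [← h3]; ring
  refine ⟨truncatedDensity L (1 / (2 * L)) (3 / (2 * L)) F,
    isNormalizedDensity_truncatedDensity hL (by positivity) (by linarith) (by linarith)
      hFc.measurable hb (by rw [integral_congr_ae hFg, hg.integral]), ?_, ?_⟩
  · refine ContinuousOn.congr (f := fun x => max (1 / (2 * L)) (min (F x) (3 / (2 * L))))
      (Continuous.continuousOn (by fun_prop)) fun x hx => piecewise_eq_of_mem _ _ _ hx
  · rw [hρg]
    exact densityMeasure_congr ((truncatedDensity_ae_eq hb).trans hFg).symm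

/-! ### Subtracting the transport cost, and Gamma-convergence. -/

namespace IsNormalizedDensity

variable {L c C : ℝ} {f f₀ : ℝ → ℝ}

variable (hf₀ : IsNormalizedDensity L c C f₀) (hf : IsNormalizedDensity L c C f)

include hf₀ hf

lemma wassersteinDist_sq_div {h : ℝ} (hh : 0 < h) :
    wassersteinDist (densityMeasure L f) (densityMeasure L f₀) ^ 2 / ENNReal.ofReal (4 * h) =
      ENNReal.ofReal ((∫ x, (x - transportMap f₀ f x) ^ 2 ∂(densityMeasure L f₀)) / (4 * h)) := by
  rw [wassersteinDist_sq hf₀ hf, ENNReal.ofReal_div_of_pos (by positivity)]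

lemma le_rateFunctional_sub {h : ℝ} (hh : 0 < h) :
    ((1 / 2 * entropy (densityMeasure L f) - 1 / 2 * entropy (densityMeasure L f₀) : ℝ) : EReal) ≤
      (rateFunctional h (densityMeasure L f) (densityMeasure L f₀) : EReal) -
        ((wassersteinDist (densityMeasure L f) (densityMeasure L f₀) ^ 2 /
          ENNReal.ofReal (4 * h) : ℝ≥0∞) : EReal) := by
  have h1 := EReal.coe_ennreal_le_coe_ennreal_iff.2 (ofReal_le_rateFunctional hf₀ hf hh)
  set W := ∫ x, (x - transportMap f₀ f x) ^ 2 ∂(densityMeasure L f₀) with hW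
  have hW0 : 0 ≤ W := integral_nonneg fun x => sq_nonneg _
  rw [wassersteinDist_sq_div hf₀ hf hh, ← hW, EReal.coe_ennreal_ofReal,
    max_eq_left (div_nonneg hW0 (by positivity))]
  rw [EReal.coe_ennreal_ofReal] at h1
  have h2 := EReal.sub_le_sub ((EReal.coe_le_coe_iff.2 (le_max_left _ _)).trans h1)
    (le_refl ((W / (4 * h) : ℝ) : EReal))
  rw [← EReal.coe_sub, add_sub_cancel_right] at h2
  exact h2

/-- Zero cost forces the rearrangement to be the identity almost everywhere. This handles the case
in which the diverging term `W / (4h)` is absent from the upper bound. -/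
lemma densityMeasure_eq_of_integral_eq_zero
    (h : ∫ x, (x - transportMap f₀ f x) ^ 2 ∂(densityMeasure L f₀) = 0) :
    densityMeasure L f = densityMeasure L f₀ := by
  have := hf₀.isProbabilityMeasure
  have hT := isMonotoneMap_transportMap hf₀ hf
  have hc := continuous_transportMap hf₀ hf
  have hi : Integrable (fun x => (x - transportMap f₀ f x) ^ 2) (densityMeasure L f₀) := by
    refine Integrable.of_bound (C := L ^ 2) (Continuous.aestronglyMeasurable (by fun_prop))
      (Eventually.of_forall fun x => ?_)
    rw [Real.norm_eq_abs, abs_of_nonneg (sq_nonneg _)]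
    have := abs_le.1 (hT.bound x)
    exact sq_le_sq' (by linarith) (by linarith)
  rw [integral_eq_zero_iff_of_nonneg (fun x => sq_nonneg _) hi] at h
  rw [← map_transportMap hf₀ hf]
  conv_rhs => rw [← Measure.map_id (μ := densityMeasure L f₀)]
  refine Measure.map_congr ?_
  filter_upwards [h] with x hx
  have : x - transportMap f₀ f x = 0 := by simpa using hx
  simp only [id]
  linarith

lemma eventually_rateFunctional_sub_le (hcont : ContinuousOn f₀ (Ioo 0 L)) {η : ℝ} (hη : 0 < η) :
    ∀ᶠ h in 𝓝[>] (0 : ℝ), (rateFunctional h (densityMeasure L f) (densityMeasure L f₀) : EReal) -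
        ((wassersteinDist (densityMeasure L f) (densityMeasure L f₀) ^ 2 /
          ENNReal.ofReal (4 * h) : ℝ≥0∞) : EReal) ≤
      ((1 / 2 * entropy (densityMeasure L f) - 1 / 2 * entropy (densityMeasure L f₀) + η : ℝ) :
        EReal) := by
  have hub := eventually_rateFunctional_le hf₀ hf hcont hη
  set W := ∫ x, (x - transportMap f₀ f x) ^ 2 ∂(densityMeasure L f₀) with hW
  have hW0 : 0 ≤ W := integral_nonneg fun x => sq_nonneg _
  -- The upper bound is stated through `ENNReal.ofReal`, so it is sharp only where its argument is
  -- nonnegative. Either the cost is positive and `W / (4h)` diverges, or the two measures coincide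
  -- and only `η` remains.
  have hpos : ∀ᶠ h in 𝓝[>] (0 : ℝ), 0 ≤ 1 / 2 * entropy (densityMeasure L f) -
      1 / 2 * entropy (densityMeasure L f₀) + η + W / (4 * h) := by
    rcases hW0.eq_or_lt with h0 | h0
    · rw [densityMeasure_eq_of_integral_eq_zero hf₀ hf h0.symm, ← h0]
      refine Eventually.of_forall fun h => ?_
      simp [hη.le]
    · have h1 : Tendsto (fun h : ℝ => W / 4 * h⁻¹) (𝓝[>] 0) atTop :=
        tendsto_inv_nhdsGT_zero.const_mul_atTop (by positivity)
      filter_upwards [h1.eventually_ge_atTop (-(1 / 2 * entropy (densityMeasure L f) -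
        1 / 2 * entropy (densityMeasure L f₀) + η))] with h hh
      have : W / (4 * h) = W / 4 * h⁻¹ := by rw [div_mul_eq_div_div, div_eq_mul_inv (W / 4)]
      linarith
  filter_upwards [hub, hpos, self_mem_nhdsWithin] with h h1 h2 h3
  rw [wassersteinDist_sq_div hf₀ hf h3, ← hW, EReal.coe_ennreal_ofReal,
    max_eq_left (div_nonneg hW0 (mul_pos four_pos h3).le)]
  have h4 := EReal.coe_ennreal_le_coe_ennreal_iff.2 h1
  rw [EReal.coe_ennreal_ofReal, max_eq_left h2] at h4
  have h5 := EReal.sub_le_sub h4 (le_refl ((W / (4 * h) : ℝ) : EReal))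
  rwa [← EReal.coe_sub, add_sub_cancel_right] at h5

end IsNormalizedDensity

end

theorem mainTheorem1 (L : ℝ) (hL : 0 < L) :
    ∃ δ₀ : ℝ, 0 < δ₀ ∧ δ₀ < 1 ∧ ∀ δ : ℝ, 0 < δ → δ ≤ δ₀ →
      ∀ ρ₀ ∈ nearUniform L δ,
        (∃ f₀ : ℝ → ℝ, ContinuousOn f₀ (Icc 0 L) ∧ HasDensityOn L ρ₀ f₀) →
        GammaConvergesOn (nearUniform L δ)
          (fun h ρ => (rateFunctional h ρ ρ₀ : EReal) -
            ((wassersteinDist ρ ρ₀ ^ 2 / ENNReal.ofReal (4 * h) : ℝ≥0∞) : EReal))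
          (fun ρ => ((1 / 2 * entropy ρ - 1 / 2 * entropy ρ₀ : ℝ) : EReal)) := by
  -- The bound `1 / (2L)` keeps all densities in `[1/(2L), 3/(2L)]`; the bound `1/2` only ensures
  -- `δ₀ < 1`.
  refine ⟨min (1 / 2) (1 / (2 * L)), by positivity, (min_le_left _ _).trans_lt (by norm_num),
    fun δ _ hδ ρ₀ hρ₀ ⟨g₀, hg₀, hd₀⟩ => ?_⟩
  have hδ' : δ ≤ 1 / (2 * L) := hδ.trans (min_le_right _ _)
  obtain ⟨f₀, hf₀, hcont, hρf₀⟩ := exists_isNormalizedDensity_continuousOn hL hδ' hρ₀ hg₀ hd₀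
  -- The recovery family is constant.
  refine ⟨fun ρ hρ u hu hlim => ?_, fun ρ hρ => ⟨fun _ => ρ, fun _ _ => hρ,
    tendsto_const_nhds, ?_⟩⟩
  · obtain ⟨f, hf, hρf⟩ := exists_isNormalizedDensity hL hδ' hρ
    have hu' : ∀ᶠ h in 𝓝[>] (0 : ℝ), ∃ g, IsNormalizedDensity L (1 / (2 * L)) (3 / (2 * L)) g ∧
        (u h : Measure ℝ) = densityMeasure L g := by
      filter_upwards [self_mem_nhdsWithin] with h hh
      exact exists_isNormalizedDensity hL hδ' (hu h hh)
    refine le_of_forall_lt fun b hb => ?_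
    obtain ⟨r, hbr, hr⟩ := EReal.lt_iff_exists_real_btwn.1 hb
    refine hbr.trans_le ?_
    have hr' := EReal.coe_lt_coe_iff.1 hr
    refine le_liminf_of_le (by isBoundedDefault) ?_
    -- The lower bound holds at each `h`, so only the entropy of `u h` has to be followed; the level
    -- `2r + E(ρ₀)` is the condition `r < ½E - ½E(ρ₀)` solved for `E`.
    filter_upwards [hf.eventually_lt_entropy hρf hu' hlim
      (E := 2 * r + entropy ρ₀) (by linarith), hu', self_mem_nhdsWithin] with h h1 ⟨g, hg, hug⟩ hh
    have h2 := hf₀.le_rateFunctional_sub hg hh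
    rw [← hug, ← hρf₀] at h2
    exact (EReal.coe_le_coe_iff.2 (by linarith)).trans h2
  · obtain ⟨f, hf, hρf⟩ := exists_isNormalizedDensity hL hδ' hρ
    simp only [hρf, hρf₀]
    refine tendsto_order.2 ⟨fun b hb => ?_, fun b hb => ?_⟩
    · filter_upwards [self_mem_nhdsWithin] with h hh
      exact hb.trans_le (hf₀.le_rateFunctional_sub hf hh)
    · obtain ⟨r, hr, hrb⟩ := EReal.lt_iff_exists_real_btwn.1 hb
      have hr' := sub_pos.2 (EReal.coe_lt_coe_iff.1 hr)
      filter_upwards [hf₀.eventually_rateFunctional_sub_le hf hcont hr'] with h hh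
      refine (hh.trans_eq ?_).trans_lt hrb
      rw [add_sub_cancel]
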